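/- Let $G$ be a compact connected Lie group with Lie algebra $\mathfrak g$, let $\{\xi_a\}$ be a basis of $\mathfrak g$, and let $\theta^a$ and $\Theta^a$ denote the dual basis of $\mathfrak g^*$ regarded in $\Lambda^1(\mathfrak g^*)$ and in $S^1(\mathfrak g^*)$ respectively. Let $W$ be a compact smooth $G$-manifold, possibly with boundary, such that the action is locally free on an open subset of $W$ containing $\partial W$. For $\xi\in\mathfrak g$ let $X_\xi(x)=\frac{d}{dt}\big|_{t=0}\exp(-t\xi)\cdot x$, so that $\xi\mapsto X_\xi$ is a homomorphism of Lie algebras, and let $\iota_a$ be the contraction of differential forms on $W$ with $X_{\xi_a}$. Let $$\Omega_G(W)=(S(\mathfrak g^*)\otimes\Omega(W))^G,\qquad D=1\otimes d-\sum_a\Theta^a\otimes\iota_a,$$ with the total degree in which $S^p(\mathfrak g^*)\otimes\Omega^q(W)$ has degree $2p+q$. Let $W^s\subset W$ be the set of points whose stabilizer has positive dimension and $W^0=W\setminus W^s$. Let $f:W\to[0,1]$ be a smooth $G$-invariant function which vanishes on an open neighborhood of $W^s$ and is identically $1$ outside a larger open neighborhood. Let $\omega$ be a connection on $W^0$, i.e.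 a smooth $\mathfrak g$-valued $1$-form on $W^0$ with $\omega(X_\xi)=\xi$ for $\xi\in\mathfrak g$ and $g^*\omega=\mathrm{Ad}_g\,\omega$ for $g\in G$. Define the degenerate connection and its degenerate equivariant curvature by $$\omega_f=f\omega=\sum_a\xi_a\,\omega_f^a,\qquad \Omega_f^G=d\omega_f+\tfrac12[\omega_f,\omega_f]-(-1+f)\sum_a\xi_a\Theta^a=\sum_a\xi_a\,(\Omega_f^G)^a ,$$ where $\omega_f$ is extended by $0$ to $W$ and $(\Omega_f^G)^a\in S(\mathfrak g^*)\otimes\Omega(W)$. Let $W(\mathfrak g)=\Lambda(\mathfrak g^*)\otimes S(\mathfrak g^*)$ be the Weil algebra, let $CW_f^w:W(\mathfrak g)\otimes\Omega(W)\to S(\mathfrak g^*)\otimes\Omega(W)$ be the $\Omega(W)$-module extension of the algebra homomorphism $W(\mathfrak g)\to S(\mathfrak g^*)\otimes\Omega(W)$ with $\theta^a\mapsto\omega_f^a$, $\Theta^a\mapsto(\Omega_f^G)^a$, and let $\Psi=\prod_a(1-\theta^a\otimes\iota_a)$ on $W(\mathfrak g)\otimes\Omega(W)$, with the sign rule $(\theta^a\otimes\iota_a)(w\otimes\beta)=(-1)^{\deg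 w}\,\theta^a w\otimes\iota_a\beta$. Define $$r_f^G=CW_f^w\circ\Psi:\ S(\mathfrak g^*)\otimes\Omega(W)\to S(\mathfrak g^*)\otimes\Omega(W),$$ where $S(\mathfrak g^*)\otimes\Omega(W)\subset W(\mathfrak g)\otimes\Omega(W)$. Then $D$ maps $\Omega_G(W)$ to itself and $D^2=0$ there; $r_f^G$ maps $\Omega_G(W)$ to itself, preserves the total degree, and satisfies $D\,r_f^G=r_f^G\,D$ on $\Omega_G(W)$. Hence there is a unique linear map $(r_f^G)_*$ on the equivariant cohomology $H_G^*(W)=\ker D/\operatorname{im}D$ of $(\Omega_G(W),D)$ with $(r_f^G)_*[\alpha]=[r_f^G\alpha]$ for every closed $\alpha\in\Omega_G(W)$. -/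

import Mathlib

open scoped Manifold ContDiff

noncomputable section

namespace DegenerateChernWeil

set_option linter.unusedSectionVars false

open Set Filter
open scoped TensorProduct Topology


/-! ### The exterior algebra `Λ(E*)` of a finite-dimensional real vector space -/

section Exterior

variable {E : Type*} [NormedAddCommGroup E] [NormedSpace ℝ E]

/-- The exterior algebra `Λ(E*)` on the dual of `E`. -/
abbrev Ext (E : Type*) [NormedAddCommGroup E] [NormedSpace ℝ E] : Type _ :=
  ExteriorAlgebra ℝ (Module.Dual ℝ E)

/-- The algebra map `Λ(E*) → Λ(E*)` induced by a linear endomorphism `A` of `E` (pullback by `A`). -/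
def extPull (A : E →L[ℝ] E) : Ext E →ₐ[ℝ] Ext E :=
  ExteriorAlgebra.map (Module.Dual.transpose (R := ℝ) (A : E →ₗ[ℝ] E))

/-- Contraction of an exterior form with the vector `v`: the antiderivation of `Λ(E*)` with
`φ ↦ φ v` on covectors. -/
def extContract : E →ₗ[ℝ] Ext E →ₗ[ℝ] Ext E :=
  CliffordAlgebra.contractLeft.comp (Module.Dual.eval ℝ E)

theorem extPull_ι (A : E →L[ℝ] E) (φ : Module.Dual ℝ E) :
    extPull A (ExteriorAlgebra.ι ℝ φ) = ExteriorAlgebra.ι ℝ (φ ∘ₗ (A : E →ₗ[ℝ] E)) := by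
  simp [extPull, ExteriorAlgebra.map_apply_ι, Module.Dual.transpose_apply]

theorem extPull_comp (A B : E →L[ℝ] E) (x : Ext E) :
    extPull A (extPull B x) = extPull (B.comp A) x := by
  have : (extPull A).comp (extPull B) = extPull (B.comp A) := by
    apply ExteriorAlgebra.hom_ext
    ext φ
    simp [extPull_ι, LinearMap.comp_assoc]
  exact DFunLike.congr_fun this x

theorem extPull_id (x : Ext E) : extPull (ContinuousLinearMap.id ℝ E) x = x := by
  have : extPull (ContinuousLinearMap.id ℝ E) = AlgHom.id ℝ (Ext E) := by
    apply ExteriorAlgebra.hom_ext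
    ext φ
    simp [extPull_ι]
  exact DFunLike.congr_fun this x

theorem extContract_ι_mul (v : E) (φ : Module.Dual ℝ E) (x : Ext E) :
    extContract v (ExteriorAlgebra.ι ℝ φ * x) =
      φ v • x - ExteriorAlgebra.ι ℝ φ * extContract v x := by
  exact CliffordAlgebra.contractLeft_ι_mul (Q := 0) (d := Module.Dual.eval ℝ E v) φ x

theorem extContract_extPull (A : E →L[ℝ] E) (v : E) (x : Ext E) :
    extContract v (extPull A x) = extPull A (extContract (A v) x) := by
  induction x using CliffordAlgebra.left_induction with
  | algebraMap r => simp [extContract, AlgHom.commutes]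
  | add x y hx hy => simp [hx, hy]
  | ι_mul x φ hx =>
    change extContract v (extPull A (ExteriorAlgebra.ι ℝ φ * x)) =
      extPull A (extContract (A v) (ExteriorAlgebra.ι ℝ φ * x))
    rw [extContract_ι_mul, map_mul, extPull_ι, extContract_ι_mul, hx]
    simp [extPull_ι]

/-- A covector anticommutes with odd forms and commutes with even ones. -/
theorem ι_mul_eq_involute_mul (φ : Module.Dual ℝ E) (x : Ext E) :
    ExteriorAlgebra.ι ℝ φ * x = CliffordAlgebra.involute x * ExteriorAlgebra.ι ℝ φ := by
  induction x using CliffordAlgebra.left_induction with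
  | algebraMap r => simp [AlgHom.commutes, Algebra.commutes]
  | add x y hx hy => simp [mul_add, add_mul, hx, hy]
  | ι_mul x ψ hx =>
    have h := ExteriorAlgebra.ι_add_mul_swap (R := ℝ) φ ψ
    change ExteriorAlgebra.ι ℝ φ * (ExteriorAlgebra.ι ℝ ψ * x) =
      CliffordAlgebra.involute (ExteriorAlgebra.ι ℝ ψ * x) * ExteriorAlgebra.ι ℝ φ
    have h2 : CliffordAlgebra.involute (ExteriorAlgebra.ι ℝ ψ) = -ExteriorAlgebra.ι ℝ ψ :=
      CliffordAlgebra.involute_ι ψ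
    rw [map_mul, h2, mul_assoc, ← hx, ← mul_assoc, ← mul_assoc, eq_neg_of_add_eq_zero_left h]
    simp

/-- A product of two covectors commutes with every form. -/
theorem commute_ι_mul_ι (φ ψ : Module.Dual ℝ E) (x : Ext E) :
    (ExteriorAlgebra.ι ℝ φ * ExteriorAlgebra.ι ℝ ψ) * x =
      x * (ExteriorAlgebra.ι ℝ φ * ExteriorAlgebra.ι ℝ ψ) := by
  rw [mul_assoc, ι_mul_eq_involute_mul ψ, ← mul_assoc, ι_mul_eq_involute_mul φ,
    CliffordAlgebra.involute_involute, mul_assoc]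

variable [FiniteDimensional ℝ E]

instance extFiniteDimensional : FiniteDimensional ℝ (Ext E) :=
  Module.Basis.finiteDimensional_of_finite
    (Module.Basis.ExteriorAlgebra (Module.finBasis ℝ (Module.Dual ℝ E)))

/-- A norm on the finite-dimensional space `Λ(E*)`; only its (unique) topology and the resulting
notions of differentiability are used. -/
instance extNormedAddCommGroup : NormedAddCommGroup (Ext E) :=
  NormedAddCommGroup.induced (Ext E) (Fin (Module.finrank ℝ (Ext E)) → ℝ)
    (Module.finBasis ℝ (Ext E)).equivFun.toLinearMap
    (Module.finBasis ℝ (Ext E)).equivFun.injective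

instance extNormedSpace : NormedSpace ℝ (Ext E) :=
  NormedSpace.induced ℝ (Ext E) (Fin (Module.finrank ℝ (Ext E)) → ℝ)
    (Module.finBasis ℝ (Ext E)).equivFun.toLinearMap

/-- The exterior derivative of a form `β` on a subset `s` of the vector space `E`:
`dβ = ∑ᵢ dxⁱ ∧ ∂ᵢβ`. -/
def coordD (s : Set E) (β : E → Ext E) (y : E) : Ext E :=
  ∑ i, ExteriorAlgebra.ι ℝ ((Module.finBasis ℝ E).coord i) *
    fderivWithin ℝ β s y (Module.finBasis ℝ E i)

def extMulL : Ext E →L[ℝ] Ext E →L[ℝ] Ext E :=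
  LinearMap.toContinuousBilinearMap (LinearMap.mul ℝ (Ext E))

theorem extMulL_apply (x y : Ext E) : extMulL x y = x * y := rfl

theorem contDiffWithinAt_ext_mul {F : Type*} [NormedAddCommGroup F] [NormedSpace ℝ F]
    {n : ℕ∞ω} {s : Set F} {y : F} {a b : F → Ext E}
    (ha : ContDiffWithinAt ℝ n a s y) (hb : ContDiffWithinAt ℝ n b s y) :
    ContDiffWithinAt ℝ n (fun z => a z * b z) s y :=
  ((extMulL (E := E)).contDiff.contDiffAt.comp_contDiffWithinAt y ha).clm_apply hb

theorem contDiffWithinAt_ext_contract {F : Type*} [NormedAddCommGroup F] [NormedSpace ℝ F]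
    {n : ℕ∞ω} {s : Set F} {y : F} {v : F → E} {b : F → Ext E}
    (hv : ContDiffWithinAt ℝ n v s y) (hb : ContDiffWithinAt ℝ n b s y) :
    ContDiffWithinAt ℝ n (fun z => extContract (v z) (b z)) s y :=
  ((LinearMap.toContinuousBilinearMap (extContract (E := E))).contDiff.contDiffAt.comp_contDiffWithinAt
    y hv).clm_apply hb

/-- The linear map `A ↦ A^* φ`. -/
def compιL (φ : Module.Dual ℝ E) : (E →L[ℝ] E) →L[ℝ] Ext E :=
  LinearMap.toContinuousLinearMap
    { toFun := fun A => ExteriorAlgebra.ι ℝ (φ ∘ₗ (A : E →ₗ[ℝ] E))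
      map_add' := by
        intro A B
        rw [← map_add]
        congr 1
        ext v
        simp
      map_smul' := by
        intro c A
        rw [RingHom.id_apply, ← map_smul]
        congr 1
        ext v
        simp }

/-- `A ↦ A^*` is smooth, pointwise on `Λ(E*)`. -/
theorem contDiff_extPull_apply (x : Ext E) :
    ContDiff ℝ ∞ (fun A : E →L[ℝ] E => extPull A x) := by
  rw [contDiff_iff_contDiffAt]
  intro A
  rw [← contDiffWithinAt_univ]
  induction x using ExteriorAlgebra.induction with
  | algebraMap r => simpa [AlgHom.commutes] using contDiffWithinAt_const
  | ι φ =>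
    have : (fun A : E →L[ℝ] E => extPull A (ExteriorAlgebra.ι ℝ φ)) = compιL φ := by
      funext A
      exact extPull_ι A φ
    rw [this]
    exact (compιL φ).contDiff.contDiffWithinAt
  | mul a b ha hb => simpa [map_mul] using contDiffWithinAt_ext_mul ha hb
  | add a b ha hb => simpa [map_add] using ha.add hb

def extPullL (A : E →L[ℝ] E) : Ext E →L[ℝ] Ext E :=
  LinearMap.toContinuousLinearMap (extPull A).toLinearMap

theorem extPullL_apply (A : E →L[ℝ] E) (x : Ext E) : extPullL A x = extPull A x := rfl

theorem contDiff_extPullL : ContDiff ℝ ∞ (extPullL (E := E)) := by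
  rw [contDiff_clm_apply_iff]
  exact contDiff_extPull_apply

theorem coordD_congr {s : Set E} {β γ : E → Ext E} {y : E} (hy : y ∈ s) (h : β =ᶠ[𝓝[s] y] γ) :
    coordD s β y = coordD s γ y := by
  simp only [coordD, h.fderivWithin_eq_of_mem hy]

theorem fderivWithin_ext_mul {s : Set E} {a b : E → Ext E} {y : E} (hs : UniqueDiffWithinAt ℝ s y)
    (ha : DifferentiableWithinAt ℝ a s y) (hb : DifferentiableWithinAt ℝ b s y) (v : E) :
    fderivWithin ℝ (fun z => a z * b z) s y v =
      fderivWithin ℝ a s y v * b y + a y * fderivWithin ℝ b s y v := by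
  have h := (((extMulL (E := E)).hasFDerivAt.comp_hasFDerivWithinAt y
    ha.hasFDerivWithinAt).clm_apply hb.hasFDerivWithinAt).fderivWithin hs
  have h' : fderivWithin ℝ (fun z => a z * b z) s y = _ := h
  rw [h']
  simp [extMulL_apply, add_comm]

/-- The graded Leibniz rule. -/
theorem coordD_mul {s : Set E} {a b : E → Ext E} {y : E} (hs : UniqueDiffWithinAt ℝ s y)
    (ha : DifferentiableWithinAt ℝ a s y) (hb : DifferentiableWithinAt ℝ b s y) :
    coordD s (fun z => a z * b z) y =
      coordD s a y * b y + CliffordAlgebra.involute (a y) * coordD s b y := by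
  simp only [coordD, fderivWithin_ext_mul hs ha hb, mul_add, Finset.sum_add_distrib,
    Finset.sum_mul, Finset.mul_sum]
  congr 1
  · simp only [mul_assoc]
  · refine Finset.sum_congr rfl fun i _ => ?_
    rw [← mul_assoc, ι_mul_eq_involute_mul, mul_assoc]

theorem ι_eq_sum (φ : Module.Dual ℝ E) : ExteriorAlgebra.ι ℝ φ =
    ∑ i, φ (Module.finBasis ℝ E i) • ExteriorAlgebra.ι ℝ ((Module.finBasis ℝ E).coord i) := by
  have : φ = ∑ i, φ (Module.finBasis ℝ E i) • (Module.finBasis ℝ E).coord i := by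
    refine (Module.finBasis ℝ E).ext fun j => ?_
    simp
  calc ExteriorAlgebra.ι ℝ φ
      = ExteriorAlgebra.ι ℝ (∑ i, φ (Module.finBasis ℝ E i) • (Module.finBasis ℝ E).coord i) := by
        rw [← this]
    _ = _ := by rw [map_sum]; simp only [map_smul]

theorem sum_ι_mul_extPull (A : E →L[ℝ] E) (L : E →L[ℝ] Ext E) :
    ∑ i, ExteriorAlgebra.ι ℝ ((Module.finBasis ℝ E).coord i) *
        extPull A (L (A (Module.finBasis ℝ E i))) =
      extPull A (∑ i, ExteriorAlgebra.ι ℝ ((Module.finBasis ℝ E).coord i) *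
        L (Module.finBasis ℝ E i)) := by
  simp only [map_sum, map_mul, extPull_ι]
  have h1 : ∀ i, L (A (Module.finBasis ℝ E i)) =
      ∑ j, (Module.finBasis ℝ E).coord j (A (Module.finBasis ℝ E i)) •
        L (Module.finBasis ℝ E j) := by
    intro i
    calc L (A (Module.finBasis ℝ E i))
        = L (∑ j, (Module.finBasis ℝ E).repr (A (Module.finBasis ℝ E i)) j •
            Module.finBasis ℝ E j) := by
          rw [(Module.finBasis ℝ E).sum_repr]
      _ = _ := by rw [map_sum]; simp only [map_smul, Module.Basis.coord_apply]
  have h2 : ∀ j, ExteriorAlgebra.ι ℝ ((Module.finBasis ℝ E).coord j ∘ₗ (A : E →ₗ[ℝ] E)) =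
      ∑ i, (Module.finBasis ℝ E).coord j (A (Module.finBasis ℝ E i)) •
        ExteriorAlgebra.ι ℝ ((Module.finBasis ℝ E).coord i) := by
    intro j
    rw [ι_eq_sum]
    simp
  simp only [h1, h2, map_sum, map_smul, Finset.mul_sum, Finset.sum_mul, mul_smul_comm,
    smul_mul_assoc]
  rw [Finset.sum_comm]

/-- The pullback of a constant form by a smooth map is closed. -/
theorem coordD_extPull_const {s : Set E} {τ : E → E} {y : E} (hs : UniqueDiffOn ℝ s) (hy : y ∈ s)
    (hy' : y ∈ closure (interior s)) (hτ : ContDiffWithinAt ℝ ∞ τ s y) (x : Ext E) :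
    coordD s (fun z => extPull (fderivWithin ℝ τ s z) x) y = 0 := by
  have hD : ContDiffWithinAt ℝ ∞ (fderivWithin ℝ τ s) s y :=
    hτ.fderivWithin_right hs (by simp) hy
  have hdiff : ∀ x : Ext E,
      DifferentiableWithinAt ℝ (fun z => extPull (fderivWithin ℝ τ s z) x) s y := fun x =>
    ((contDiff_extPull_apply x).contDiffAt.comp_contDiffWithinAt y hD).differentiableWithinAt
      (by simp)
  induction x using ExteriorAlgebra.induction with
  | algebraMap r => simp [coordD, AlgHom.commutes]
  | ι φ =>
    have h1 : (fun z => extPull (fderivWithin ℝ τ s z) (ExteriorAlgebra.ι ℝ φ)) =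
        fun z => compιL φ (fderivWithin ℝ τ s z) := by
      funext z
      exact extPull_ι _ φ
    have h2 : ∀ v, fderivWithin ℝ (fun z => compιL φ
        (fderivWithin ℝ τ s z)) s y v =
        ExteriorAlgebra.ι ℝ (φ ∘ₗ (fderivWithin ℝ (fderivWithin ℝ τ s) s y v : E →ₗ[ℝ] E)) := by
      intro v
      have := ((compιL φ).hasFDerivAt.comp_hasFDerivWithinAt y
        (hD.differentiableWithinAt (by simp)).hasFDerivWithinAt).fderivWithin (hs y hy)
      have h3 : fderivWithin ℝ (fun z => compιL φ
        (fderivWithin ℝ τ s z)) s y = _ := this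
      rw [h3]
      rfl
    have hsymm : IsSymmSndFDerivWithinAt ℝ τ s y :=
      hτ.isSymmSndFDerivWithinAt (by simpa using ENat.LEInfty.out) hs hy' hy
    simp only [coordD, h1, h2]
    set b := Module.finBasis ℝ E
    have h4 : ∀ i, ExteriorAlgebra.ι ℝ (φ ∘ₗ (fderivWithin ℝ (fderivWithin ℝ τ s) s y (b i) :
        E →ₗ[ℝ] E)) = ∑ j, φ (fderivWithin ℝ (fderivWithin ℝ τ s) s y (b i) (b j)) •
          ExteriorAlgebra.ι ℝ (b.coord j) := fun i => ι_eq_sum _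
    simp only [h4, Finset.mul_sum, mul_smul_comm]
    have h5 : (∑ i, ∑ j, φ (fderivWithin ℝ (fderivWithin ℝ τ s) s y (b i) (b j)) •
        (ExteriorAlgebra.ι ℝ (b.coord i) * ExteriorAlgebra.ι ℝ (b.coord j))) =
        -(∑ i, ∑ j, φ (fderivWithin ℝ (fderivWithin ℝ τ s) s y (b i) (b j)) •
        (ExteriorAlgebra.ι ℝ (b.coord i) * ExteriorAlgebra.ι ℝ (b.coord j))) := by
      conv_lhs => rw [Finset.sum_comm]
      simp only [← Finset.sum_neg_distrib]
      refine Finset.sum_congr rfl fun i _ => Finset.sum_congr rfl fun j _ => ?_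
      rw [hsymm.eq (b j) (b i), eq_neg_of_add_eq_zero_left
        (ExteriorAlgebra.ι_add_mul_swap (R := ℝ) (b.coord j) (b.coord i)), smul_neg]
    have h6 := eq_neg_iff_add_eq_zero.mp h5
    rw [← two_smul ℝ] at h6
    exact (smul_eq_zero.mp h6).resolve_left two_ne_zero
  | mul a b ha hb =>
    simp only [map_mul]
    rw [coordD_mul (hs y hy) (hdiff a) (hdiff b), ha, hb]
    simp
  | add a b ha hb =>
    have : coordD s (fun z => extPull (fderivWithin ℝ τ s z) (a + b)) y =
        coordD s (fun z => extPull (fderivWithin ℝ τ s z) a) y +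
        coordD s (fun z => extPull (fderivWithin ℝ τ s z) b) y := by
      simp only [coordD, map_add, ← Finset.sum_add_distrib, ← mul_add]
      rw [fderivWithin_fun_add (hs y hy) (hdiff a) (hdiff b)]
      rfl
    rw [this, ha, hb, add_zero]

/-- Naturality of the exterior derivative under smooth maps. -/
theorem coordD_pullback {s t : Set E} {τ : E → E} {y : E} {β : E → Ext E}
    (hs : UniqueDiffOn ℝ s) (hy : y ∈ s) (hy' : y ∈ closure (interior s))
    (hτ : ContDiffWithinAt ℝ ∞ τ s y) (hst : MapsTo τ s t)
    (hβ : DifferentiableWithinAt ℝ β t (τ y)) :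
    coordD s (fun z => extPull (fderivWithin ℝ τ s z) (β (τ z))) y =
      extPull (fderivWithin ℝ τ s y) (coordD t β (τ y)) := by
  have hD : ContDiffWithinAt ℝ ∞ (fderivWithin ℝ τ s) s y :=
    hτ.fderivWithin_right hs (by simp) hy
  have hM : DifferentiableWithinAt ℝ (fun z => extPullL (fderivWithin ℝ τ s z)) s y :=
    (contDiff_extPullL.contDiffAt.comp_contDiffWithinAt y hD).differentiableWithinAt (by simp)
  have hτd := (hτ.differentiableWithinAt (by simp)).hasFDerivWithinAt
  have hc := hβ.hasFDerivWithinAt.comp y hτd hst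
  have hprod : fderivWithin ℝ (fun z => extPull (fderivWithin ℝ τ s z) (β (τ z))) s y = _ :=
    (hM.hasFDerivWithinAt.clm_apply hc).fderivWithin (hs y hy)
  have hconst : ∀ v, fderivWithin ℝ (fun z => extPull (fderivWithin ℝ τ s z) (β (τ y))) s y v =
      fderivWithin ℝ (fun z => extPullL (fderivWithin ℝ τ s z)) s y v (β (τ y)) := by
    intro v
    have : fderivWithin ℝ (fun z => extPull (fderivWithin ℝ τ s z) (β (τ y))) s y = _ :=
      (hM.hasFDerivWithinAt.clm_apply (hasFDerivWithinAt_const (β (τ y)) y s)).fderivWithin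
        (hs y hy)
    rw [this]
    simp
  have h0 := coordD_extPull_const hs hy hy' hτ (β (τ y))
  simp only [coordD, hconst] at h0
  simp only [coordD, hprod]
  rw [← sum_ι_mul_extPull, ← sub_eq_zero, ← Finset.sum_sub_distrib, ← h0]
  refine Finset.sum_congr rfl fun i _ => ?_
  simp [extPullL_apply, mul_add]

/-- The derivative of a function with values in the covectors has values in the covectors. -/
theorem fderivWithin_mem_range_ι {s : Set E} {y : E} {β : E → Ext E}
    (hs : UniqueDiffWithinAt ℝ s y) (hd : DifferentiableWithinAt ℝ β s y)
    (hβ : ∀ z, ∃ ψ : Module.Dual ℝ E, β z = ExteriorAlgebra.ι ℝ ψ) (v : E) :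
    ∃ ψ : Module.Dual ℝ E, fderivWithin ℝ β s y v = ExteriorAlgebra.ι ℝ ψ := by
  let L : Ext E →L[ℝ] Ext E := LinearMap.toContinuousLinearMap
    ((ExteriorAlgebra.ι ℝ).comp (ExteriorAlgebra.ιInv (R := ℝ) (M := Module.Dual ℝ E)))
  have hL : ∀ z, L (β z) = β z := by
    intro z
    obtain ⟨ψ, hψ⟩ := hβ z
    rw [hψ]
    exact congrArg (ExteriorAlgebra.ι ℝ) (ExteriorAlgebra.ι_leftInverse ψ)
  have h1 : fderivWithin ℝ (fun z => L (β z)) s y = L.comp (fderivWithin ℝ β s y) :=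
    (L.hasFDerivAt.comp_hasFDerivWithinAt y hd.hasFDerivWithinAt).fderivWithin hs
  simp only [hL] at h1
  refine ⟨ExteriorAlgebra.ιInv (fderivWithin ℝ β s y v), ?_⟩
  conv_lhs => rw [h1]
  rfl

end Exterior

/-! ### Differential forms on a manifold, possibly with boundary -/

section Forms

variable {E : Type*} [NormedAddCommGroup E] [NormedSpace ℝ E]
  {H : Type*} [TopologicalSpace H] (I : ModelWithCorners ℝ E H)
  {M : Type*} [TopologicalSpace M] [ChartedSpace H M]

/- A (not necessarily smooth) differential form on `M` is a section `α` of the bundle `Λ(T*M)`,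
i.e. a family `α x ∈ Λ((T_x M)*)`. Mathlib's `TangentSpace I x` is by definition the model space `E`
(a tangent vector at `x` is read in the preferred chart at `x`), so such a section is a function
`M → Ext E`; the wedge product is the pointwise product. -/

/-- The derivative at `x` of `φ : M → M`. -/
def tangentD (φ : M → M) (x : M) : E →L[ℝ] E := mfderiv I I φ x

/-- The derivative at `x` of the (extended) chart at `x₀`. -/
def chartD (x₀ x : M) : E →L[ℝ] E := mfderiv I 𝓘(ℝ, E) (extChartAt I x₀) x

/-- The derivative at `y` of the inverse of the (extended) chart at `x₀`. -/
def chartSymmD (x₀ : M) (y : E) : E →L[ℝ] E :=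
  mfderivWithin 𝓘(ℝ, E) I (extChartAt I x₀).symm (range I) y

/-- The form `α` read in the chart at `x₀`: its pullback by the inverse of that chart. -/
def chartRep (α : M → Ext E) (x₀ : M) (y : E) : Ext E :=
  extPull (chartSymmD I x₀ y) (α ((extChartAt I x₀).symm y))

/-- The pullback `φ^* α`. -/
def pullForm (φ : M → M) (α : M → Ext E) (x : M) : Ext E :=
  extPull (tangentD I φ x) (α (φ x))

variable [FiniteDimensional ℝ E]

/-- `α` is smooth at `x₀`: it has smooth coefficients in the chart at `x₀`. -/
def SmoothFormAt (α : M → Ext E) (x₀ : M) : Prop :=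
  ContDiffWithinAt ℝ ∞ (chartRep I α x₀) (range I) (extChartAt I x₀ x₀)

/-- The exterior derivative at `x`, computed in the chart at `x`. -/
def dForm (α : M → Ext E) (x : M) : Ext E :=
  extPull (chartD I x x)
    (coordD (range I) (chartRep I α x) (extChartAt I x x))

variable {I}

theorem SmoothFormAt.add {α β : M → Ext E} {x : M} (hα : SmoothFormAt I α x)
    (hβ : SmoothFormAt I β x) : SmoothFormAt I (α + β) x := by
  have : chartRep I (α + β) x = fun y => chartRep I α x y + chartRep I β x y := by
    funext y
    simp [chartRep]
  rw [SmoothFormAt, this]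
  exact ContDiffWithinAt.add hα hβ

theorem SmoothFormAt.mul {α β : M → Ext E} {x : M} (hα : SmoothFormAt I α x)
    (hβ : SmoothFormAt I β x) : SmoothFormAt I (α * β) x := by
  have : chartRep I (α * β) x = fun y => chartRep I α x y * chartRep I β x y := by
    funext y
    simp [chartRep]
  rw [SmoothFormAt, this]
  exact contDiffWithinAt_ext_mul hα hβ

theorem smoothFormAt_congr {α β : M → Ext E} {x : M} (hα : SmoothFormAt I α x)
    (h : β =ᶠ[𝓝 x] α) : SmoothFormAt I β x := by
  refine ContDiffWithinAt.congr_of_eventuallyEq hα ?_ ?_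
  · have hc : Tendsto (extChartAt I x).symm (𝓝[range I] (extChartAt I x x)) (𝓝 x) := by
      have := (continuousAt_extChartAt_symm (I := I) x).continuousWithinAt (s := range I)
      simpa [ContinuousWithinAt] using this
    filter_upwards [hc.eventually h] with y hy
    simp only [chartRep, hy]
  · have := h.self_of_nhds
    simp only [chartRep, extChartAt_to_inv, this]

/-- A smooth function is a smooth `0`-form. -/
theorem smoothFormAt_fun {f : M → ℝ} {x : M} (hf : ContMDiffAt I 𝓘(ℝ, ℝ) ∞ f x) :
    SmoothFormAt I (fun z => algebraMap ℝ (Ext E) (f z)) x := by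
  have h1 : ContDiffWithinAt ℝ ∞ (fun y => f ((extChartAt I x).symm y)) (range I)
      (extChartAt I x x) := (contMDiffAt_iff.mp hf).2
  have : chartRep I (fun z => algebraMap ℝ (Ext E) (f z)) x =
      fun y => (Algebra.linearMap ℝ (Ext E)).toContinuousLinearMap
        (f ((extChartAt I x).symm y)) := by
    funext y
    simp [chartRep, AlgHom.commutes]
  rw [SmoothFormAt, this]
  refine ((Algebra.linearMap ℝ (Ext E)).toContinuousLinearMap.contDiff.contDiffAt
    ).comp_contDiffWithinAt _ h1

theorem smoothFormAt_const (r : ℝ) (x : M) :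
    SmoothFormAt I (algebraMap ℝ (M → Ext E) r) x :=
  smoothFormAt_fun (f := fun _ => r) contMDiffAt_const

variable (I M) in
/-- The smooth differential forms among all the sections of `Λ(T*M)`. -/
def smoothForms : Subalgebra ℝ (M → Ext E) where
  carrier := {α | ∀ x, SmoothFormAt I α x}
  mul_mem' ha hb x := (ha x).mul (hb x)
  add_mem' ha hb x := (ha x).add (hb x)
  algebraMap_mem' r x := smoothFormAt_const r x

variable (I M) in
/-- The algebra `Ω(M)` of smooth differential forms (of mixed degree) on `M`. -/
def Form : Type _ := smoothForms I M

instance formRing : Ring (Form I M) := inferInstanceAs (Ring (smoothForms I M))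

instance formAlgebra : Algebra ℝ (Form I M) := inferInstanceAs (Algebra ℝ (smoothForms I M))

/-- The smooth form given by a smooth section. -/
def Form.mk (α : M → Ext E) (hα : ∀ x, SmoothFormAt I α x) : Form I M := (⟨α, hα⟩ : smoothForms I M)

variable (I M) in
/-- The section underlying a smooth form; sums and products are pointwise. -/
def Form.val : Form I M →ₐ[ℝ] (M → Ext E) := (smoothForms I M).val

theorem Form.smooth (α : Form I M) (x : M) : SmoothFormAt I (Form.val I M α) x :=
  (show smoothForms I M from α).2 x

theorem Form.val_mk (α : M → Ext E) (hα : ∀ x, SmoothFormAt I α x) :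
    Form.val I M (Form.mk α hα) = α := rfl

theorem Form.ext {α β : Form I M} (h : ∀ x, Form.val I M α x = Form.val I M β x) : α = β :=
  Subtype.ext (funext h)

variable [IsManifold I ∞ M]

theorem contDiffWithinAt_transition {φ : M → M} {x₀ x x' : M} (hx : x ∈ (extChartAt I x₀).source)
    (hx' : φ x ∈ (extChartAt I x').source) (hφ : ContMDiffAt I I ∞ φ x) :
    ContDiffWithinAt ℝ ∞ (extChartAt I x' ∘ φ ∘ (extChartAt I x₀).symm) (range I)
      (extChartAt I x₀ x) := by
  rw [extChartAt_source] at hx hx'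
  exact ((contMDiffAt_iff_of_mem_source hx hx').mp hφ).2

theorem chartSymmD_comp_chartD {x₀ x : M} (hx : x ∈ (extChartAt I x₀).source) :
    (chartSymmD I x₀ (extChartAt I x₀ x)).comp (chartD I x₀ x) = ContinuousLinearMap.id ℝ E :=
  have : IsManifold I 1 M := IsManifold.of_le (n := ∞) (by simp)
  mfderivWithin_extChartAt_symm_comp_mfderiv_extChartAt' hx

theorem fderivWithin_transition {φ : M → M} {x₀ x' : M} {z : E}
    (hz : z ∈ (extChartAt I x₀).target)
    (hz' : φ ((extChartAt I x₀).symm z) ∈ (extChartAt I x').source)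
    (hφ : MDifferentiableAt I I φ ((extChartAt I x₀).symm z)) :
    fderivWithin ℝ (extChartAt I x' ∘ φ ∘ (extChartAt I x₀).symm) (range I) z =
      (chartD I x' (φ ((extChartAt I x₀).symm z))).comp
        ((tangentD I φ ((extChartAt I x₀).symm z)).comp (chartSymmD I x₀ z)) := by
  have : IsManifold I 1 M := IsManifold.of_le (n := ∞) (by simp)
  have hzr : z ∈ range I := extChartAt_target_subset_range x₀ hz
  have hU : UniqueMDiffWithinAt 𝓘(ℝ, E) (range I) z :=
    (I.uniqueDiffOn z hzr).uniqueMDiffWithinAt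
  have h1 := mdifferentiableWithinAt_extChartAt_symm hz
  have hz'' : φ ((extChartAt I x₀).symm z) ∈ (chartAt H x').source := by
    rwa [extChartAt_source] at hz'
  have h2 := mdifferentiableAt_extChartAt (I := I) hz''
  have e1 : mfderivWithin 𝓘(ℝ, E) I (φ ∘ (extChartAt I x₀).symm) (range I) z =
      (mfderiv I I φ ((extChartAt I x₀).symm z)).comp
        (mfderivWithin 𝓘(ℝ, E) I (extChartAt I x₀).symm (range I) z) :=
    mfderiv_comp_mfderivWithin z hφ h1 hU
  have h3 : MDifferentiableWithinAt 𝓘(ℝ, E) I (φ ∘ (extChartAt I x₀).symm) (range I) z :=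
    hφ.comp_mdifferentiableWithinAt z h1
  have e2 : mfderivWithin 𝓘(ℝ, E) 𝓘(ℝ, E) (extChartAt I x' ∘ φ ∘ (extChartAt I x₀).symm)
      (range I) z =
      (mfderiv I 𝓘(ℝ, E) (extChartAt I x') (φ ((extChartAt I x₀).symm z))).comp
        (mfderivWithin 𝓘(ℝ, E) I (φ ∘ (extChartAt I x₀).symm) (range I) z) :=
    mfderiv_comp_mfderivWithin z h2 h3 hU
  rw [e1, mfderivWithin_eq_fderivWithin] at e2
  exact e2

theorem chartRep_pullForm {φ : M → M} {x₀ x' : M} {α : M → Ext E} {z : E}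
    (hz : z ∈ (extChartAt I x₀).target)
    (hz' : φ ((extChartAt I x₀).symm z) ∈ (extChartAt I x').source)
    (hφ : MDifferentiableAt I I φ ((extChartAt I x₀).symm z)) :
    chartRep I (pullForm I φ α) x₀ z =
      extPull (fderivWithin ℝ (extChartAt I x' ∘ φ ∘ (extChartAt I x₀).symm) (range I) z)
        (chartRep I α x' ((extChartAt I x' ∘ φ ∘ (extChartAt I x₀).symm) z)) := by
  have e3 := chartSymmD_comp_chartD hz'
  have e4 : (extChartAt I x').symm (extChartAt I x' (φ ((extChartAt I x₀).symm z))) =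
      φ ((extChartAt I x₀).symm z) := (extChartAt I x').left_inv hz'
  simp only [chartRep, pullForm, Function.comp_apply]
  rw [fderivWithin_transition hz hz' hφ, extPull_comp, extPull_comp, e4,
    ← ContinuousLinearMap.comp_assoc, e3, ContinuousLinearMap.id_comp]

theorem eventually_chart {φ : M → M} {x₀ x x' : M} (hx : x ∈ (extChartAt I x₀).source)
    (hx' : φ x ∈ (extChartAt I x').source) (hφ : ContMDiff I I ∞ φ) :
    ∀ᶠ z in 𝓝[range I] (extChartAt I x₀ x), z ∈ (extChartAt I x₀).target ∧
      φ ((extChartAt I x₀).symm z) ∈ (extChartAt I x').source := by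
  refine Filter.Eventually.and (extChartAt_target_mem_nhdsWithin' hx) ?_
  have hc : Tendsto (extChartAt I x₀).symm (𝓝[range I] (extChartAt I x₀ x)) (𝓝 x) := by
    have := (continuousAt_extChartAt_symm' (I := I) hx).continuousWithinAt (s := range I)
    rwa [ContinuousWithinAt, (extChartAt I x₀).left_inv hx] at this
  exact (hφ.continuous.continuousAt.tendsto.comp hc).eventually
    ((isOpen_extChartAt_source x').mem_nhds hx')

/-- The pullback of a smooth form by a smooth map is smooth. -/
theorem smoothFormAt_pullForm {φ : M → M} (hφ : ContMDiff I I ∞ φ) {α : M → Ext E} {x : M}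
    (hα : SmoothFormAt I α (φ x)) : SmoothFormAt I (pullForm I φ α) x := by
  have hτ := contDiffWithinAt_transition (mem_extChartAt_source (I := I) x)
    (mem_extChartAt_source (I := I) (φ x)) (hφ x)
  set τ := extChartAt I (φ x) ∘ φ ∘ (extChartAt I x).symm with hτdef
  have hτx : τ (extChartAt I x x) = extChartAt I (φ x) (φ x) := by simp [hτdef]
  have hD : ContDiffWithinAt ℝ ∞ (fderivWithin ℝ τ (range I)) (range I) (extChartAt I x x) :=
    hτ.fderivWithin_right I.uniqueDiffOn (by simp) (mem_range_self _)
  have hβ : ContDiffWithinAt ℝ ∞ (fun z => chartRep I α (φ x) (τ z)) (range I)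
      (extChartAt I x x) := by
    refine ContDiffWithinAt.comp (g := chartRep I α (φ x)) (t := range I) (extChartAt I x x) ?_ hτ ?_
    · rw [hτx]
      exact hα
    · intro z _
      simp [hτdef]
  have hfin : ContDiffWithinAt ℝ ∞ (fun z => extPullL (fderivWithin ℝ τ (range I) z)
      (chartRep I α (φ x) (τ z))) (range I) (extChartAt I x x) :=
    (contDiff_extPullL.contDiffAt.comp_contDiffWithinAt _ hD).clm_apply hβ
  have hev := eventually_chart (mem_extChartAt_source (I := I) x)
    (mem_extChartAt_source (I := I) (φ x)) hφ
  have heq : ∀ᶠ z in 𝓝[range I] (extChartAt I x x), chartRep I (pullForm I φ α) x z =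
      extPullL (fderivWithin ℝ τ (range I) z) (chartRep I α (φ x) (τ z)) := by
    filter_upwards [hev] with z hz
    exact chartRep_pullForm hz.1 hz.2 ((hφ _).mdifferentiableAt (by simp))
  exact hfin.congr_of_eventuallyEq heq (heq.self_of_nhdsWithin (mem_range_self _))

theorem pullForm_id (α : M → Ext E) : pullForm I id α = α := by
  funext x
  have : tangentD I (id : M → M) x = ContinuousLinearMap.id ℝ E := mfderiv_id
  simp only [pullForm, this, id, extPull_id]

/-- In the chart at `x₀`, the exterior derivative is given by the coordinate formula. -/
theorem chartRep_dForm {α : M → Ext E} {x₀ : M} {z : E} (hz : z ∈ (extChartAt I x₀).target)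
    (hα : SmoothFormAt I α ((extChartAt I x₀).symm z)) :
    chartRep I (dForm I α) x₀ z = coordD (range I) (chartRep I α x₀) z := by
  have : IsManifold I 1 M := IsManifold.of_le (n := ∞) (by simp)
  set x := (extChartAt I x₀).symm z with hxdef
  have hx : x ∈ (extChartAt I x₀).source := (extChartAt I x₀).map_target hz
  have hzx : extChartAt I x₀ x = z := (extChartAt I x₀).right_inv hz
  have hzr : z ∈ range I := extChartAt_target_subset_range x₀ hz
  have hU : UniqueMDiffWithinAt 𝓘(ℝ, E) (range I) z :=
    (I.uniqueDiffOn z hzr).uniqueMDiffWithinAt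
  have hτ := contDiffWithinAt_transition (φ := id) hx (mem_extChartAt_source (I := I) x)
    contMDiffAt_id
  rw [hzx] at hτ
  have hev := eventually_chart (φ := id) hx (mem_extChartAt_source (I := I) x) contMDiff_id
  rw [hzx] at hev
  set τ := extChartAt I x ∘ id ∘ (extChartAt I x₀).symm with hτdef
  have heq : chartRep I α x₀ =ᶠ[𝓝[range I] z] fun w =>
      extPull (fderivWithin ℝ τ (range I) w) (chartRep I α x (τ w)) := by
    filter_upwards [hev] with w hw
    have := chartRep_pullForm (α := α) hw.1 hw.2 mdifferentiableAt_id
    rwa [pullForm_id] at this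
  have hτz : τ z = extChartAt I x x := rfl
  rw [coordD_congr hzr heq, coordD_pullback (t := range I) I.uniqueDiffOn hzr
    (I.range_subset_closure_interior hzr) hτ (by intro w _; simp [hτdef])
    (by rw [hτz]; exact hα.differentiableWithinAt (by simp)), hτz]
  simp only [chartRep, dForm, ← hxdef]
  have e2 := fderivWithin_transition (φ := id) (x' := x) hz (mem_extChartAt_source (I := I) x)
    mdifferentiableAt_id
  have e3 : tangentD I (id : M → M) x = ContinuousLinearMap.id ℝ E := mfderiv_id
  simp only [← hτdef, id, ← hxdef] at e2
  rw [e3, ContinuousLinearMap.id_comp] at e2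
  rw [e2, extPull_comp]

theorem smoothFormAt_dForm {α : M → Ext E} (hα : ∀ x, SmoothFormAt I α x) (x : M) :
    SmoothFormAt I (dForm I α) x := by
  have hD : ContDiffWithinAt ℝ ∞ (fderivWithin ℝ (chartRep I α x) (range I)) (range I)
      (extChartAt I x x) :=
    ContDiffWithinAt.fderivWithin_right (hα x) I.uniqueDiffOn (by simp) (mem_range_self _)
  have hc : ContDiffWithinAt ℝ ∞ (coordD (range I) (chartRep I α x)) (range I)
      (extChartAt I x x) := by
    unfold coordD
    refine ContDiffWithinAt.sum fun i _ => ?_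
    exact contDiffWithinAt_ext_mul contDiffWithinAt_const
      (hD.clm_apply contDiffWithinAt_const)
  refine hc.congr_of_eventuallyEq ?_ (chartRep_dForm (mem_extChartAt_target x) (hα _))
  filter_upwards [extChartAt_target_mem_nhdsWithin (I := I) x] with z hz
  exact chartRep_dForm hz (hα _)

variable (I M) in
/-- The exterior differential `d : Ω(M) → Ω(M)`. -/
def extD : Form I M →ₗ[ℝ] Form I M where
  toFun α := Form.mk (dForm I (Form.val I M α)) (smoothFormAt_dForm α.smooth)
  map_add' α β := by
    refine Form.ext fun x => ?_
    have hr : chartRep I (Form.val I M α + Form.val I M β) x =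
        fun y => chartRep I (Form.val I M α) x y + chartRep I (Form.val I M β) x y := by
      funext y
      simp [chartRep]
    have hU : UniqueDiffWithinAt ℝ (range I) (extChartAt I x x) :=
      I.uniqueDiffOn _ (mem_range_self _)
    simp only [map_add, Pi.add_apply, Form.val_mk, dForm, coordD, hr]
    rw [fderivWithin_fun_add hU ((α.smooth x).differentiableWithinAt (by simp))
      ((β.smooth x).differentiableWithinAt (by simp))]
    simp [mul_add, Finset.sum_add_distrib]
  map_smul' c α := by
    refine Form.ext fun x => ?_
    have hr : chartRep I (c • Form.val I M α) x =
        fun y => c • chartRep I (Form.val I M α) x y := by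
      funext y
      simp [chartRep]
    have hU : UniqueDiffWithinAt ℝ (range I) (extChartAt I x x) :=
      I.uniqueDiffOn _ (mem_range_self _)
    simp only [map_smul, RingHom.id_apply, Pi.smul_apply, Form.val_mk, dForm, coordD, hr]
    rw [fderivWithin_fun_const_smul hU ((α.smooth x).differentiableWithinAt (by simp))]
    simp [Finset.smul_sum]

variable (I) in
/-- The pullback `φ^* : Ω(M) → Ω(M)` by a smooth map `φ`. -/
def pullback (φ : M → M) (hφ : ContMDiff I I ∞ φ) : Form I M →ₗ[ℝ] Form I M where
  toFun α := Form.mk (pullForm I φ (Form.val I M α))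
    fun x => smoothFormAt_pullForm hφ (α.smooth (φ x))
  map_add' α β := by
    refine Form.ext fun x => ?_
    simp [Form.val_mk, pullForm]
  map_smul' c α := by
    refine Form.ext fun x => ?_
    simp [Form.val_mk, pullForm]

/-- The vector field `X` (with `X x ∈ T_x M = E`) is smooth: in each chart it has smooth coefficients. -/
def SmoothVectorField (I : ModelWithCorners ℝ E H) (X : M → E) : Prop :=
  ∀ x₀, ContMDiffAt I 𝓘(ℝ, E) ∞
    (fun x => chartD I x₀ x (X x)) x₀

theorem smoothFormAt_contract {X : M → E} (hX : SmoothVectorField I X)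
    {α : M → Ext E} {x : M} (hα : SmoothFormAt I α x) :
    SmoothFormAt I (fun z => extContract (X z) (α z)) x := by
  have : IsManifold I 1 M := IsManifold.of_le (n := ∞) (by simp)
  have h2 : ContDiffWithinAt ℝ ∞ (fun y : E => chartD I x ((extChartAt I x).symm y)
      (X ((extChartAt I x).symm y))) (range I) (extChartAt I x x) :=
    (contMDiffAt_iff.mp (hX x)).2
  have heq : ∀ y ∈ (extChartAt I x).target,
      chartRep I (fun z => extContract (X z) (α z)) x y =
      extContract (chartD I x ((extChartAt I x).symm y) (X ((extChartAt I x).symm y)))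
        (chartRep I α x y) := by
    intro y hy
    have e := chartSymmD_comp_chartD ((extChartAt I x).map_target hy)
    rw [(extChartAt I x).right_inv hy] at e
    have e' := DFunLike.congr_fun e (X ((extChartAt I x).symm y))
    simp only [ContinuousLinearMap.comp_apply, ContinuousLinearMap.id_apply] at e'
    simp only [chartRep]
    rw [extContract_extPull, e']
  refine (contDiffWithinAt_ext_contract h2 hα).congr_of_eventuallyEq ?_
    (heq _ (mem_extChartAt_target x))
  filter_upwards [extChartAt_target_mem_nhdsWithin (I := I) x] with z hz
  exact heq z hz

/-- The contraction `ι_X : Ω(M) → Ω(M)` with a smooth vector field. -/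
def contract (X : M → E) (hX : SmoothVectorField I X) :
    Form I M →ₗ[ℝ] Form I M where
  toFun α := Form.mk (fun x => extContract (X x) (Form.val I M α x))
    fun x => smoothFormAt_contract hX (α.smooth x)
  map_add' α β := by
    refine Form.ext fun x => ?_
    simp [Form.val_mk]
  map_smul' c α := by
    refine Form.ext fun x => ?_
    simp [Form.val_mk]

end Forms

/-! ### Actions of a Lie group on a manifold -/

section Actions

variable {EG : Type*} [NormedAddCommGroup EG] [NormedSpace ℝ EG] [FiniteDimensional ℝ EG]
  (G : Type*) [TopologicalSpace G] [ChartedSpace EG G] [Group G] [LieGroup 𝓘(ℝ, EG) ∞ G]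
  {E : Type*} [NormedAddCommGroup E] [NormedSpace ℝ E] [FiniteDimensional ℝ E]
  {H : Type*} [TopologicalSpace H] (I : ModelWithCorners ℝ E H)
  (W : Type*) [TopologicalSpace W] [ChartedSpace H W] [IsManifold I ∞ W]
  [MulAction G W] [ContMDiffSMul 𝓘(ℝ, EG) I ∞ G W]

variable (EG) in
/-- The Lie algebra `𝔤` of `G`. -/
abbrev LieAlg : Type _ := GroupLieAlgebra 𝓘(ℝ, EG) G

variable (EG) in
/-- The dual space `𝔤*`. -/
abbrev LieDual : Type _ := Module.Dual ℝ (LieAlg EG G)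

variable (EG) in
/-- The symmetric algebra `S(𝔤*)`. -/
def Sym : Type _ := SymmetricAlgebra ℝ (LieDual EG G)

instance symCommRing : CommRing (Sym EG G) :=
  inferInstanceAs (CommRing (SymmetricAlgebra ℝ (LieDual EG G)))

instance symAlgebra : Algebra ℝ (Sym EG G) :=
  inferInstanceAs (Algebra ℝ (SymmetricAlgebra ℝ (LieDual EG G)))

/-- The inclusion `𝔤* = S¹(𝔤*) → S(𝔤*)`. -/
def symι : LieDual EG G →ₗ[ℝ] Sym EG G := SymmetricAlgebra.ι ℝ (LieDual EG G)

variable {G} in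
/-- The universal property of `S(𝔤*)`. -/
def symLift {A : Type*} [CommRing A] [Algebra ℝ A] (l : LieDual EG G →ₗ[ℝ] A) :
    Sym EG G →ₐ[ℝ] A := SymmetricAlgebra.lift l

variable (EG) in
/-- The Weil algebra `W(𝔤) = Λ(𝔤*) ⊗ S(𝔤*)`. -/
abbrev Weil : Type _ := ExteriorAlgebra ℝ (LieDual EG G) ⊗[ℝ] Sym EG G

variable (EG) in
/-- The algebra `S(𝔤*) ⊗ Ω(W)`. -/
abbrev Cartan : Type _ := Sym EG G ⊗[ℝ] Form I W

variable {G} in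
/-- The adjoint action of `g` on `𝔤`: the derivative at `1` of `h ↦ g h g⁻¹`. -/
def Ad (g : G) : LieAlg EG G →ₗ[ℝ] LieAlg EG G :=
  ContinuousLinearMap.toLinearMap (M := LieAlg EG G) (M₂ := LieAlg EG G)
    (mfderiv 𝓘(ℝ, EG) 𝓘(ℝ, EG) (fun h : G => g * h * g⁻¹) 1)

/-- The derivative at `1` of the orbit map `g ↦ g • x`. -/
def orbitD (x : W) : LieAlg EG G →L[ℝ] E := mfderiv 𝓘(ℝ, EG) I (fun g : G => g • x) 1

variable {W} in
/-- The vector field on `W` generated by `ξ ∈ 𝔤`, `x ↦ d/dt|₀ exp(-tξ) • x`. (With this sign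
`ξ ↦ X_ξ` is a homomorphism from `𝔤` to the Lie algebra of vector fields.) -/
def fundField (ξ : LieAlg EG G) (x : W) : E := -orbitD G I W x ξ

variable {I W} in
theorem smoothVectorField_fundField (ξ : LieAlg EG G) :
    SmoothVectorField I (fundField G I ξ : W → E) := by
  intro x₀
  have : IsManifold I 1 W := IsManifold.of_le (n := ∞) (by simp)
  have : IsManifold 𝓘(ℝ, EG) 1 G := IsManifold.of_le (n := ∞) (by simp)
  have hs : ContMDiff (I.prod 𝓘(ℝ, EG)) I ∞ (Function.uncurry fun (x : W) (g : G) => g • x) :=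
    (contMDiff_smul (I := 𝓘(ℝ, EG)) (I' := I) (n := ∞) (G := G) (M := W)).comp
      (contMDiff_snd.prodMk contMDiff_fst)
  have h := ContMDiffAt.mfderiv (I := 𝓘(ℝ, EG)) (I' := I) (J := I) (x₀ := x₀) (m := ∞) (n := ∞)
    (fun (x : W) (g : G) => g • x) (fun _ => (1 : G)) (hs _) contMDiffAt_const (by simp)
  have h2 : ContMDiffAt I 𝓘(ℝ, E) ∞ (fun x => inTangentCoordinates 𝓘(ℝ, EG) I
      (fun _ : W => (1 : G)) (fun x : W => (1 : G) • x)
      (fun x => mfderiv 𝓘(ℝ, EG) I (fun g : G => g • x) 1) x₀ x (-ξ : EG)) x₀ :=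
    h.clm_apply contMDiffAt_const
  refine h2.congr_of_eventuallyEq ?_
  filter_upwards [(chartAt H x₀).open_source.mem_nhds (mem_chart_source H x₀)] with x hx
  have e := inTangentCoordinates_eq_mfderiv_comp (I := 𝓘(ℝ, EG)) (I' := I)
    (f := fun _ : W => (1 : G)) (g := fun x : W => (1 : G) • x)
    (ϕ := fun x => mfderiv 𝓘(ℝ, EG) I (fun g : G => g • x) 1) (x₀ := x₀) (x := x)
    (mem_chart_source EG (1 : G)) (by simpa using hx)
  have e2 : mfderivWithin 𝓘(ℝ, EG) 𝓘(ℝ, EG) (extChartAt 𝓘(ℝ, EG) (1 : G)).symm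
      (range 𝓘(ℝ, EG)) (extChartAt 𝓘(ℝ, EG) (1 : G) 1) = ContinuousLinearMap.id ℝ EG :=
    mfderivWithin_range_extChartAt_symm
  have e3 : inTangentCoordinates 𝓘(ℝ, EG) I
      (fun _ : W => (1 : G)) (fun x : W => (1 : G) • x)
      (fun x => mfderiv 𝓘(ℝ, EG) I (fun g : G => g • x) 1) x₀ x =
      (chartD I ((1 : G) • x₀) ((1 : G) • x)).comp ((orbitD G I W x).comp
        (mfderivWithin 𝓘(ℝ, EG) 𝓘(ℝ, EG) (extChartAt 𝓘(ℝ, EG) (1 : G)).symm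
      (range 𝓘(ℝ, EG)) (extChartAt 𝓘(ℝ, EG) (1 : G) 1) : EG →L[ℝ] EG)) := e
  rw [e3, one_smul, one_smul]
  change chartD I x₀ x (-orbitD G I W x ξ) = chartD I x₀ x (orbitD G I W x
    ((mfderivWithin 𝓘(ℝ, EG) 𝓘(ℝ, EG) (extChartAt 𝓘(ℝ, EG) (1 : G)).symm
      (range 𝓘(ℝ, EG)) (extChartAt 𝓘(ℝ, EG) (1 : G) 1) : EG →L[ℝ] EG) (-ξ : EG)))
  have e4 : (mfderivWithin 𝓘(ℝ, EG) 𝓘(ℝ, EG) (extChartAt 𝓘(ℝ, EG) (1 : G)).symm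
      (range 𝓘(ℝ, EG)) (extChartAt 𝓘(ℝ, EG) (1 : G) 1) : EG →L[ℝ] EG) (-ξ : EG) = -ξ :=
    DFunLike.congr_fun e2 (-ξ : EG)
  rw [e4]
  exact congrArg _ (map_neg (orbitD G I W x) ξ).symm

/-- The contraction `ι_ξ` of forms on `W` with the vector field generated by `ξ`. -/
def iota (ξ : LieAlg EG G) : Form I W →ₗ[ℝ] Form I W :=
  contract (fundField G I ξ) (smoothVectorField_fundField G ξ)

variable {G} in
/-- The coadjoint action of `g` on `S(𝔤*)`: the algebra map with `φ ↦ φ ∘ Ad(g⁻¹)` on `𝔤*`. -/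
def symAct (g : G) : Sym EG G →ₐ[ℝ] Sym EG G :=
  symLift ((symι G).comp (Module.Dual.transpose (R := ℝ) (Ad (EG := EG) g⁻¹)))

variable {G} in
/-- The diagonal action of `g` on `S(𝔤*) ⊗ Ω(W)`; on forms `g` acts by pullback by `g⁻¹`. -/
def cartanAct (g : G) : Cartan EG G I W →ₗ[ℝ] Cartan EG G I W :=
  TensorProduct.map (symAct g).toLinearMap
    (pullback I (fun x : W => g⁻¹ • x)
      ((contMDiff_smul (I := 𝓘(ℝ, EG)) (I' := I) (n := ∞) (G := G) (M := W)).comp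
        (contMDiff_const.prodMk contMDiff_id)))

variable (EG) in
/-- `Ω_G(W) = (S(𝔤*) ⊗ Ω(W))^G`. -/
def equivForms : Submodule ℝ (Cartan EG G I W) where
  carrier := {α | ∀ g : G, cartanAct I W g α = α}
  add_mem' ha hb g := by rw [map_add, ha g, hb g]
  zero_mem' g := map_zero _
  smul_mem' c a ha g := by rw [map_smul, ha g]

variable {k : ℕ} (ξ : Module.Basis (Fin k) ℝ (LieAlg EG G))

/-- The Cartan differential `D = 1 ⊗ d - Θ^a ⊗ ι_a`. -/
def cartanD : Cartan EG G I W →ₗ[ℝ] Cartan EG G I W :=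
  TensorProduct.map LinearMap.id (extD I W) -
    ∑ a, TensorProduct.map
      (LinearMap.mulLeft ℝ (symι G (ξ.coord a))) (iota G I W (ξ a))

/-- The forms of pure degree `q`. -/
def formDegree (q : ℕ) : Submodule ℝ (Form I W) where
  carrier := {α | ∀ x, Form.val I W α x ∈ ⋀[ℝ]^q (Module.Dual ℝ E)}
  add_mem' ha hb x := by
    rw [map_add]
    exact add_mem (ha x) (hb x)
  zero_mem' x := by
    rw [map_zero]
    exact zero_mem _
  smul_mem' c _ ha x := by
    rw [map_smul]
    exact Submodule.smul_mem _ c (ha x)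

variable (EG) in
/-- The part of `S(𝔤*) ⊗ Ω(W)` of total degree `n`; elements of `S^p(𝔤*)` have degree `2p`. -/
def cartanDegree (n : ℕ) : Submodule ℝ (Cartan EG G I W) :=
  ⨆ (p : ℕ) (q : ℕ) (_ : 2 * p + q = n), Submodule.map₂ (TensorProduct.mk ℝ (Sym EG G) (Form I W))
    (LinearMap.range (symι (EG := EG) G) ^ p) (formDegree I W q)

/-- The equivariantly closed forms. -/
def cocycles : Submodule ℝ (Cartan EG G I W) :=
  equivForms EG G I W ⊓ LinearMap.ker (cartanD G I W ξ)

/-- The equivariantly exact forms: the image of `Ω_G(W)` under `D`. -/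
def coboundaries : Submodule ℝ (Cartan EG G I W) :=
  (equivForms EG G I W).map (cartanD G I W ξ)

/-- The equivariant cohomology `H_G^*(W)`, i.e. the cohomology of `(Ω_G(W), D)`: closed modulo
exact equivariant forms. -/
abbrev EquivCohomology : Type _ :=
  cocycles G I W ξ ⧸ (coboundaries G I W ξ).submoduleOf (cocycles G I W ξ)

/-! ### Degenerate principal bundles, connections and the degenerate Chern–Weil construction -/

/-- The set `W^s` of points whose stabilizer has positive dimension, i.e. is not discrete. -/
def singularSet : Set W := {x | ¬ DiscreteTopology (MulAction.stabilizer G x)}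

/-- The action is locally free on an open set containing the boundary. -/
def IsDegeneratePrincipalBundle : Prop :=
  ∃ U : Set W, IsOpen U ∧ I.boundary W ⊆ U ∧
    ∀ x ∈ U, DiscreteTopology (MulAction.stabilizer G x)

/-- A connection `ω` on `W⁰ = W - W^s`: a smooth `𝔤`-valued 1-form on `W⁰` with `ω(X_ξ) = ξ` and
`g^* ω = Ad(g) ω`. (Its values on `W^s` are irrelevant; no condition is put on them.) -/
structure Connection where
  form : W → E →ₗ[ℝ] LieAlg EG G
  smooth : ∀ x ∉ singularSet G W, ∀ φ : LieDual EG G,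
    SmoothFormAt I (fun z => ExteriorAlgebra.ι ℝ (φ ∘ₗ form z)) x
  vertical : ∀ x ∉ singularSet G W, ∀ η : LieAlg EG G, form x (fundField G I η x) = η
  equivariant : ∀ x ∉ singularSet G W, ∀ (g : G) (v : E),
    form (g • x) (tangentD I (fun z : W => g • z) x v) = Ad g (form x v)

/-- A cut-off function: `G`-invariant, smooth, with values in `[0, 1]`, vanishing on a neighbourhood
of `W^s` and identically `1` outside a larger one. -/
structure Cutoff where
  toFun : W → ℝ
  smooth : ContMDiff I 𝓘(ℝ, ℝ) ∞ toFun
  mem_Icc : ∀ x, toFun x ∈ Icc (0 : ℝ) 1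
  invariant : ∀ (g : G) (x : W), toFun (g • x) = toFun x
  exists_nhds : ∃ U V : Set W, IsOpen U ∧ IsOpen V ∧ singularSet G W ⊆ U ∧ closure U ⊆ V ∧
    (∀ x ∈ U, toFun x = 0) ∧ ∀ x ∉ V, toFun x = 1

variable (f : Cutoff G I W) (conn : Connection (EG := EG) G I W)

variable {G I W}

theorem smoothFormAt_degForm (φ : LieDual EG G) (x : W) :
    SmoothFormAt I (fun z => ExteriorAlgebra.ι ℝ (φ ∘ₗ (f.toFun z • conn.form z))) x := by
  have he : (fun z => ExteriorAlgebra.ι ℝ (φ ∘ₗ (f.toFun z • conn.form z)) : W → Ext E) =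
      (fun z => algebraMap ℝ (Ext E) (f.toFun z)) *
        fun z => ExteriorAlgebra.ι ℝ (φ ∘ₗ conn.form z) := by
    funext z
    rw [Pi.mul_apply, ← Algebra.smul_def, ← map_smul]
    congr 1
    ext v
    simp
  by_cases hx : x ∈ singularSet G W
  · obtain ⟨U, V, hU, -, hsU, -, h0, -⟩ := f.exists_nhds
    refine smoothFormAt_congr (α := algebraMap ℝ (W → Ext E) 0) (smoothFormAt_const 0 x) ?_
    filter_upwards [hU.mem_nhds (hsU hx)] with z hz
    simp [h0 z hz]
  · rw [he]
    exact (smoothFormAt_fun (f.smooth x)).mul (conn.smooth x hx φ)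

/-- The degenerate connection `ω_f = f ω`, through its components `φ(ω_f) ∈ Ω¹(W)`, `φ ∈ 𝔤*`;
the component along the dual basis vector `ξ.coord a` is `ω_f^a`. -/
def degConn : LieDual EG G →ₗ[ℝ] Form I W where
  toFun φ := Form.mk (fun x => ExteriorAlgebra.ι ℝ (φ ∘ₗ (f.toFun x • conn.form x)))
    (smoothFormAt_degForm f conn φ)
  map_add' φ ψ := by
    refine Form.ext fun x => ?_
    simp [Form.val_mk, LinearMap.add_comp]
  map_smul' c φ := by
    refine Form.ext fun x => ?_
    simp [Form.val_mk, LinearMap.smul_comp]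

/-- The cut-off function as a `0`-form. -/
def cutoffForm : Form I W :=
  Form.mk (fun x => algebraMap ℝ (Ext E) (f.toFun x)) fun x => smoothFormAt_fun (f.smooth x)

/-- The degenerate equivariant curvature `Ω_f^G = dω_f + ½[ω_f, ω_f] - (-1 + f) ξ_a Θ^a`, through
its components `φ(Ω_f^G) ∈ S(𝔤*) ⊗ Ω(W)`, `φ ∈ 𝔤*`. Here
`φ([ω_f, ω_f]) = ∑ φ([ξ_b, ξ_c]) ω_f^b ∧ ω_f^c` and `φ(ξ_a) Θ^a` is `φ` as an element of `S¹(𝔤*)`. -/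
def degCurvature : LieDual EG G →ₗ[ℝ] Cartan EG G I W where
  toFun φ := (1 : Sym EG G) ⊗ₜ[ℝ] (extD I W (degConn f conn φ) +
      (2⁻¹ : ℝ) • ∑ b, ∑ c, φ ⁅ξ b, ξ c⁆ •
        (degConn f conn (ξ.coord b) * degConn f conn (ξ.coord c))) -
    symι G φ ⊗ₜ[ℝ] (-1 + cutoffForm f)
  map_add' φ ψ := by
    simp only [map_add, LinearMap.add_apply, add_smul, Finset.sum_add_distrib, smul_add,
      TensorProduct.tmul_add, TensorProduct.add_tmul]
    abel
  map_smul' c φ := by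
    simp only [map_smul, LinearMap.smul_apply, smul_eq_mul, mul_smul, ← Finset.smul_sum,
      RingHom.id_apply, smul_sub]
    rw [smul_comm (2⁻¹ : ℝ) c, ← smul_add, TensorProduct.tmul_smul]
    rfl

/-! The components of the curvature are even, hence central in `S(𝔤*) ⊗ Ω(W)`. -/

theorem tmul_mem_center (s : Sym EG G) {β : Form I W} (hβ : ∀ γ : Form I W, β * γ = γ * β) :
    s ⊗ₜ[ℝ] β ∈ Subalgebra.center ℝ (Cartan EG G I W) := by
  rw [Subalgebra.mem_center_iff]
  intro t
  induction t using TensorProduct.induction_on with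
  | zero => simp
  | tmul r γ => rw [Algebra.TensorProduct.tmul_mul_tmul, Algebra.TensorProduct.tmul_mul_tmul,
      mul_comm, hβ]
  | add a b ha hb => rw [add_mul, mul_add, ha, hb]

theorem extD_degConn_comm (φ : LieDual EG G) (γ : Form I W) :
    extD I W (degConn f conn φ) * γ = γ * extD I W (degConn f conn φ) := by
  have hι : ∀ (x : W) (y : E), ∃ ψ : Module.Dual ℝ E,
      chartRep I (Form.val I W (degConn f conn φ)) x y = ExteriorAlgebra.ι ℝ ψ := fun x y =>
    ⟨_, extPull_ι _ _⟩
  have hd : ∀ (x : W) (v : E), ∃ ψ : Module.Dual ℝ E,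
      fderivWithin ℝ (chartRep I (Form.val I W (degConn f conn φ)) x) (range I)
        (extChartAt I x x) v = ExteriorAlgebra.ι ℝ ψ := fun x v =>
    fderivWithin_mem_range_ι (I.uniqueDiffOn _ (mem_range_self _))
      (((degConn f conn φ).smooth x).differentiableWithinAt (by simp)) (hι x) v
  refine Form.ext fun x => ?_
  rw [map_mul, map_mul, Pi.mul_apply, Pi.mul_apply]
  change extPull (chartD I x x) (∑ i, _) * _ = _ * extPull (chartD I x x) (∑ i, _)
  rw [map_sum, Finset.sum_mul, Finset.mul_sum]
  refine Finset.sum_congr rfl fun i _ => ?_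
  obtain ⟨ψ, hψ⟩ := hd x (Module.finBasis ℝ E i)
  rw [hψ, map_mul, extPull_ι, extPull_ι]
  exact commute_ι_mul_ι _ _ _

theorem degCurvature_mem_center (φ : LieDual EG G) :
    degCurvature ξ f conn φ ∈ Subalgebra.center ℝ (Cartan EG G I W) := by
  refine sub_mem (tmul_mem_center _ fun γ => ?_) (tmul_mem_center _ fun γ => ?_)
  · rw [add_mul, mul_add, extD_degConn_comm]
    congr 1
    rw [smul_mul_assoc, mul_smul_comm, Finset.sum_mul, Finset.mul_sum]
    congr 1
    refine Finset.sum_congr rfl fun b _ => ?_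
    rw [Finset.sum_mul, Finset.mul_sum]
    refine Finset.sum_congr rfl fun c _ => ?_
    rw [smul_mul_assoc, mul_smul_comm]
    congr 1
    refine Form.ext fun x => ?_
    exact commute_ι_mul_ι _ _ _
  · rw [add_mul, mul_add, neg_one_mul, mul_neg_one]
    congr 1
    refine Form.ext fun x => ?_
    exact Algebra.commutes (f.toFun x) (Form.val I W γ x)

theorem degConn_sq (φ : LieDual EG G) :
    ((1 : Sym EG G) ⊗ₜ[ℝ] degConn f conn φ) * ((1 : Sym EG G) ⊗ₜ[ℝ] degConn f conn φ) = 0 := by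
  have : degConn f conn φ * degConn f conn φ = 0 := by
    refine Form.ext fun x => ?_
    exact ExteriorAlgebra.ι_sq_zero _
  rw [Algebra.TensorProduct.tmul_mul_tmul, this, TensorProduct.tmul_zero]

/-- The algebra homomorphism `Λ(𝔤*) → S(𝔤*) ⊗ Ω(W)`, `θ^a ↦ ω_f^a`. -/
def cwExterior : ExteriorAlgebra ℝ (LieDual EG G) →ₐ[ℝ] Cartan EG G I W :=
  ExteriorAlgebra.lift ℝ
    ⟨(TensorProduct.mk ℝ (Sym EG G) (Form I W) 1).comp (degConn f conn), degConn_sq f conn⟩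

/-- The algebra homomorphism `Θ^a ↦ (Ω_f^G)^a` from `S(𝔤*)` to the centre of `S(𝔤*) ⊗ Ω(W)`. -/
def cwSym : Sym EG G →ₐ[ℝ] Subalgebra.center ℝ (Cartan EG G I W) :=
  symLift ((degCurvature ξ f conn).codRestrict
    (Subalgebra.toSubmodule (Subalgebra.center ℝ (Cartan EG G I W)))
    (degCurvature_mem_center ξ f conn))

/-- The Chern–Weil construction `W(𝔤) → S(𝔤*) ⊗ Ω(W)`, `θ^a ↦ ω_f^a`, `Θ^a ↦ (Ω_f^G)^a`. -/
def cwWeil : Weil EG G →ₐ[ℝ] Cartan EG G I W :=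
  Algebra.TensorProduct.lift (cwExterior f conn)
    ((Subalgebra.center ℝ (Cartan EG G I W)).val.comp (cwSym ξ f conn)) fun l s =>
      Subalgebra.mem_center_iff.mp (cwSym ξ f conn s).2 (cwExterior f conn l)

/-- `CW_f^w : W(𝔤) ⊗ Ω(W) → S(𝔤*) ⊗ Ω(W)`, the extension of the Chern–Weil construction as a map of
`Ω(W)`-modules: `w ⊗ β ↦ cwWeil w ∧ β`. -/
def CWf : Weil EG G ⊗[ℝ] Form I W →ₗ[ℝ] Cartan EG G I W :=
  TensorProduct.lift ((LinearMap.mul ℝ (Cartan EG G I W)).compl₁₂ (cwWeil ξ f conn).toLinearMap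
    (TensorProduct.mk ℝ (Sym EG G) (Form I W) 1))

variable (G I W)

/-- The operator `θ^a ⊗ ι_a` on `W(𝔤) ⊗ Ω(W)`, with the sign rule
`(θ^a ⊗ ι_a)(w ⊗ β) = (-1)^{deg w} θ^a w ⊗ ι_a β`. (The parity of `w` is that of its
`Λ(𝔤*)`-component; `involute` is the parity automorphism of `Λ(𝔤*)`.) -/
def thetaIota (a : Fin k) : Module.End ℝ (Weil EG G ⊗[ℝ] Form I W) :=
  TensorProduct.map
    ((LinearMap.mulLeft ℝ (ExteriorAlgebra.ι ℝ (ξ.coord a) ⊗ₜ[ℝ] (1 : Sym EG G))).comp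
      (TensorProduct.map CliffordAlgebra.involute.toLinearMap LinearMap.id))
    (iota G I W (ξ a))

/-- `Ψ = ∏_a (1 - θ^a ⊗ ι_a)` on `W(𝔤) ⊗ Ω(W)`. -/
def Psi : Module.End ℝ (Weil EG G ⊗[ℝ] Form I W) :=
  (List.ofFn fun a : Fin k => 1 - thetaIota G I W ξ a).prod

variable (EG) in
/-- The inclusion `S(𝔤*) ⊗ Ω(W) → W(𝔤) ⊗ Ω(W)`. -/
def cartanToWeil : Cartan EG G I W →ₗ[ℝ] Weil EG G ⊗[ℝ] Form I W :=
  TensorProduct.map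
    (Algebra.TensorProduct.includeRight :
      Sym EG G →ₐ[ℝ] ExteriorAlgebra ℝ (LieDual EG G) ⊗[ℝ] Sym EG G).toLinearMap LinearMap.id

variable {G I W}

/-- The map `r_f^G = CW_f^w ∘ Ψ : S(𝔤*) ⊗ Ω(W) → S(𝔤*) ⊗ Ω(W)`. -/
def rMap : Cartan EG G I W →ₗ[ℝ] Cartan EG G I W :=
  (CWf ξ f conn).comp ((Psi G I W ξ).comp (cartanToWeil EG G I W))

end Actions

end DegenerateChernWeil

end

open DegenerateChernWeil

noncomputable section

namespace DegenerateChernWeil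

set_option linter.unusedSectionVars false

open Set Filter
open scoped TensorProduct Topology

section ExteriorLemmas

variable {E : Type*} [NormedAddCommGroup E] [NormedSpace ℝ E]

theorem involute_extContract (v : E) (x : Ext E) :
    CliffordAlgebra.involute (extContract v x) = -extContract v (CliffordAlgebra.involute x) := by
  induction x using CliffordAlgebra.left_induction with
  | algebraMap r => simp [extContract, AlgHom.commutes]
  | add x y hx hy => simp [hx, hy, add_comm]
  | ι_mul x φ hx =>
    change CliffordAlgebra.involute (extContract v (ExteriorAlgebra.ι ℝ φ * x)) =
      -extContract v (CliffordAlgebra.involute (ExteriorAlgebra.ι ℝ φ * x))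
    have h2 : CliffordAlgebra.involute (ExteriorAlgebra.ι ℝ φ) = -ExteriorAlgebra.ι ℝ φ :=
      CliffordAlgebra.involute_ι φ
    rw [extContract_ι_mul, map_sub, map_mul, map_mul, h2, neg_mul, neg_mul, map_neg, neg_neg,
      extContract_ι_mul, map_smul, hx]
    simp

theorem extContract_mul (v : E) (x y : Ext E) :
    extContract v (x * y) = extContract v x * y + CliffordAlgebra.involute x * extContract v y := by
  induction x using CliffordAlgebra.left_induction with
  | algebraMap r =>
    rw [← Algebra.smul_def, map_smul, AlgHom.commutes, ← Algebra.smul_def]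
    simp [extContract]
  | add x z hx hz => simp only [add_mul, map_add, hx, hz]; abel
  | ι_mul x φ hx =>
    change extContract v (ExteriorAlgebra.ι ℝ φ * x * y) = extContract v (ExteriorAlgebra.ι ℝ φ * x) * y
      + CliffordAlgebra.involute (ExteriorAlgebra.ι ℝ φ * x) * extContract v y
    have h2 : CliffordAlgebra.involute (ExteriorAlgebra.ι ℝ φ) = -ExteriorAlgebra.ι ℝ φ :=
      CliffordAlgebra.involute_ι φ
    rw [mul_assoc, extContract_ι_mul, extContract_ι_mul, hx, map_mul, h2]
    simp only [mul_add, sub_mul, neg_mul, smul_mul_assoc, mul_assoc]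
    abel

theorem extContract_algebraMap (v : E) (r : ℝ) : extContract v (algebraMap ℝ (Ext E) r) = 0 := by
  simp [extContract]

theorem extContract_ι (v : E) (φ : Module.Dual ℝ E) :
    extContract v (ExteriorAlgebra.ι ℝ φ) = algebraMap ℝ (Ext E) (φ v) := by
  have h := extContract_ι_mul v φ 1
  have h1 : extContract v (1 : Ext E) = 0 := by
    simpa using extContract_algebraMap v (1 : ℝ)
  rwa [mul_one, h1, mul_zero, sub_zero, ← Algebra.algebraMap_eq_smul_one] at h

theorem extContract_comm (v w : E) (x : Ext E) :
    extContract v (extContract w x) = -extContract w (extContract v x) :=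
  CliffordAlgebra.contractLeft_comm _ _ _

theorem involute_extPull (A : E →L[ℝ] E) (x : Ext E) :
    CliffordAlgebra.involute (extPull A x) = extPull A (CliffordAlgebra.involute x) := by
  have : (CliffordAlgebra.involute : Ext E →ₐ[ℝ] Ext E).comp (extPull A) =
      (extPull A).comp CliffordAlgebra.involute := by
    apply ExteriorAlgebra.hom_ext
    ext φ
    have h2 : ∀ φ : Module.Dual ℝ E,
        CliffordAlgebra.involute (ExteriorAlgebra.ι ℝ φ) = -ExteriorAlgebra.ι ℝ φ :=
      CliffordAlgebra.involute_ι
    simp [extPull_ι, h2]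
  exact DFunLike.congr_fun this x

/-- Pullback by a rank-one perturbation of a linear map. -/
theorem extPull_sub_smulRight (A : E →L[ℝ] E) (φ : E →L[ℝ] ℝ) (v : E) (x : Ext E) :
    extPull (A - φ.smulRight v) x =
      extPull A x - ExteriorAlgebra.ι ℝ (φ : Module.Dual ℝ E) *
        extPull A (extContract v x) := by
  induction x using CliffordAlgebra.left_induction with
  | algebraMap r => rw [extContract_algebraMap]; simp [AlgHom.commutes]
  | add x y hx hy => simp only [map_add, hx, hy, mul_add]; abel
  | ι_mul x ψ hx =>
    change extPull (A - φ.smulRight v) (ExteriorAlgebra.ι ℝ ψ * x) =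
      extPull A (ExteriorAlgebra.ι ℝ ψ * x) - ExteriorAlgebra.ι ℝ (φ : Module.Dual ℝ E) *
        extPull A (extContract v (ExteriorAlgebra.ι ℝ ψ * x))
    have h1 : ψ ∘ₗ ((A - φ.smulRight v : E →L[ℝ] E) : E →ₗ[ℝ] E) =
        ψ ∘ₗ (A : E →ₗ[ℝ] E) - ψ v • (φ : Module.Dual ℝ E) := by
      ext w
      simp [mul_comm]
    have h3 := eq_neg_of_add_eq_zero_left
      (ExteriorAlgebra.ι_add_mul_swap (R := ℝ) (ψ ∘ₗ (A : E →ₗ[ℝ] E)) (φ : Module.Dual ℝ E))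
    have h4 := ExteriorAlgebra.ι_sq_zero (R := ℝ) (φ : Module.Dual ℝ E)
    rw [map_mul, hx, extPull_ι, h1, extContract_ι_mul, map_sub, map_sub, map_smul, map_smul,
      map_mul, map_mul, extPull_ι]
    simp only [sub_mul, mul_sub, smul_mul_assoc, mul_smul_comm, ← mul_assoc, h3, h4]
    simp only [neg_mul, zero_mul, smul_zero]
    abel

theorem extPull_mem_exteriorPower (A : E →L[ℝ] E) {q : ℕ} {x : Ext E}
    (hx : x ∈ ⋀[ℝ]^q (Module.Dual ℝ E)) : extPull A x ∈ ⋀[ℝ]^q (Module.Dual ℝ E) := by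
  have h : (⋀[ℝ]^q (Module.Dual ℝ E)).map (extPull A).toLinearMap ≤ ⋀[ℝ]^q (Module.Dual ℝ E) := by
    rw [ExteriorAlgebra.exteriorPower, Submodule.map_pow]
    refine pow_le_pow_left' ?_ q
    rintro _ ⟨_, ⟨φ, rfl⟩, rfl⟩
    exact ⟨_, (extPull_ι A φ).symm⟩
  exact h ⟨x, hx, rfl⟩

end ExteriorLemmas

section FormCalculus

variable {E : Type*} [NormedAddCommGroup E] [NormedSpace ℝ E] [FiniteDimensional ℝ E]
  {H : Type*} [TopologicalSpace H] {I : ModelWithCorners ℝ E H}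
  {M : Type*} [TopologicalSpace M] [ChartedSpace H M]

theorem involute_coordD {s : Set E} {β : E → Ext E} {y : E} (hs : UniqueDiffWithinAt ℝ s y)
    (hβ : DifferentiableWithinAt ℝ β s y) :
    coordD s (fun z => CliffordAlgebra.involute (β z)) y =
      -CliffordAlgebra.involute (coordD s β y) := by
  let L : Ext E →L[ℝ] Ext E := LinearMap.toContinuousLinearMap
    (CliffordAlgebra.involute : Ext E →ₐ[ℝ] Ext E).toLinearMap
  have h1 : fderivWithin ℝ (fun z => CliffordAlgebra.involute (β z)) s y =
      L.comp (fderivWithin ℝ β s y) :=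
    (L.hasFDerivAt.comp_hasFDerivWithinAt y hβ.hasFDerivWithinAt).fderivWithin hs
  have h2 : ∀ φ : Module.Dual ℝ E,
      CliffordAlgebra.involute (ExteriorAlgebra.ι ℝ φ) = -ExteriorAlgebra.ι ℝ φ :=
    CliffordAlgebra.involute_ι
  simp only [coordD, h1, map_sum, map_mul, h2, neg_mul, Finset.sum_neg_distrib, neg_neg]
  rfl

theorem coordD_coordD {s : Set E} {β : E → Ext E} {y : E} (hs : UniqueDiffOn ℝ s) (hy : y ∈ s)
    (hy' : y ∈ closure (interior s)) (hβ : ContDiffWithinAt ℝ ∞ β s y) :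
    coordD s (coordD s β) y = 0 := by
  have hD : ContDiffWithinAt ℝ ∞ (fderivWithin ℝ β s) s y :=
    hβ.fderivWithin_right hs (by simp) hy
  have hDd := hD.differentiableWithinAt (by simp)
  set b := Module.finBasis ℝ E
  have h1 : ∀ v, fderivWithin ℝ (coordD s β) s y v =
      ∑ i, ExteriorAlgebra.ι ℝ (b.coord i) *
        fderivWithin ℝ (fderivWithin ℝ β s) s y v (b i) := by
    intro v
    have h : ∀ i, HasFDerivWithinAt (fun z => ExteriorAlgebra.ι ℝ (b.coord i) *
        fderivWithin ℝ β s z (b i)) ((extMulL (ExteriorAlgebra.ι ℝ (b.coord i))).comp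
          ((fderivWithin ℝ (fderivWithin ℝ β s) s y).flip (b i))) s y := fun i => by
      have h2 : HasFDerivWithinAt (fun z => fderivWithin ℝ β s z (b i))
          ((fderivWithin ℝ (fderivWithin ℝ β s) s y).flip (b i)) s y := by
        simpa using hDd.hasFDerivWithinAt.clm_apply (hasFDerivWithinAt_const (b i) y s)
      exact (extMulL (ExteriorAlgebra.ι ℝ (b.coord i))).hasFDerivAt.comp_hasFDerivWithinAt y h2
    have h' : HasFDerivWithinAt (coordD s β) _ s y :=
      HasFDerivWithinAt.fun_sum (u := Finset.univ) fun i _ => h i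
    rw [h'.fderivWithin (hs y hy)]
    simp [extMulL_apply]
  have hsymm : IsSymmSndFDerivWithinAt ℝ β s y :=
    hβ.isSymmSndFDerivWithinAt (by simpa using ENat.LEInfty.out) hs hy' hy
  have h0 : coordD s (coordD s β) y = ∑ j, ∑ i, ExteriorAlgebra.ι ℝ (b.coord j) *
      (ExteriorAlgebra.ι ℝ (b.coord i) *
        fderivWithin ℝ (fderivWithin ℝ β s) s y (b j) (b i)) := by
    conv_lhs => rw [coordD]
    simp only [h1, Finset.mul_sum, b]
  have h5 : coordD s (coordD s β) y = -coordD s (coordD s β) y := by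
    rw [h0]
    conv_lhs => rw [Finset.sum_comm]
    simp only [← Finset.sum_neg_distrib]
    refine Finset.sum_congr rfl fun i _ => Finset.sum_congr rfl fun j _ => ?_
    rw [hsymm.eq (b j) (b i), ← mul_assoc, ← mul_assoc, eq_neg_of_add_eq_zero_left
      (ExteriorAlgebra.ι_add_mul_swap (R := ℝ) (b.coord j) (b.coord i)), neg_mul]
  have h6 := eq_neg_iff_add_eq_zero.mp h5
  rw [← two_smul ℝ] at h6
  exact (smul_eq_zero.mp h6).resolve_left two_ne_zero

theorem extChartAt_self_mem_range (x : M) : extChartAt I x x ∈ range I := mem_range_self _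

theorem chartRep_mul (α β : M → Ext E) (x : M) :
    chartRep I (α * β) x = fun y => chartRep I α x y * chartRep I β x y := by
  funext y
  simp [chartRep]

theorem chartRep_involute (α : M → Ext E) (x : M) :
    chartRep I (fun z => CliffordAlgebra.involute (α z)) x =
      fun y => CliffordAlgebra.involute (chartRep I α x y) := by
  funext y
  simp [chartRep, involute_extPull]

theorem smoothFormAt_involute {α : M → Ext E} {x : M} (hα : SmoothFormAt I α x) :
    SmoothFormAt I (fun z => CliffordAlgebra.involute (α z)) x := by
  rw [SmoothFormAt, chartRep_involute]
  exact (LinearMap.toContinuousLinearMap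
    (CliffordAlgebra.involute : Ext E →ₐ[ℝ] Ext E).toLinearMap).contDiff.contDiffAt.comp_contDiffWithinAt
      _ hα

variable (I M) in
/-- The parity automorphism of `Ω(M)`, which is `(-1)^q` on forms of degree `q`. -/
def parity : Form I M →ₐ[ℝ] Form I M where
  toFun α := Form.mk (fun x => CliffordAlgebra.involute (Form.val I M α x))
    fun x => smoothFormAt_involute (α.smooth x)
  map_one' := Form.ext fun x => by simp [Form.val_mk]
  map_mul' α β := Form.ext fun x => by simp [Form.val_mk]
  map_zero' := Form.ext fun x => by simp [Form.val_mk]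
  map_add' α β := Form.ext fun x => by simp [Form.val_mk]
  commutes' r := Form.ext fun x => by simp [Form.val_mk, AlgHom.commutes]

theorem val_parity (α : Form I M) (x : M) :
    Form.val I M (parity I M α) x = CliffordAlgebra.involute (Form.val I M α x) := rfl

/-- A smooth function as a `0`-form. -/
def funForm (h : M → ℝ) (hh : ContMDiff I 𝓘(ℝ, ℝ) ∞ h) : Form I M :=
  Form.mk (fun x => algebraMap ℝ (Ext E) (h x)) fun x => smoothFormAt_fun (hh x)

theorem val_funForm (h : M → ℝ) (hh : ContMDiff I 𝓘(ℝ, ℝ) ∞ h) (x : M) :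
    Form.val I M (funForm h hh) x = algebraMap ℝ (Ext E) (h x) := rfl

theorem funForm_comm (h : M → ℝ) (hh : ContMDiff I 𝓘(ℝ, ℝ) ∞ h) (α : Form I M) :
    funForm h hh * α = α * funForm h hh :=
  Form.ext fun x => Algebra.commutes (h x) (Form.val I M α x)

theorem parity_funForm (h : M → ℝ) (hh : ContMDiff I 𝓘(ℝ, ℝ) ∞ h) :
    parity I M (funForm h hh) = funForm h hh :=
  Form.ext fun x => by rw [val_parity, val_funForm, AlgHom.commutes]

variable [IsManifold I ∞ M]

theorem extPull_chartD_chartRep (α : M → Ext E) {x₀ x : M} (hx : x ∈ (extChartAt I x₀).source) :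
    extPull (chartD I x₀ x) (chartRep I α x₀ (extChartAt I x₀ x)) = α x := by
  rw [chartRep, extPull_comp, chartSymmD_comp_chartD hx, extPull_id, (extChartAt I x₀).left_inv hx]

theorem val_extD (α : Form I M) (x : M) :
    Form.val I M (extD I M α) x = dForm I (Form.val I M α) x := rfl

theorem val_pullback {φ : M → M} (hφ : ContMDiff I I ∞ φ) (α : Form I M) (x : M) :
    Form.val I M (pullback I φ hφ α) x = extPull (tangentD I φ x) (Form.val I M α (φ x)) := rfl

theorem extD_mul (α β : Form I M) :
    extD I M (α * β) = extD I M α * β + parity I M α * extD I M β := by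
  refine Form.ext fun x => ?_
  rw [map_add, map_mul (Form.val I M), map_mul (Form.val I M), Pi.add_apply, Pi.mul_apply,
    Pi.mul_apply, val_extD, val_extD, val_extD, val_parity, map_mul]
  conv_lhs => rw [dForm, chartRep_mul, coordD_mul (I.uniqueDiffOn _ (extChartAt_self_mem_range _))
    ((α.smooth x).differentiableWithinAt (by simp))
    ((β.smooth x).differentiableWithinAt (by simp)), map_add, map_mul, map_mul,
    extPull_chartD_chartRep _ (mem_extChartAt_source x), ← involute_extPull,
    extPull_chartD_chartRep _ (mem_extChartAt_source x)]
  rfl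

theorem parity_extD (α : Form I M) : parity I M (extD I M α) = -extD I M (parity I M α) := by
  refine Form.ext fun x => ?_
  rw [val_parity, map_neg, Pi.neg_apply, val_extD, val_extD]
  have : Form.val I M (parity I M α) = fun z => CliffordAlgebra.involute (Form.val I M α z) := rfl
  rw [this, dForm, dForm, chartRep_involute, involute_coordD (I.uniqueDiffOn _ (extChartAt_self_mem_range _))
    ((α.smooth x).differentiableWithinAt (by simp)), map_neg, neg_neg, involute_extPull]

theorem extD_extD (α : Form I M) : extD I M (extD I M α) = 0 := by
  refine Form.ext fun x => ?_
  rw [val_extD, map_zero, Pi.zero_apply, dForm]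
  have h : chartRep I (Form.val I M (extD I M α)) x =ᶠ[𝓝[range I] (extChartAt I x x)]
      coordD (range I) (chartRep I (Form.val I M α) x) := by
    filter_upwards [extChartAt_target_mem_nhdsWithin (I := I) x] with z hz
    exact chartRep_dForm hz (α.smooth _)
  rw [coordD_congr (extChartAt_self_mem_range _) h, coordD_coordD I.uniqueDiffOn (extChartAt_self_mem_range _)
    (I.range_subset_closure_interior (extChartAt_self_mem_range _)) (α.smooth x), map_zero]

theorem val_extD_congr {α β : Form I M} {x : M}
    (h : Form.val I M α =ᶠ[𝓝 x] Form.val I M β) :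
    Form.val I M (extD I M α) x = Form.val I M (extD I M β) x := by
  rw [val_extD, val_extD, dForm, dForm]
  congr 1
  refine coordD_congr (extChartAt_self_mem_range _) ?_
  have hc : Tendsto (extChartAt I x).symm (𝓝[range I] (extChartAt I x x)) (𝓝 x) := by
    have := (continuousAt_extChartAt_symm (I := I) x).continuousWithinAt (s := range I)
    simpa [ContinuousWithinAt] using this
  filter_upwards [hc.eventually h] with y hy
  simp only [chartRep, hy]

/-- The derivative of a function as a covector. -/
def covectorD (I : ModelWithCorners ℝ E H) (h : M → ℝ) (x : M) : E →L[ℝ] ℝ :=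
  mfderiv I 𝓘(ℝ, ℝ) h x

theorem covectorD_eq_fderivWithin {h : M → ℝ} {x : M} (hh : MDifferentiableAt I 𝓘(ℝ, ℝ) h x) :
    covectorD I h x = fderivWithin ℝ (h ∘ (extChartAt I x).symm) (range I)
      (extChartAt I x x) := by
  rw [covectorD, hh.mfderiv]
  rfl

theorem val_extD_funForm (h : M → ℝ) (hh : ContMDiff I 𝓘(ℝ, ℝ) ∞ h) (x : M) :
    Form.val I M (extD I M (funForm h hh)) x =
      ExteriorAlgebra.ι ℝ (covectorD I h x : Module.Dual ℝ E) := by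
  have hd : MDifferentiableAt I 𝓘(ℝ, ℝ) h x := (hh x).mdifferentiableAt (by simp)
  have h1 : DifferentiableWithinAt ℝ (h ∘ (extChartAt I x).symm) (range I)
      (extChartAt I x x) :=
    (contMDiffAt_iff.mp (hh x)).2.differentiableWithinAt (by simp)
  have hr : chartRep I (Form.val I M (funForm h hh)) x =
      fun y => (Algebra.linearMap ℝ (Ext E)).toContinuousLinearMap
        ((h ∘ (extChartAt I x).symm) y) := by
    funext y
    simp [chartRep, AlgHom.commutes, val_funForm]
  have h2 : fderivWithin ℝ (chartRep I (Form.val I M (funForm h hh)) x) (range I)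
      (extChartAt I x x) = ((Algebra.linearMap ℝ (Ext E)).toContinuousLinearMap).comp
        (fderivWithin ℝ (h ∘ (extChartAt I x).symm) (range I) (extChartAt I x x)) := by
    rw [hr]
    exact ((ContinuousLinearMap.hasFDerivAt _).comp_hasFDerivWithinAt _
      h1.hasFDerivWithinAt).fderivWithin (I.uniqueDiffOn _ (extChartAt_self_mem_range _))
  have : IsManifold I 1 M := IsManifold.of_le (n := ∞) (by simp)
  have h4 : chartD I x x = ContinuousLinearMap.id ℝ E := mfderiv_extChartAt_self
  rw [val_extD, dForm, covectorD_eq_fderivWithin hd, h4, extPull_id]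
  have h3 : coordD (range I) (chartRep I (Form.val I M (funForm h hh)) x) (extChartAt I x x) =
      ExteriorAlgebra.ι ℝ (fderivWithin ℝ (h ∘ (extChartAt I x).symm) (range I)
        (extChartAt I x x) : Module.Dual ℝ E) := by
    rw [coordD, ι_eq_sum, h2]
    refine Finset.sum_congr rfl fun i _ => ?_
    simp [← Algebra.commutes, Algebra.smul_def]
  exact h3

theorem val_contract {X : M → E} (hX : SmoothVectorField I X) (α : Form I M) (x : M) :
    Form.val I M (contract X hX α) x = extContract (X x) (Form.val I M α x) := rfl

theorem contract_mul {X : M → E} (hX : SmoothVectorField I X) (α β : Form I M) :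
    contract X hX (α * β) = contract X hX α * β + parity I M α * contract X hX β := by
  refine Form.ext fun x => ?_
  simp only [map_add, map_mul, Pi.add_apply, Pi.mul_apply, val_contract, val_parity,
    extContract_mul]

theorem parity_contract {X : M → E} (hX : SmoothVectorField I X) (α : Form I M) :
    parity I M (contract X hX α) = -contract X hX (parity I M α) := by
  refine Form.ext fun x => ?_
  simp only [map_neg, Pi.neg_apply, val_contract, val_parity, involute_extContract]

theorem contract_funForm {X : M → E} (hX : SmoothVectorField I X) (h : M → ℝ)
    (hh : ContMDiff I 𝓘(ℝ, ℝ) ∞ h) : contract X hX (funForm h hh) = 0 :=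
  Form.ext fun _ => extContract_algebraMap _ _

theorem pullback_mul {φ : M → M} (hφ : ContMDiff I I ∞ φ) (α β : Form I M) :
    pullback I φ hφ (α * β) = pullback I φ hφ α * pullback I φ hφ β := by
  refine Form.ext fun x => ?_
  simp only [map_mul, Pi.mul_apply, val_pullback]

theorem pullback_algebraMap {φ : M → M} (hφ : ContMDiff I I ∞ φ) (r : ℝ) :
    pullback I φ hφ (algebraMap ℝ _ r) = algebraMap ℝ _ r := by
  refine Form.ext fun x => ?_
  rw [val_pullback, AlgHom.commutes]
  exact AlgHom.commutes _ r

theorem pullback_funForm {φ : M → M} (hφ : ContMDiff I I ∞ φ) (h : M → ℝ)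
    (hh : ContMDiff I 𝓘(ℝ, ℝ) ∞ h) :
    pullback I φ hφ (funForm h hh) = funForm (h ∘ φ) (hh.comp hφ) := by
  refine Form.ext fun x => ?_
  rw [val_pullback, val_funForm, val_funForm]
  exact AlgHom.commutes _ _

theorem pullback_extD {φ : M → M} (hφ : ContMDiff I I ∞ φ) (α : Form I M) :
    pullback I φ hφ (extD I M α) = extD I M (pullback I φ hφ α) := by
  refine Form.ext fun x => ?_
  have hx := mem_extChartAt_source (I := I) x
  have hx' := mem_extChartAt_source (I := I) (φ x)
  have hτ := contDiffWithinAt_transition hx hx' (hφ x)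
  have hev := eventually_chart hx hx' hφ
  have e2 := fderivWithin_transition (φ := φ) (x₀ := x) (x' := φ x) (z := extChartAt I x x)
    (mem_extChartAt_target x) (by rw [extChartAt_to_inv]; exact hx')
    ((hφ _).mdifferentiableAt (by simp))
  rw [extChartAt_to_inv] at e2
  set τ := extChartAt I (φ x) ∘ φ ∘ (extChartAt I x).symm with hτdef
  have hτx : τ (extChartAt I x x) = extChartAt I (φ x) (φ x) := by simp [hτdef]
  have heq : chartRep I (Form.val I M (pullback I φ hφ α)) x =ᶠ[𝓝[range I] (extChartAt I x x)]
      fun w => extPull (fderivWithin ℝ τ (range I) w)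
        (chartRep I (Form.val I M α) (φ x) (τ w)) := by
    filter_upwards [hev] with w hw
    exact chartRep_pullForm hw.1 hw.2 ((hφ _).mdifferentiableAt (by simp))
  rw [val_extD, dForm, coordD_congr (extChartAt_self_mem_range _) heq, coordD_pullback (t := range I)
    I.uniqueDiffOn (extChartAt_self_mem_range _) (I.range_subset_closure_interior (extChartAt_self_mem_range _)) hτ
    (by intro w _; simp [hτdef])
    (by rw [hτx]; exact (α.smooth (φ x)).differentiableWithinAt (by simp)), hτx, e2,
    val_pullback, val_extD, dForm, extPull_comp, extPull_comp]
  congr 2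
  rw [ContinuousLinearMap.comp_assoc, ContinuousLinearMap.comp_assoc, chartSymmD_comp_chartD hx,
    ContinuousLinearMap.comp_id]

end FormCalculus

section LocalGeneration

variable {E : Type*} [NormedAddCommGroup E] [NormedSpace ℝ E] [FiniteDimensional ℝ E]
  {H : Type*} [TopologicalSpace H] {I : ModelWithCorners ℝ E H}
  {M : Type*} [TopologicalSpace M] [ChartedSpace H M] [IsManifold I ∞ M]

theorem contDiffWithinAt_chartRep {α : M → Ext E} (hα : ∀ x, SmoothFormAt I α x) {x₀ : M} {z : E}
    (hz : z ∈ (extChartAt I x₀).target) :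
    ContDiffWithinAt ℝ ∞ (chartRep I α x₀) (range I) z := by
  set x := (extChartAt I x₀).symm z with hxdef
  have hx : x ∈ (extChartAt I x₀).source := (extChartAt I x₀).map_target hz
  have hzx : extChartAt I x₀ x = z := (extChartAt I x₀).right_inv hz
  have hzr : z ∈ range I := extChartAt_target_subset_range x₀ hz
  have hτ := contDiffWithinAt_transition (φ := id) hx (mem_extChartAt_source (I := I) x)
    contMDiffAt_id
  rw [hzx] at hτ
  have hev := eventually_chart (φ := id) hx (mem_extChartAt_source (I := I) x) contMDiff_id
  rw [hzx] at hev
  set τ := extChartAt I x ∘ id ∘ (extChartAt I x₀).symm with hτdef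
  have hτz : τ z = extChartAt I x x := rfl
  have hD : ContDiffWithinAt ℝ ∞ (fderivWithin ℝ τ (range I)) (range I) z :=
    hτ.fderivWithin_right I.uniqueDiffOn (by simp) hzr
  have hβ : ContDiffWithinAt ℝ ∞ (fun w => chartRep I α x (τ w)) (range I) z := by
    refine ContDiffWithinAt.comp (g := chartRep I α x) (t := range I) z ?_ hτ ?_
    · rw [hτz]
      exact hα x
    · intro w _
      simp [hτdef]
  have heq : chartRep I α x₀ =ᶠ[𝓝[range I] z] fun w =>
      extPullL (fderivWithin ℝ τ (range I) w) (chartRep I α x (τ w)) := by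
    filter_upwards [hev] with w hw
    have := chartRep_pullForm (α := α) hw.1 hw.2 mdifferentiableAt_id
    rwa [pullForm_id] at this
  exact ((contDiff_extPullL.contDiffAt.comp_contDiffWithinAt _ hD).clm_apply hβ).congr_of_eventuallyEq
    heq (heq.self_of_nhdsWithin hzr)

theorem contMDiffOn_chartRep {F : Type*} [NormedAddCommGroup F] [NormedSpace ℝ F]
    {α : M → Ext E} (hα : ∀ x, SmoothFormAt I α x) (x₀ : M) (l : Ext E →L[ℝ] F) :
    ContMDiffOn I 𝓘(ℝ, F) ∞ (fun y => l (chartRep I α x₀ (extChartAt I x₀ y)))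
      (chartAt H x₀).source := by
  intro y hy
  have hy' : y ∈ (extChartAt I x₀).source := by rwa [extChartAt_source]
  have h1 : ContMDiffWithinAt 𝓘(ℝ, E) 𝓘(ℝ, F) ∞ (fun z => l (chartRep I α x₀ z)) (range I)
      (extChartAt I x₀ y) :=
    (l.contDiff.contDiffAt.comp_contDiffWithinAt _ (contDiffWithinAt_chartRep hα
      ((extChartAt I x₀).map_source hy'))).contMDiffWithinAt
  refine h1.comp y (contMDiffAt_extChartAt' hy).contMDiffWithinAt ?_
  intro w _
  exact mem_range_self _

variable [T2Space M]

/-- Near any given point, every smooth form is a polynomial in functions and their differentials.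
-/
theorem Form.local_induction (x₀ : M) {P : Form I M → Prop}
    (hfun : ∀ h hh, P (funForm h hh)) (hd : ∀ h hh, P (extD I M (funForm h hh)))
    (hadd : ∀ α β, P α → P β → P (α + β)) (hmul : ∀ α β, P α → P β → P (α * β))
    (hcongr : ∀ α β, Form.val I M α =ᶠ[𝓝 x₀] Form.val I M β → P α → P β) (α : Form I M) : P α := by
  have : IsManifold I 1 M := IsManifold.of_le (n := ∞) (by simp)
  have : Nonempty (SmoothBumpFunction I x₀) := inferInstance
  let χ : SmoothBumpFunction I x₀ := Classical.choice this
  have hχ : ∀ᶠ y in 𝓝 x₀, χ =ᶠ[𝓝 y] 1 := χ.eventuallyEq_one.eventuallyEq_nhds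
  have hsrc : ∀ᶠ y in 𝓝 x₀, y ∈ (chartAt H x₀).source :=
    (chartAt H x₀).open_source.mem_nhds (mem_chart_source H x₀)
  -- constant coefficient forms in the chart
  have key : ∀ e : Ext E, ∃ β : Form I M, P β ∧
      ∀ᶠ y in 𝓝 x₀, Form.val I M β y = extPull (chartD I x₀ y) e := by
    intro e
    induction e using ExteriorAlgebra.induction with
    | algebraMap r =>
      refine ⟨funForm (fun _ => r) contMDiff_const, hfun _ _, Eventually.of_forall fun y => ?_⟩
      rw [val_funForm, AlgHom.commutes]
    | ι φ =>
      let φ' : E →L[ℝ] ℝ := LinearMap.toContinuousLinearMap φ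
      have hs : ContMDiff I 𝓘(ℝ, ℝ) ∞ (fun y => χ y • φ' (extChartAt I x₀ y)) :=
        χ.contMDiff_smul (φ'.contMDiff.comp_contMDiffOn contMDiffOn_extChartAt)
      refine ⟨_, hd _ hs, ?_⟩
      filter_upwards [hχ, hsrc] with y hy hys
      rw [val_extD_funForm, extPull_ι]
      congr 1
      have h1 : (fun y => χ y • φ' (extChartAt I x₀ y)) =ᶠ[𝓝 y] φ' ∘ extChartAt I x₀ := by
        filter_upwards [hy] with w hw
        simp [hw]
      have h2 : covectorD I (fun y => χ y • φ' (extChartAt I x₀ y)) y = φ'.comp (chartD I x₀ y) := by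
        rw [covectorD, h1.mfderiv_eq]
        have h3 := mfderiv_comp (I := I) (I' := 𝓘(ℝ, E)) (I'' := 𝓘(ℝ, ℝ)) y
          (g := φ') (f := extChartAt I x₀)
          φ'.mdifferentiableAt (mdifferentiableAt_extChartAt hys)
        refine h3.trans ?_
        rw [φ'.mfderiv_eq]
        rfl
      rw [h2]
      rfl
    | mul a b ha hb =>
      obtain ⟨α, hα, hα'⟩ := ha
      obtain ⟨β, hβ, hβ'⟩ := hb
      refine ⟨α * β, hmul _ _ hα hβ, ?_⟩
      filter_upwards [hα', hβ'] with y h1 h2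
      rw [map_mul, map_mul, Pi.mul_apply, h1, h2]
    | add a b ha hb =>
      obtain ⟨α, hα, hα'⟩ := ha
      obtain ⟨β, hβ, hβ'⟩ := hb
      refine ⟨α + β, hadd _ _ hα hβ, ?_⟩
      filter_upwards [hα', hβ'] with y h1 h2
      rw [map_add, map_add, Pi.add_apply, h1, h2]
  choose B hB hB' using key
  let b := Module.finBasis ℝ (Ext E)
  let l : ∀ i, Ext E →L[ℝ] ℝ := fun i => LinearMap.toContinuousLinearMap (b.coord i)
  have hs : ∀ i, ContMDiff I 𝓘(ℝ, ℝ) ∞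
      (fun y => χ y • l i (chartRep I (Form.val I M α) x₀ (extChartAt I x₀ y))) := fun i =>
    χ.contMDiff_smul (contMDiffOn_chartRep α.smooth x₀ (l i))
  have hsum : ∀ s : Finset (Fin (Module.finrank ℝ (Ext E))),
      P (∑ i ∈ s, funForm _ (hs i) * B (b i)) := by
    intro s
    induction s using Finset.induction_on with
    | empty =>
      rw [Finset.sum_empty]
      refine hcongr (funForm (fun _ => 0) contMDiff_const) 0 (Eventually.of_forall fun y => ?_)
        (hfun _ _)
      rw [val_funForm]
      simp
    | insert i s hi ih =>
      rw [Finset.sum_insert hi]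
      exact hadd _ _ (hmul _ _ (hfun _ _) (hB _)) ih
  refine hcongr _ _ ?_ (hsum Finset.univ)
  have hall : ∀ᶠ y in 𝓝 x₀, ∀ i, Form.val I M (B (b i)) y = extPull (chartD I x₀ y) (b i) :=
    eventually_all.mpr fun i => hB' (b i)
  filter_upwards [hall, χ.eventuallyEq_one, hsrc] with y h1 h2 h3
  have h4 := extPull_chartD_chartRep (I := I) (Form.val I M α) (x₀ := x₀) (x := y)
    (by rwa [extChartAt_source])
  rw [← h4, map_sum, Finset.sum_apply]
  conv_rhs => rw [← b.sum_repr (chartRep I (Form.val I M α) x₀ (extChartAt I x₀ y)), map_sum]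
  refine Finset.sum_congr rfl fun i _ => ?_
  rw [map_mul, Pi.mul_apply, h1 i, val_funForm, h2,
    map_smul (extPull _), ← Algebra.smul_def]
  simp [l]

end LocalGeneration

section AdjointDerivative

variable {EG : Type*} [NormedAddCommGroup EG] [NormedSpace ℝ EG] [FiniteDimensional ℝ EG]
  {G : Type*} [TopologicalSpace G] [ChartedSpace EG G] [Group G] [LieGroup 𝓘(ℝ, EG) ∞ G]

variable (EG G) in
/-- The chart of `G` at `1`. -/
abbrev oneChart : PartialEquiv G EG := extChartAt 𝓘(ℝ, EG) (1 : G)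

variable (EG G) in
/-- The image of `1` in the chart at `1`. -/
abbrev onePoint : EG := oneChart EG G 1

/-- The curve through `1` in `G` which is a line in the chart at `1`. -/
def chartCurve (ξ : EG) (t : ℝ) : G := (oneChart EG G).symm (onePoint EG G + t • ξ)

variable (EG G) in
/-- The multiplication of `G` in the chart at `1`. -/
def chartMul (p : EG × EG) : EG :=
  oneChart EG G ((oneChart EG G).symm p.1 * (oneChart EG G).symm p.2)

variable (G) in
/-- Conjugation by the points of `chartCurve ξ` in the chart at `1`. -/
def chartConj (ξ : EG) (p : ℝ × EG) : EG :=
  oneChart EG G (chartCurve ξ p.1 * (oneChart EG G).symm p.2 * (chartCurve ξ p.1 : G)⁻¹)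

theorem oneChart_symm_onePoint : (oneChart EG G).symm (onePoint EG G) = 1 := extChartAt_to_inv _

theorem chartCurve_zero (ξ : EG) : (chartCurve ξ 0 : G) = 1 := by
  rw [chartCurve, zero_smul, add_zero, oneChart_symm_onePoint]

theorem oneChart_target_mem_nhds : (oneChart EG G).target ∈ 𝓝 (onePoint EG G) :=
  extChartAt_target_mem_nhds _

theorem contMDiffAt_oneChart_symm {e : EG} (he : e ∈ (oneChart EG G).target) :
    ContMDiffAt 𝓘(ℝ, EG) 𝓘(ℝ, EG) ∞ (oneChart EG G).symm e :=
  (contMDiffOn_extChartAt_symm (1 : G)).contMDiffAt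
    ((isOpen_extChartAt_target (I := 𝓘(ℝ, EG)) (1 : G)).mem_nhds he)

theorem contMDiffAt_chartCurve {ξ : EG} {t : ℝ}
    (ht : onePoint EG G + t • ξ ∈ (oneChart EG G).target) :
    ContMDiffAt 𝓘(ℝ, ℝ) 𝓘(ℝ, EG) ∞ (chartCurve ξ : ℝ → G) t := by
  have h : ContMDiffAt 𝓘(ℝ, ℝ) 𝓘(ℝ, EG) ∞ (fun t : ℝ => onePoint EG G + t • ξ) t :=
    (ContDiff.contMDiff (by fun_prop)).contMDiffAt
  exact (contMDiffAt_oneChart_symm ht).comp t h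

theorem eventually_chartCurve_target (ξ : EG) :
    ∀ᶠ t in 𝓝 (0 : ℝ), onePoint EG G + t • ξ ∈ (oneChart EG G).target := by
  have h : Continuous (fun t : ℝ => onePoint EG G + t • ξ) := by fun_prop
  have h0 : Tendsto (fun t : ℝ => onePoint EG G + t • ξ) (𝓝 0) (𝓝 (onePoint EG G)) := by
    simpa using h.tendsto 0
  exact h0.eventually oneChart_target_mem_nhds

theorem contMDiffAt_chartCurve_zero (ξ : EG) :
    ContMDiffAt 𝓘(ℝ, ℝ) 𝓘(ℝ, EG) ∞ (chartCurve ξ : ℝ → G) 0 :=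
  contMDiffAt_chartCurve (eventually_chartCurve_target ξ).self_of_nhds

theorem hasMFDerivAt_chartCurve (ξ : EG) :
    HasMFDerivAt 𝓘(ℝ, ℝ) 𝓘(ℝ, EG) (chartCurve ξ : ℝ → G) 0
      (ContinuousLinearMap.toSpanSingleton ℝ ξ : ℝ →L[ℝ] EG) := by
  have h1 := ((contMDiffAt_chartCurve_zero (G := G) ξ).mdifferentiableAt (by simp)).hasMFDerivAt
  have : IsManifold 𝓘(ℝ, EG) 1 G := IsManifold.of_le (n := ∞) (by simp)
  refine ⟨h1.1, ?_⟩
  have h2 : HasFDerivAt (fun t : ℝ => onePoint EG G + t • ξ)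
      (ContinuousLinearMap.toSpanSingleton ℝ ξ) 0 := by
    have := (hasDerivAt_id (0 : ℝ)).smul_const ξ
    simpa using (this.const_add (onePoint EG G)).hasFDerivAt
  have h3 : (fun t : ℝ => onePoint EG G + t • ξ) =ᶠ[𝓝 0]
      writtenInExtChartAt 𝓘(ℝ, ℝ) 𝓘(ℝ, EG) 0 (chartCurve ξ : ℝ → G) := by
    filter_upwards [eventually_chartCurve_target (G := G) ξ] with t ht
    have := (oneChart EG G).right_inv ht
    simp only [writtenInExtChartAt, chartCurve_zero, Function.comp_apply]
    exact this.symm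
  exact (h2.congr_of_eventuallyEq h3.symm).hasFDerivWithinAt

theorem contDiffAt_chartMul : ContDiffAt ℝ ∞ (chartMul EG G) (onePoint EG G, onePoint EG G) := by
  rw [← contMDiffAt_iff_contDiffAt]
  have h1 : ContMDiffAt 𝓘(ℝ, EG × EG) 𝓘(ℝ, EG) ∞ (fun p : EG × EG => (oneChart EG G).symm p.1)
      (onePoint EG G, onePoint EG G) :=
    (contMDiffAt_oneChart_symm (mem_extChartAt_target (1 : G))).comp
      (onePoint EG G, onePoint EG G) contDiff_fst.contMDiff.contMDiffAt
  have h2 : ContMDiffAt 𝓘(ℝ, EG × EG) 𝓘(ℝ, EG) ∞ (fun p : EG × EG => (oneChart EG G).symm p.2)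
      (onePoint EG G, onePoint EG G) :=
    (contMDiffAt_oneChart_symm (mem_extChartAt_target (1 : G))).comp
      (onePoint EG G, onePoint EG G) contDiff_snd.contMDiff.contMDiffAt
  have h3 := h1.mul h2
  refine ContMDiffAt.comp (I' := 𝓘(ℝ, EG)) (onePoint EG G, onePoint EG G) (g := oneChart EG G) ?_ h3
  have : (oneChart EG G).symm (onePoint EG G) * (oneChart EG G).symm (onePoint EG G) = 1 := by
    rw [oneChart_symm_onePoint, one_mul]
  rw [this]
  exact contMDiffAt_extChartAt

theorem contDiffAt_chartConj (ξ : EG) : ContDiffAt ℝ ∞ (chartConj G ξ) (0, onePoint EG G) := by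
  rw [← contMDiffAt_iff_contDiffAt]
  have h1 : ContMDiffAt 𝓘(ℝ, ℝ × EG) 𝓘(ℝ, EG) ∞ (fun p : ℝ × EG => (chartCurve ξ p.1 : G))
      (0, onePoint EG G) :=
    ContMDiffAt.comp (g := (chartCurve ξ : ℝ → G)) (0, onePoint EG G)
      (contMDiffAt_chartCurve_zero ξ) contDiff_fst.contMDiff.contMDiffAt
  have h2 : ContMDiffAt 𝓘(ℝ, ℝ × EG) 𝓘(ℝ, EG) ∞ (fun p : ℝ × EG => (oneChart EG G).symm p.2)
      (0, onePoint EG G) :=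
    (contMDiffAt_oneChart_symm (mem_extChartAt_target (1 : G))).comp
      (0, onePoint EG G) contDiff_snd.contMDiff.contMDiffAt
  have h3 := (h1.mul h2).mul h1.inv
  refine ContMDiffAt.comp (I' := 𝓘(ℝ, EG)) (0, onePoint EG G) (g := oneChart EG G) ?_ h3
  have : (chartCurve ξ 0 : G) * (oneChart EG G).symm (onePoint EG G) * (chartCurve ξ 0 : G)⁻¹ = 1 := by
    rw [chartCurve_zero, oneChart_symm_onePoint, one_mul, inv_one, one_mul]
  change ContMDiffAt _ _ _ _
    ((chartCurve ξ 0 : G) * (oneChart EG G).symm (onePoint EG G) * (chartCurve ξ 0 : G)⁻¹)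
  rw [this]
  exact contMDiffAt_extChartAt

theorem contMDiff_conj (g : G) :
    ContMDiff 𝓘(ℝ, EG) 𝓘(ℝ, EG) ∞ (fun h : G => g * h * g⁻¹) :=
  (contMDiff_mul_right (a := g⁻¹)).comp (contMDiff_mul_left (a := g))

theorem mfderiv_apply_eq_fderiv_oneChart {φ : G → EG} (hφ : MDifferentiableAt 𝓘(ℝ, EG) 𝓘(ℝ, EG) φ 1) :
    (mfderiv 𝓘(ℝ, EG) 𝓘(ℝ, EG) φ 1 : EG →L[ℝ] EG) =
      fderiv ℝ (φ ∘ (oneChart EG G).symm) (onePoint EG G) := by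
  rw [hφ.mfderiv]
  simp only [ModelWithCorners.range_eq_univ, fderivWithin_univ]
  rfl

theorem Ad_apply_eq_fderiv (g : G) (η : EG) :
    Ad g η = fderiv ℝ (fun e : EG => oneChart EG G (g * (oneChart EG G).symm e * g⁻¹))
      (onePoint EG G) η := by
  have h := (contMDiff_conj (EG := EG) g 1).mdifferentiableAt (by simp)
  have h1 : (mfderiv 𝓘(ℝ, EG) 𝓘(ℝ, EG) (fun h : G => g * h * g⁻¹) 1 : EG →L[ℝ] EG) =
      fderiv ℝ (extChartAt 𝓘(ℝ, EG) (g * 1 * g⁻¹) ∘ (fun h : G => g * h * g⁻¹) ∘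
        (oneChart EG G).symm) (onePoint EG G) := by
    rw [h.mfderiv]
    simp only [ModelWithCorners.range_eq_univ, fderivWithin_univ]
    rfl
  have h2 : g * 1 * g⁻¹ = 1 := by simp
  rw [h2] at h1
  exact DFunLike.congr_fun h1 η

/-- The relation `(g h g⁻¹) g = g h` in the chart at `1`. -/
theorem eventually_chartMul_chartConj (ξ : EG) :
    ∀ᶠ p in 𝓝 ((0 : ℝ), onePoint EG G),
      chartMul EG G (chartConj G ξ p, onePoint EG G + p.1 • ξ) =
        chartMul EG G (onePoint EG G + p.1 • ξ, p.2) := by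
  have hc : ContinuousAt (fun p : ℝ × EG =>
      (chartCurve ξ p.1 : G) * (oneChart EG G).symm p.2 * (chartCurve ξ p.1 : G)⁻¹)
      (0, onePoint EG G) := by
    have h1 : ContinuousAt (fun p : ℝ × EG => (chartCurve ξ p.1 : G)) (0, onePoint EG G) :=
      ContinuousAt.comp (g := (chartCurve ξ : ℝ → G)) (f := Prod.fst)
        (contMDiffAt_chartCurve_zero (G := G) ξ).continuousAt continuousAt_fst
    have h2 : ContinuousAt (fun p : ℝ × EG => (oneChart EG G).symm p.2) (0, onePoint EG G) :=
      ContinuousAt.comp (g := (oneChart EG G).symm) (f := Prod.snd)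
        (continuousAt_extChartAt_symm (1 : G)) continuousAt_snd
    have : IsTopologicalGroup G := topologicalGroup_of_lieGroup 𝓘(ℝ, EG) ∞
    exact (h1.mul h2).mul h1.inv
  have h0 : (oneChart EG G).source ∈ 𝓝 ((chartCurve ξ (0 : ℝ) : G) *
      (oneChart EG G).symm (onePoint EG G) * (chartCurve ξ (0 : ℝ) : G)⁻¹) := by
    have : (chartCurve ξ 0 : G) * (oneChart EG G).symm (onePoint EG G) *
      (chartCurve ξ 0 : G)⁻¹ = 1 := by
      rw [chartCurve_zero, oneChart_symm_onePoint, one_mul, inv_one, one_mul]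
    rw [this]
    exact extChartAt_source_mem_nhds _
  filter_upwards [hc h0] with p hp
  have h4 := (oneChart EG G).left_inv hp
  simp only [chartMul, chartConj]
  rw [h4]
  simp [chartCurve]

/-- The derivative of the adjoint action is the bracket, in the chart at `1`. -/
theorem hasDerivAt_Ad_chartCurve (ξ η : EG) :
    HasDerivAt (fun t => (Ad (chartCurve ξ t : G) η : EG))
      (fderiv ℝ (fderiv ℝ (chartMul EG G)) (onePoint EG G, onePoint EG G) (ξ, 0) (0, η) -
        fderiv ℝ (fderiv ℝ (chartMul EG G)) (onePoint EG G, onePoint EG G) (0, ξ) (η, 0)) 0 := by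
  set e₀ := onePoint EG G with he₀
  set m := chartMul EG G with hm
  set K := chartConj G ξ with hK
  have hKs : ContDiffAt ℝ ∞ K (0, e₀) := contDiffAt_chartConj ξ
  have hms : ContDiffAt ℝ ∞ m (e₀, e₀) := contDiffAt_chartMul
  have hK0 : ∀ t, K (t, e₀) = e₀ := by
    intro t
    rw [hK, he₀, chartConj, oneChart_symm_onePoint, mul_one, mul_inv_cancel]
  have hKd : ∀ᶠ t in 𝓝 (0 : ℝ), DifferentiableAt ℝ K (t, e₀) := by
    have h1 : ∀ᶠ p in 𝓝 ((0 : ℝ), e₀), DifferentiableAt ℝ K p :=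
      ((hKs.of_le (m := 1) (by simp)).eventually (by simp)).mono fun p hp =>
        hp.differentiableAt (by simp)
    have h2 : Tendsto (fun t : ℝ => (t, e₀)) (𝓝 0) (𝓝 (0, e₀)) :=
      (Continuous.prodMk_left e₀).tendsto 0
    exact h2.eventually h1
  have hmd : ∀ᶠ p in 𝓝 (e₀, e₀), DifferentiableAt ℝ m p :=
    ((hms.of_le (m := 1) (by simp)).eventually (by simp)).mono fun p hp =>
      hp.differentiableAt (by simp)
  have hinr : ∀ t, DifferentiableAt ℝ K (t, e₀) →
      HasFDerivAt (fun e => K (t, e)) ((fderiv ℝ K (t, e₀)).comp (.inr ℝ ℝ EG)) e₀ := fun t ht =>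
    ht.hasFDerivAt.comp e₀ (hasFDerivAt_prodMk_right t e₀)
  have hAd : ∀ᶠ t in 𝓝 (0 : ℝ), (Ad (chartCurve ξ t : G) η : EG) = fderiv ℝ K (t, e₀) (0, η) := by
    filter_upwards [hKd] with t ht
    rw [Ad_apply_eq_fderiv]
    exact DFunLike.congr_fun (hinr t ht).fderiv η
  have hDK : DifferentiableAt ℝ (fderiv ℝ K) (0, e₀) :=
    ((hKs.fderiv_right (m := ∞) (by simp))).differentiableAt (by simp)
  have hDm : DifferentiableAt ℝ (fderiv ℝ m) (e₀, e₀) :=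
    ((hms.fderiv_right (m := ∞) (by simp))).differentiableAt (by simp)
  set a' := fderiv ℝ (fderiv ℝ K) (0, e₀) (1, 0) (0, η) with ha'
  have hderK : HasDerivAt (fun t : ℝ => fderiv ℝ K (t, e₀) (0, η)) a' 0 := by
    have h1 : HasDerivAt (fun t : ℝ => (t, e₀)) ((1 : ℝ), (0 : EG)) 0 :=
      (hasDerivAt_id (0 : ℝ)).prodMk (hasDerivAt_const (0 : ℝ) e₀)
    have h2 := hDK.hasFDerivAt.comp_hasDerivAt (0 : ℝ) h1
    simpa using h2.clm_apply (hasDerivAt_const (0 : ℝ) ((0 : ℝ), η))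
  have hc : HasDerivAt (fun t : ℝ => e₀ + t • ξ) ξ 0 := by
    simpa using ((hasDerivAt_id (0 : ℝ)).smul_const ξ).const_add e₀
  have hc1 : HasDerivAt (fun t : ℝ => (e₀, e₀ + t • ξ)) ((0 : EG), ξ) 0 :=
    (hasDerivAt_const (0 : ℝ) e₀).prodMk hc
  have hc2 : HasDerivAt (fun t : ℝ => (e₀ + t • ξ, e₀)) (ξ, (0 : EG)) 0 :=
    hc.prodMk (hasDerivAt_const (0 : ℝ) e₀)
  have hm1 : HasDerivAt (fun t : ℝ => fderiv ℝ m (e₀, e₀ + t • ξ))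
      (fderiv ℝ (fderiv ℝ m) (e₀, e₀) (0, ξ)) 0 := by
    refine HasFDerivAt.comp_hasDerivAt (l := fderiv ℝ m) (f := fun t : ℝ => (e₀, e₀ + t • ξ))
      (0 : ℝ) ?_ hc1
    simpa using hDm.hasFDerivAt
  have hm2 : HasDerivAt (fun t : ℝ => fderiv ℝ m (e₀ + t • ξ, e₀))
      (fderiv ℝ (fderiv ℝ m) (e₀, e₀) (ξ, 0)) 0 := by
    refine HasFDerivAt.comp_hasDerivAt (l := fderiv ℝ m) (f := fun t : ℝ => (e₀ + t • ξ, e₀))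
      (0 : ℝ) ?_ hc2
    simpa using hDm.hasFDerivAt
  have hrel : (fun t : ℝ => fderiv ℝ m (e₀, e₀ + t • ξ) (fderiv ℝ K (t, e₀) (0, η), 0)) =ᶠ[𝓝 0]
      fun t => fderiv ℝ m (e₀ + t • ξ, e₀) (0, η) := by
    have hev : ∀ᶠ t in 𝓝 (0 : ℝ), ∀ᶠ e in 𝓝 e₀, m (K (t, e), e₀ + t • ξ) = m (e₀ + t • ξ, e) := by
      have := eventually_chartMul_chartConj (G := G) ξ
      rw [nhds_prod_eq] at this
      exact this.curry
    have t1 : Tendsto (fun t : ℝ => (e₀, e₀ + t • ξ)) (𝓝 0) (𝓝 (e₀, e₀)) := by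
      simpa using hc1.continuousAt.tendsto
    have t2 : Tendsto (fun t : ℝ => (e₀ + t • ξ, e₀)) (𝓝 0) (𝓝 (e₀, e₀)) := by
      simpa using hc2.continuousAt.tendsto
    filter_upwards [hev, hKd, t1.eventually hmd, t2.eventually hmd] with t h1 h2 h3 h4
    have f1 : HasFDerivAt (fun e => (K (t, e), e₀ + t • ξ))
        (((fderiv ℝ K (t, e₀)).comp (.inr ℝ ℝ EG)).prod 0) e₀ :=
      (hinr t h2).prodMk (hasFDerivAt_const _ _)
    have f2 : HasFDerivAt (fun e => m (K (t, e), e₀ + t • ξ)) ((fderiv ℝ m (e₀, e₀ + t • ξ)).comp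
        (((fderiv ℝ K (t, e₀)).comp (.inr ℝ ℝ EG)).prod 0)) e₀ := by
      refine HasFDerivAt.comp (g := m) (f := fun e => (K (t, e), e₀ + t • ξ)) e₀ ?_ f1
      rw [hK0]
      exact h3.hasFDerivAt
    have f3 : HasFDerivAt (fun e => m (e₀ + t • ξ, e)) ((fderiv ℝ m (e₀ + t • ξ, e₀)).comp
        (.inr ℝ EG EG)) e₀ := h4.hasFDerivAt.comp e₀ (hasFDerivAt_prodMk_right _ e₀)
    have f4 := f2.unique (f3.congr_of_eventuallyEq h1)
    simpa using DFunLike.congr_fun f4 η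
  have hd1 : HasDerivAt (fun t : ℝ => fderiv ℝ m (e₀, e₀ + t • ξ)
      (fderiv ℝ K (t, e₀) (0, η), 0)) (fderiv ℝ (fderiv ℝ m) (e₀, e₀) (0, ξ)
        (fderiv ℝ K (0, e₀) (0, η), 0) + fderiv ℝ m (e₀, e₀ + (0 : ℝ) • ξ) (a', 0)) 0 :=
    hm1.clm_apply (hderK.prodMk (hasDerivAt_const (0 : ℝ) (0 : EG)))
  have hd2 : HasDerivAt (fun t : ℝ => fderiv ℝ m (e₀ + t • ξ, e₀) (0, η))
      (fderiv ℝ (fderiv ℝ m) (e₀, e₀) (ξ, 0) (0, η)) 0 := by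
    simpa using hm2.clm_apply (hasDerivAt_const (0 : ℝ) ((0 : EG), η))
  have huniq := hd1.unique (hd2.congr_of_eventuallyEq hrel)
  have hK00 : fderiv ℝ K (0, e₀) (0, η) = η := by
    have h1 : (fun e => K (0, e)) =ᶠ[𝓝 e₀] id := by
      filter_upwards [oneChart_target_mem_nhds (EG := EG) (G := G)] with e he
      simpa [hK, chartConj, chartCurve_zero] using (oneChart EG G).right_inv he
    have h2 := (hinr 0 hKd.self_of_nhds).unique ((hasFDerivAt_id e₀).congr_of_eventuallyEq h1)
    exact DFunLike.congr_fun h2 η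
  have hm00 : fderiv ℝ m (e₀, e₀ + (0 : ℝ) • ξ) (a', 0) = a' := by
    have h1 : (fun e => m (e, e₀)) =ᶠ[𝓝 e₀] id := by
      filter_upwards [oneChart_target_mem_nhds (EG := EG) (G := G)] with e he
      rw [hm, chartMul, he₀, oneChart_symm_onePoint, mul_one]
      exact (oneChart EG G).right_inv he
    have h2 : HasFDerivAt (fun e => m (e, e₀)) ((fderiv ℝ m (e₀, e₀)).comp (.inl ℝ EG EG)) e₀ :=
      HasFDerivAt.comp (g := m) (f := fun e => (e, e₀)) e₀ hmd.self_of_nhds.hasFDerivAt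
        (hasFDerivAt_prodMk_left e₀ e₀)
    have h3 := h2.unique ((hasFDerivAt_id e₀).congr_of_eventuallyEq h1)
    simpa using DFunLike.congr_fun h3 a'
  rw [hK00, hm00] at huniq
  rw [← eq_sub_iff_add_eq'.mpr huniq]
  exact hderK.congr_of_eventuallyEq hAd

end AdjointDerivative

section AdjointBracket

variable {EG : Type*} [NormedAddCommGroup EG] [NormedSpace ℝ EG] [FiniteDimensional ℝ EG]
  {G : Type*} [TopologicalSpace G] [ChartedSpace EG G] [Group G] [LieGroup 𝓘(ℝ, EG) ∞ G]

/-- The identification of the Lie algebra, i.e. the tangent space at `1`, with the model space. -/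
def toModel : LieAlg EG G →ₗ[ℝ] EG := (LinearMap.id : EG →ₗ[ℝ] EG)

theorem lieGroup_minSmoothness : LieGroup 𝓘(ℝ, EG) (minSmoothness ℝ 3) G :=
  LieGroup.of_le (n := ∞) (by simp; exact ENat.LEInfty.out)

variable (EG) in
/-- A left-invariant vector field, read in the chart at `1`. -/
theorem eventually_mpullbackWithin_mulInvariantVectorField (η : LieAlg EG G) :
    ∀ᶠ e in 𝓝 (onePoint EG G),
      (VectorField.mpullbackWithin 𝓘(ℝ, EG) 𝓘(ℝ, EG) (oneChart EG G).symm
        (mulInvariantVectorField (I := 𝓘(ℝ, EG)) (G := G) η) (range 𝓘(ℝ, EG)) e : EG) =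
      fderiv ℝ (chartMul EG G) (e, onePoint EG G) (0, toModel η) := by
  have : IsManifold 𝓘(ℝ, EG) 1 G := IsManifold.of_le (n := ∞) (by simp)
  have hmd : ∀ᶠ p in 𝓝 (onePoint EG G, onePoint EG G), DifferentiableAt ℝ (chartMul EG G) p :=
    (((contDiffAt_chartMul (EG := EG) (G := G)).of_le (m := 1) (by simp)).eventually
      (by simp)).mono fun p hp => hp.differentiableAt (by simp)
  have ht : Tendsto (fun e : EG => (e, onePoint EG G)) (𝓝 (onePoint EG G))
      (𝓝 (onePoint EG G, onePoint EG G)) := (Continuous.prodMk_left _).tendsto _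
  filter_upwards [oneChart_target_mem_nhds (EG := EG) (G := G), ht.eventually hmd] with e he hd
  set g := (oneChart EG G).symm e with hg
  have hgs : g ∈ (oneChart EG G).source := (oneChart EG G).map_target he
  have hge : oneChart EG G g = e := (oneChart EG G).right_inv he
  have h1 := chartSymmD_comp_chartD hgs
  rw [hge] at h1
  have h2 : (chartD 𝓘(ℝ, EG) (1 : G) g).comp (chartSymmD 𝓘(ℝ, EG) (1 : G) e) =
      ContinuousLinearMap.id ℝ EG := mfderiv_extChartAt_comp_mfderivWithin_extChartAt_symm he
  have h3 : (chartSymmD 𝓘(ℝ, EG) (1 : G) e).inverse = chartD 𝓘(ℝ, EG) (1 : G) g :=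
    ContinuousLinearMap.inverse_eq h1 h2
  have hmul : MDifferentiableAt 𝓘(ℝ, EG) 𝓘(ℝ, EG) (fun h : G => g * h) 1 :=
    ((contMDiff_mul_left (n := ∞) (a := g)) 1).mdifferentiableAt (by simp)
  have hgs' : g * 1 ∈ (chartAt EG (1 : G)).source := by
    rw [mul_one]
    rwa [extChartAt_source] at hgs
  have h4 : (mfderiv 𝓘(ℝ, EG) 𝓘(ℝ, EG) (oneChart EG G ∘ fun h : G => g * h) 1 : EG →L[ℝ] EG) =
      (chartD 𝓘(ℝ, EG) (1 : G) (g * 1)).comp (tangentD 𝓘(ℝ, EG) (fun h : G => g * h) 1) :=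
    mfderiv_comp (I' := 𝓘(ℝ, EG)) (1 : G) (mdifferentiableAt_extChartAt hgs') hmul
  rw [mul_one, mfderiv_apply_eq_fderiv_oneChart
    ((mdifferentiableAt_extChartAt hgs').comp (1 : G) hmul)] at h4
  have h5 : HasFDerivAt (fun e' => chartMul EG G (e, e'))
      ((fderiv ℝ (chartMul EG G) (e, onePoint EG G)).comp (.inr ℝ EG EG)) (onePoint EG G) :=
    hd.hasFDerivAt.comp _ (hasFDerivAt_prodMk_right e _)
  have h6 : fderiv ℝ ((oneChart EG G ∘ fun h : G => g * h) ∘ (oneChart EG G).symm)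
      (onePoint EG G) = _ := h5.fderiv
  rw [h6] at h4
  have h7 := DFunLike.congr_fun h4 (toModel η)
  refine Eq.trans ?_ h7.symm
  change (chartSymmD 𝓘(ℝ, EG) (1 : G) e).inverse (tangentD 𝓘(ℝ, EG) (fun h : G => g * h) 1 η) = _
  rw [h3]
  rfl

theorem lie_eq_chartMul (ξ η : LieAlg EG G) : toModel ⁅ξ, η⁆ =
    fderiv ℝ (fderiv ℝ (chartMul EG G)) (onePoint EG G, onePoint EG G) (toModel ξ, 0) (0, toModel η) -
      fderiv ℝ (fderiv ℝ (chartMul EG G)) (onePoint EG G, onePoint EG G)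
        (0, toModel ξ) (toModel η, 0) := by
  have : IsManifold 𝓘(ℝ, EG) 1 G := IsManifold.of_le (n := ∞) (by simp)
  set e₀ := onePoint EG G with he₀
  set m := chartMul EG G with hm
  let V : LieAlg EG G → EG → EG := fun ζ => VectorField.mpullbackWithin 𝓘(ℝ, EG) 𝓘(ℝ, EG)
    (oneChart EG G).symm (mulInvariantVectorField (I := 𝓘(ℝ, EG)) (G := G) ζ) (range 𝓘(ℝ, EG))
  have hV : ∀ ζ : LieAlg EG G, V ζ =ᶠ[𝓝 e₀] fun e => fderiv ℝ m (e, e₀) (0, toModel ζ) :=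
    fun ζ => eventually_mpullbackWithin_mulInvariantVectorField EG ζ
  have hms : ContDiffAt ℝ ∞ m (e₀, e₀) := contDiffAt_chartMul
  have hDm : DifferentiableAt ℝ (fderiv ℝ m) (e₀, e₀) :=
    ((hms.fderiv_right (m := ∞) (by simp))).differentiableAt (by simp)
  have hVd : ∀ (ζ : LieAlg EG G) (v : EG), fderiv ℝ (V ζ) e₀ v =
      fderiv ℝ (fderiv ℝ m) (e₀, e₀) (v, 0) (0, toModel ζ) := by
    intro ζ v
    rw [(hV ζ).fderiv_eq]
    have h1 : HasFDerivAt (fun e => fderiv ℝ m (e, e₀))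
        ((fderiv ℝ (fderiv ℝ m) (e₀, e₀)).comp (.inl ℝ EG EG)) e₀ :=
      HasFDerivAt.comp (g := fderiv ℝ m) (f := fun e => (e, e₀)) e₀ hDm.hasFDerivAt
        (hasFDerivAt_prodMk_left e₀ e₀)
    have h2 := h1.clm_apply (hasFDerivAt_const (0, toModel ζ) e₀)
    rw [h2.fderiv]
    simp
  have hm00 : ∀ ζ : EG, fderiv ℝ m (e₀, e₀) ((0 : EG), ζ) = ζ := by
    intro ζ
    have h1 : (fun e => m (e₀, e)) =ᶠ[𝓝 e₀] id := by
      filter_upwards [oneChart_target_mem_nhds (EG := EG) (G := G)] with e he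
      rw [hm, chartMul, he₀, oneChart_symm_onePoint, one_mul]
      exact (oneChart EG G).right_inv he
    have h2 : HasFDerivAt (fun e => m (e₀, e)) ((fderiv ℝ m (e₀, e₀)).comp (.inr ℝ EG EG)) e₀ :=
      (hms.differentiableAt (by simp)).hasFDerivAt.comp e₀ (hasFDerivAt_prodMk_right e₀ e₀)
    have h3 := h2.unique ((hasFDerivAt_id e₀).congr_of_eventuallyEq h1)
    simpa using DFunLike.congr_fun h3 ζ
  have hV0 : ∀ ζ : LieAlg EG G, V ζ e₀ = toModel ζ := fun ζ => (hV ζ).self_of_nhds.trans (hm00 (toModel ζ))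
  have hchart : mfderiv 𝓘(ℝ, EG) 𝓘(ℝ, EG) (extChartAt 𝓘(ℝ, EG) (1 : G)) 1 =
      ContinuousLinearMap.id ℝ EG := mfderiv_extChartAt_self
  have hbr : toModel ⁅ξ, η⁆ = VectorField.lieBracket ℝ (V ξ) (V η) e₀ := by
    change (⁅ξ, η⁆ : LieAlg EG G) = _
    rw [GroupLieAlgebra.bracket_def, ← VectorField.mlieBracketWithin_univ,
      VectorField.mlieBracketWithin_apply, preimage_univ, univ_inter]
    have h1 : range 𝓘(ℝ, EG) = univ := ModelWithCorners.range_eq_univ _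
    have h2 : VectorField.lieBracketWithin ℝ (V ξ) (V η) (range 𝓘(ℝ, EG)) e₀ =
        VectorField.lieBracket ℝ (V ξ) (V η) e₀ := by
      rw [h1, VectorField.lieBracketWithin_univ]
    rw [← h2]
    have h3 : (ContinuousLinearMap.inverse (chartD 𝓘(ℝ, EG) (1 : G) 1)) =
        ContinuousLinearMap.id ℝ EG := by
      have : chartD 𝓘(ℝ, EG) (1 : G) 1 = ContinuousLinearMap.id ℝ EG := hchart
      rw [this, ContinuousLinearMap.inverse_id]
    exact DFunLike.congr_fun h3 _
  rw [hbr]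
  have hsymm : IsSymmSndFDerivAt ℝ m (e₀, e₀) :=
    hms.isSymmSndFDerivAt (by simpa using ENat.LEInfty.out)
  change fderiv ℝ (V η) e₀ (V ξ e₀) - fderiv ℝ (V ξ) e₀ (V η e₀) = _
  rw [hV0, hV0, hVd, hVd, hsymm.eq (toModel η, 0)]

/-- The derivative of the adjoint action is the bracket. -/
theorem hasDerivAt_Ad (ξ η : LieAlg EG G) :
    HasDerivAt (fun t => toModel (Ad (chartCurve (toModel ξ) t : G) η)) (toModel ⁅ξ, η⁆) 0 := by
  rw [lie_eq_chartMul]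
  exact hasDerivAt_Ad_chartCurve (G := G) (toModel ξ) (toModel η)

theorem hasDerivAt_dual_Ad (φ : LieDual EG G) (ξ η : LieAlg EG G) :
    HasDerivAt (fun t => φ (Ad (chartCurve (toModel ξ) t : G) η)) (φ ⁅ξ, η⁆) 0 := by
  let φ' : EG →L[ℝ] ℝ := LinearMap.toContinuousLinearMap (E := EG) φ
  exact φ'.hasFDerivAt.comp_hasDerivAt (0 : ℝ) (hasDerivAt_Ad ξ η)

theorem Ad_eq_tangentD (g : G) (η : LieAlg EG G) :
    Ad g η = tangentD 𝓘(ℝ, EG) (fun h : G => g * h * g⁻¹) 1 η := rfl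

theorem Ad_one (η : LieAlg EG G) : Ad (1 : G) η = η := by
  have : (fun h : G => 1 * h * 1⁻¹) = id := by
    funext h
    simp
  rw [Ad_eq_tangentD, this]
  have h : tangentD 𝓘(ℝ, EG) (id : G → G) 1 = ContinuousLinearMap.id ℝ EG := mfderiv_id
  rw [h]
  rfl

theorem Ad_mul (g h : G) (η : LieAlg EG G) : Ad (g * h) η = Ad g (Ad h η) := by
  have h1 : (fun k : G => g * h * k * (g * h)⁻¹) =
      (fun k : G => g * k * g⁻¹) ∘ fun k : G => h * k * h⁻¹ := by
    funext k
    simp [mul_assoc]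
  have h2 : tangentD 𝓘(ℝ, EG) ((fun k : G => g * k * g⁻¹) ∘ fun k : G => h * k * h⁻¹) 1 =
      (tangentD 𝓘(ℝ, EG) (fun k : G => g * k * g⁻¹) (h * 1 * h⁻¹)).comp
        (tangentD 𝓘(ℝ, EG) (fun k : G => h * k * h⁻¹) 1) :=
    mfderiv_comp (I' := 𝓘(ℝ, EG)) (1 : G)
      ((contMDiff_conj g _).mdifferentiableAt (by simp))
      ((contMDiff_conj h _).mdifferentiableAt (by simp))
  rw [mul_one, mul_inv_cancel] at h2
  rw [Ad_eq_tangentD, h1, h2]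
  rfl

theorem Ad_Ad_inv (g : G) (η : LieAlg EG G) : Ad g (Ad g⁻¹ η) = η := by
  rw [← Ad_mul, mul_inv_cancel, Ad_one]

/-- The adjoint action is by Lie algebra automorphisms. -/
theorem Ad_lie (g : G) (ξ η : LieAlg EG G) : Ad g ⁅ξ, η⁆ = ⁅Ad g ξ, Ad g η⁆ := by
  have := lieGroup_minSmoothness (EG := EG) (G := G)
  have : IsManifold 𝓘(ℝ, EG) 1 G := IsManifold.of_le (n := ∞) (by simp)
  set c : G → G := fun h => g * h * g⁻¹ with hc
  have hcs : ContMDiff 𝓘(ℝ, EG) 𝓘(ℝ, EG) ∞ c := contMDiff_conj g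
  set c' : G → G := fun h => g⁻¹ * h * g⁻¹⁻¹ with hc'
  have hcs' : ContMDiff 𝓘(ℝ, EG) 𝓘(ℝ, EG) ∞ c' := contMDiff_conj g⁻¹
  have hcc' : c ∘ c' = id := by funext h; simp [hc, hc', mul_assoc]
  have hc'c : c' ∘ c = id := by funext h; simp [hc, hc', mul_assoc]
  have hinv : ∀ h : G, (tangentD 𝓘(ℝ, EG) c h).inverse = tangentD 𝓘(ℝ, EG) c' (c h) := by
    intro h
    have e1 : tangentD 𝓘(ℝ, EG) (c' ∘ c) h =
        (tangentD 𝓘(ℝ, EG) c' (c h)).comp (tangentD 𝓘(ℝ, EG) c h) :=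
      mfderiv_comp (I' := 𝓘(ℝ, EG)) h ((hcs' _).mdifferentiableAt (by simp))
        ((hcs _).mdifferentiableAt (by simp))
    have e2 : tangentD 𝓘(ℝ, EG) (c ∘ c') (c h) =
        (tangentD 𝓘(ℝ, EG) c (c' (c h))).comp (tangentD 𝓘(ℝ, EG) c' (c h)) :=
      mfderiv_comp (I' := 𝓘(ℝ, EG)) (c h) ((hcs _).mdifferentiableAt (by simp))
        ((hcs' _).mdifferentiableAt (by simp))
    have e3 : ∀ k : G, tangentD 𝓘(ℝ, EG) (id : G → G) k = ContinuousLinearMap.id ℝ EG :=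
      fun k => mfderiv_id
    have e4 : c' (c h) = h := congrFun hc'c h
    rw [hc'c, e3] at e1
    rw [hcc', e3, e4] at e2
    exact ContinuousLinearMap.inverse_eq e2.symm e1.symm
  have hpull : ∀ ζ : LieAlg EG G, VectorField.mpullback 𝓘(ℝ, EG) 𝓘(ℝ, EG) c
      (mulInvariantVectorField (I := 𝓘(ℝ, EG)) (G := G) (Ad g ζ)) = mulInvariantVectorField ζ := by
    intro ζ
    funext h
    have e0 : c' ∘ (fun k : G => c h * k) ∘ c = fun k => h * k := by
      funext k
      simp [hc, hc', mul_assoc]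
    have hL : ∀ a : G, ContMDiff 𝓘(ℝ, EG) 𝓘(ℝ, EG) ∞ (fun k : G => a * k) :=
      fun a => contMDiff_mul_left
    have e1 : tangentD 𝓘(ℝ, EG) (c' ∘ (fun k : G => c h * k) ∘ c) 1 =
        (tangentD 𝓘(ℝ, EG) c' (c h * c 1)).comp (tangentD 𝓘(ℝ, EG) ((fun k : G => c h * k) ∘ c) 1) :=
      mfderiv_comp (I' := 𝓘(ℝ, EG)) (1 : G) ((hcs' _).mdifferentiableAt (by simp))
        (((hL _).comp hcs _).mdifferentiableAt (by simp))
    have e2 : tangentD 𝓘(ℝ, EG) ((fun k : G => c h * k) ∘ c) 1 =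
        (tangentD 𝓘(ℝ, EG) (fun k : G => c h * k) (c 1)).comp (tangentD 𝓘(ℝ, EG) c 1) :=
      mfderiv_comp (I' := 𝓘(ℝ, EG)) (1 : G) ((hL _ _).mdifferentiableAt (by simp))
        ((hcs _).mdifferentiableAt (by simp))
    have e3 : c 1 = 1 := by simp [hc]
    rw [e2, e0, e3, mul_one, ← hinv] at e1
    exact (DFunLike.congr_fun e1 (toModel ζ)).symm
  have key := VectorField.mpullback_mlieBracket (I := 𝓘(ℝ, EG)) (I' := 𝓘(ℝ, EG)) (n := ∞) (f := c)
    (x₀ := (1 : G)) (mdifferentiableAt_mulInvariantVectorField (Ad g ξ))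
    (mdifferentiableAt_mulInvariantVectorField (Ad g η)) (hcs 1) (by simp; exact ENat.LEInfty.out)
  rw [hpull, hpull] at key
  have e3 : c 1 = 1 := by simp [hc]
  have key' : tangentD 𝓘(ℝ, EG) c' (c 1) (VectorField.mlieBracket 𝓘(ℝ, EG)
      (mulInvariantVectorField (I := 𝓘(ℝ, EG)) (G := G) (Ad g ξ))
      (mulInvariantVectorField (I := 𝓘(ℝ, EG)) (G := G) (Ad g η)) (c 1)) = ⁅ξ, η⁆ := by
    rw [← hinv]
    exact key
  rw [e3] at key'
  have key'' : Ad g⁻¹ ⁅Ad g ξ, Ad g η⁆ = ⁅ξ, η⁆ := key'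
  rw [← key'', Ad_Ad_inv]

end AdjointBracket

section LieDerivative

variable {EG : Type*} [NormedAddCommGroup EG] [NormedSpace ℝ EG] [FiniteDimensional ℝ EG]
  {G : Type*} [TopologicalSpace G] [ChartedSpace EG G] [Group G] [LieGroup 𝓘(ℝ, EG) ∞ G]
  {E : Type*} [NormedAddCommGroup E] [NormedSpace ℝ E] [FiniteDimensional ℝ E]
  {H : Type*} [TopologicalSpace H] {I : ModelWithCorners ℝ E H}
  {W : Type*} [TopologicalSpace W] [ChartedSpace H W] [IsManifold I ∞ W]
  [MulAction G W] [ContMDiffSMul 𝓘(ℝ, EG) I ∞ G W]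

include EG in
variable (EG I W) in
theorem contMDiff_smul_left (g : G) : ContMDiff I I ∞ (fun x : W => g • x) :=
  (contMDiff_smul (I := 𝓘(ℝ, EG)) (I' := I) (n := ∞) (G := G) (M := W)).comp
    (contMDiff_const.prodMk contMDiff_id)

include EG in
variable (EG) in
theorem contMDiff_orbit (x : W) : ContMDiff 𝓘(ℝ, EG) I ∞ (fun g : G => g • x) :=
  (contMDiff_smul (I := 𝓘(ℝ, EG)) (I' := I) (n := ∞) (G := G) (M := W)).comp
    (contMDiff_id.prodMk contMDiff_const)

variable (EG I W) in
/-- Pullback of forms by the action of `g`. -/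
def pullAct (g : G) : Form I W →ₗ[ℝ] Form I W :=
  pullback I (fun x : W => g • x) (contMDiff_smul_left EG I W g)

theorem val_pullAct (g : G) (α : Form I W) (x : W) : Form.val I W (pullAct EG I W g α) x =
    extPull (tangentD I (fun z : W => g • z) x) (Form.val I W α (g • x)) := rfl

theorem pullAct_mul (g : G) (α β : Form I W) :
    pullAct EG I W g (α * β) = pullAct EG I W g α * pullAct EG I W g β := pullback_mul _ _ _

theorem pullAct_extD (g : G) (α : Form I W) :
    pullAct EG I W g (extD I W α) = extD I W (pullAct EG I W g α) := pullback_extD _ _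

theorem pullAct_one (α : Form I W) : pullAct EG I W (1 : G) α = α := by
  refine Form.ext fun x => ?_
  have h1 : (fun z : W => (1 : G) • z) = id := by
    funext z
    simp
  have h2 : tangentD I (id : W → W) x = ContinuousLinearMap.id ℝ E := mfderiv_id
  rw [val_pullAct, h1, h2, extPull_id, one_smul]

variable (EG I) in
/-- The derivative of the orbit map `h ↦ h • x` at `g`. -/
def orbitDAt (x : W) (g : G) : EG →L[ℝ] E := mfderiv 𝓘(ℝ, EG) I (fun h : G => h • x) g

theorem tangentD_smul_orbitD (g : G) (x : W) (η : LieAlg EG G) :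
    tangentD I (fun z : W => g • z) x (orbitD G I W x η) = orbitD G I W (g • x) (Ad g η) := by
  have h1 : (fun z : W => g • z) ∘ (fun h : G => h • x) =
      (fun h : G => h • (g • x)) ∘ fun h : G => g * h * g⁻¹ := by
    funext h
    simp [mul_smul]
  have e1 : (mfderiv 𝓘(ℝ, EG) I ((fun z : W => g • z) ∘ (fun h : G => h • x)) 1 : EG →L[ℝ] E) =
      (tangentD I (fun z : W => g • z) ((1 : G) • x)).comp (orbitDAt EG I x (1 : G)) :=
    mfderiv_comp (I' := I) (1 : G) ((contMDiff_smul_left EG I W g _).mdifferentiableAt (by simp))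
      ((contMDiff_orbit EG x _).mdifferentiableAt (by simp))
  have e2 : (mfderiv 𝓘(ℝ, EG) I ((fun h : G => h • (g • x)) ∘ fun h : G => g * h * g⁻¹) 1 :
      EG →L[ℝ] E) = (orbitDAt EG I (g • x) (g * 1 * g⁻¹)).comp (tangentD 𝓘(ℝ, EG) (fun h : G => g * h * g⁻¹) 1) :=
    mfderiv_comp (I' := 𝓘(ℝ, EG)) (1 : G)
      ((contMDiff_orbit EG (g • x) _).mdifferentiableAt (by simp))
      ((contMDiff_conj g _).mdifferentiableAt (by simp))
  rw [one_smul] at e1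
  rw [← h1, e1, mul_one, mul_inv_cancel] at e2
  exact DFunLike.congr_fun e2 (toModel η)

theorem tangentD_smul_fundField (g : G) (x : W) (η : LieAlg EG G) :
    tangentD I (fun z : W => g • z) x (fundField G I η x) = fundField G I (Ad g η) (g • x) := by
  rw [fundField, fundField, map_neg, tangentD_smul_orbitD]

theorem val_iota (ξ : LieAlg EG G) (α : Form I W) (x : W) :
    Form.val I W (iota G I W ξ α) x = extContract (fundField G I ξ x) (Form.val I W α x) := rfl

variable (G I W) in
/-- Contraction as a linear map in the Lie algebra element. -/
def iotaLin : LieAlg EG G →ₗ[ℝ] Form I W →ₗ[ℝ] Form I W where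
  toFun := iota G I W
  map_add' ξ η := by
    refine LinearMap.ext fun α => Form.ext fun x => ?_
    rw [LinearMap.add_apply, map_add, Pi.add_apply, val_iota, val_iota, val_iota, fundField,
      fundField, fundField, map_add, neg_add, map_add, LinearMap.add_apply]
  map_smul' c ξ := by
    refine LinearMap.ext fun α => Form.ext fun x => ?_
    rw [RingHom.id_apply, LinearMap.smul_apply, map_smul, Pi.smul_apply, val_iota, val_iota,
      fundField, fundField, map_smul, ← smul_neg, map_smul, LinearMap.smul_apply]

theorem iotaLin_apply (ξ : LieAlg EG G) : iotaLin G I W ξ = iota G I W ξ := rfl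

theorem iota_mul (ξ : LieAlg EG G) (α β : Form I W) :
    iota G I W ξ (α * β) = iota G I W ξ α * β + parity I W α * iota G I W ξ β :=
  contract_mul _ _ _

theorem parity_iota (ξ : LieAlg EG G) (α : Form I W) :
    parity I W (iota G I W ξ α) = -iota G I W ξ (parity I W α) := parity_contract _ _

theorem iota_iota_comm (ξ η : LieAlg EG G) (α : Form I W) :
    iota G I W ξ (iota G I W η α) = -iota G I W η (iota G I W ξ α) :=
  Form.ext fun x => by
    rw [map_neg, Pi.neg_apply, val_iota, val_iota, val_iota, val_iota, extContract_comm]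

theorem iota_pullAct (g : G) (ξ : LieAlg EG G) (α : Form I W) :
    iota G I W ξ (pullAct EG I W g α) = pullAct EG I W g (iota G I W (Ad g ξ) α) := by
  refine Form.ext fun x => ?_
  rw [val_iota, val_pullAct, val_pullAct, val_iota, extContract_extPull, tangentD_smul_fundField]

/-- The Lie derivative along the vector field generated by `ξ`. -/
def lieD (G : Type*) [TopologicalSpace G] [ChartedSpace EG G] [Group G] [LieGroup 𝓘(ℝ, EG) ∞ G]
    (I : ModelWithCorners ℝ E H)
    (W : Type*) [TopologicalSpace W] [ChartedSpace H W] [IsManifold I ∞ W]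
    [MulAction G W] [ContMDiffSMul 𝓘(ℝ, EG) I ∞ G W] (ξ : LieAlg EG G) :
    Form I W →ₗ[ℝ] Form I W :=
  (extD I W).comp (iota G I W ξ) + (iota G I W ξ).comp (extD I W)

theorem lieD_apply (ξ : LieAlg EG G) (α : Form I W) :
    lieD G I W ξ α = extD I W (iota G I W ξ α) + iota G I W ξ (extD I W α) := rfl

theorem lieD_mul (ξ : LieAlg EG G) (α β : Form I W) :
    lieD G I W ξ (α * β) = lieD G I W ξ α * β + α * lieD G I W ξ β := by
  have hp : parity I W (parity I W α) = α :=
    Form.ext fun x => by rw [val_parity, val_parity, CliffordAlgebra.involute_involute]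
  simp only [lieD_apply, extD_mul, iota_mul, map_add, parity_extD, parity_iota, hp]
  noncomm_ring

theorem lieD_extD (ξ : LieAlg EG G) (α : Form I W) :
    lieD G I W ξ (extD I W α) = extD I W (lieD G I W ξ α) := by
  simp only [lieD_apply, extD_extD, map_add, map_zero, add_zero, zero_add]

theorem val_lieD_congr (ξ : LieAlg EG G) {α β : Form I W} {x : W}
    (h : Form.val I W α =ᶠ[𝓝 x] Form.val I W β) :
    Form.val I W (lieD G I W ξ α) x = Form.val I W (lieD G I W ξ β) x := by
  rw [lieD_apply, lieD_apply, map_add, map_add, Pi.add_apply, Pi.add_apply, val_iota, val_iota,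
    val_extD_congr h]
  congr 1
  refine val_extD_congr ?_
  filter_upwards [h] with y hy
  rw [val_iota, val_iota, hy]

/-- The derivative of the function `h` along the vector field generated by `ξ`. -/
def fundDeriv (I : ModelWithCorners ℝ E H) (ξ : LieAlg EG G) (h : W → ℝ) (x : W) : ℝ :=
  covectorD I h x (fundField G I ξ x)

theorem contMDiff_of_val_eq_algebraMap {h : W → ℝ} {α : Form I W}
    (hα : ∀ x, Form.val I W α x = algebraMap ℝ (Ext E) (h x)) : ContMDiff I 𝓘(ℝ, ℝ) ∞ h := by
  let l : Ext E →L[ℝ] ℝ := LinearMap.toContinuousLinearMap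
    (ExteriorAlgebra.algebraMapInv : Ext E →ₐ[ℝ] ℝ).toLinearMap
  have hl : ∀ r, l (algebraMap ℝ (Ext E) r) = r :=
    ExteriorAlgebra.algebraMap_leftInverse (Module.Dual ℝ E)
  intro x
  refine ((contMDiffOn_chartRep α.smooth x l).contMDiffAt
    ((chartAt H x).open_source.mem_nhds (mem_chart_source H x))).congr_of_eventuallyEq ?_
  filter_upwards [(chartAt H x).open_source.mem_nhds (mem_chart_source H x)] with y hy
  have hy' : y ∈ (extChartAt I x).source := by rwa [extChartAt_source]
  rw [chartRep, (extChartAt I x).left_inv hy', hα, AlgHom.commutes, hl]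

theorem val_iota_extD_funForm (ξ : LieAlg EG G) (h : W → ℝ) (hh : ContMDiff I 𝓘(ℝ, ℝ) ∞ h)
    (x : W) : Form.val I W (iota G I W ξ (extD I W (funForm h hh))) x =
      algebraMap ℝ (Ext E) (fundDeriv I ξ h x) := by
  rw [val_iota, val_extD_funForm, extContract_ι]
  rfl

theorem contMDiff_fundDeriv (ξ : LieAlg EG G) {h : W → ℝ} (hh : ContMDiff I 𝓘(ℝ, ℝ) ∞ h) :
    ContMDiff I 𝓘(ℝ, ℝ) ∞ (fundDeriv I ξ h) :=
  contMDiff_of_val_eq_algebraMap (val_iota_extD_funForm ξ h hh)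

theorem iota_extD_funForm (ξ : LieAlg EG G) (h : W → ℝ) (hh : ContMDiff I 𝓘(ℝ, ℝ) ∞ h) :
    iota G I W ξ (extD I W (funForm h hh)) = funForm (fundDeriv I ξ h) (contMDiff_fundDeriv ξ hh) :=
  Form.ext (val_iota_extD_funForm ξ h hh)

theorem lieD_funForm (ξ : LieAlg EG G) (h : W → ℝ) (hh : ContMDiff I 𝓘(ℝ, ℝ) ∞ h) :
    lieD G I W ξ (funForm h hh) = funForm (fundDeriv I ξ h) (contMDiff_fundDeriv ξ hh) := by
  rw [lieD_apply, iota_extD_funForm]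
  have : iota G I W ξ (funForm h hh) = 0 := contract_funForm _ _ _
  rw [this, map_zero, zero_add]

theorem hasDerivAt_smul_chartCurve (ξ : LieAlg EG G) {h : W → ℝ} (hh : ContMDiff I 𝓘(ℝ, ℝ) ∞ h)
    (x : W) : HasDerivAt (fun t => h ((chartCurve (toModel ξ) t : G) • x))
      (-fundDeriv I ξ h x) 0 := by
  have h1 := hasMFDerivAt_chartCurve (G := G) (toModel ξ)
  have h2 : HasMFDerivAt 𝓘(ℝ, EG) I (fun g : G => g • x) (chartCurve (toModel ξ) 0 : G)
      (mfderiv 𝓘(ℝ, EG) I (fun g : G => g • x) (chartCurve (toModel ξ) 0 : G)) :=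
    ((contMDiff_orbit EG x _).mdifferentiableAt (by simp)).hasMFDerivAt
  have h3 : HasMFDerivAt I 𝓘(ℝ, ℝ) h ((chartCurve (toModel ξ) 0 : G) • x)
      (mfderiv I 𝓘(ℝ, ℝ) h ((chartCurve (toModel ξ) 0 : G) • x)) :=
    ((hh _).mdifferentiableAt (by simp)).hasMFDerivAt
  have h4 : HasFDerivAt (fun t => h ((chartCurve (toModel ξ) t : G) • x))
      ((covectorD I h ((chartCurve (toModel ξ) 0 : G) • x)).comp
        ((orbitDAt EG I x (chartCurve (toModel ξ) 0 : G)).comp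
          (ContinuousLinearMap.toSpanSingleton ℝ (toModel ξ)))) 0 :=
    (h3.comp (0 : ℝ) (h2.comp (0 : ℝ) h1)).hasFDerivAt
  refine h4.hasDerivAt.congr_deriv ?_
  change covectorD I h ((chartCurve (toModel ξ) 0 : G) • x)
    (orbitDAt EG I x (chartCurve (toModel ξ) 0 : G) ((1 : ℝ) • toModel ξ)) = _
  rw [chartCurve_zero, one_smul, one_smul, fundDeriv, fundField, map_neg, neg_neg]
  rfl

theorem hasDerivAt_covectorD_smul (ξ : LieAlg EG G) {h : W → ℝ} (hh : ContMDiff I 𝓘(ℝ, ℝ) ∞ h)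
    (x : W) : HasDerivAt (fun t => covectorD I (fun z : W => h ((chartCurve (toModel ξ) t : G) • z)) x)
      (-covectorD I (fundDeriv I ξ h) x) 0 := by
  set z₀ := extChartAt I x x with hz₀
  let u : ℝ × E → ℝ := fun p => h ((chartCurve (toModel ξ) p.1 : G) • (extChartAt I x).symm p.2)
  let S : Set (ℝ × E) := univ ×ˢ range I
  have hz₀r : z₀ ∈ range I := extChartAt_self_mem_range x
  have hS : UniqueDiffOn ℝ S := uniqueDiffOn_univ.prod I.uniqueDiffOn
  have hmem : ∀ t, (t, z₀) ∈ S := fun t => ⟨mem_univ _, hz₀r⟩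
  have hcl : ((0 : ℝ), z₀) ∈ closure (interior S) := by
    rw [interior_prod_eq, closure_prod_eq]
    exact ⟨by simp, I.range_subset_closure_interior hz₀r⟩
  have hu : ContDiffWithinAt ℝ ∞ u S (0, z₀) := by
    rw [← contMDiffWithinAt_iff_contDiffWithinAt]
    have h1 : ContMDiffWithinAt 𝓘(ℝ, ℝ × E) 𝓘(ℝ, EG) ∞
        (fun p : ℝ × E => (chartCurve (toModel ξ) p.1 : G)) S (0, z₀) :=
      (ContMDiffAt.comp (g := (chartCurve (toModel ξ) : ℝ → G)) (0, z₀)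
        (contMDiffAt_chartCurve_zero _) contDiff_fst.contMDiff.contMDiffAt).contMDiffWithinAt
    have h2 : ContMDiffWithinAt 𝓘(ℝ, ℝ × E) I ∞
        (fun p : ℝ × E => (extChartAt I x).symm p.2) S (0, z₀) :=
      ContMDiffWithinAt.comp (g := (extChartAt I x).symm) (t := range I) (0, z₀)
        (contMDiffWithinAt_extChartAt_symm_range x (mem_extChartAt_target x))
        contDiff_snd.contMDiff.contMDiffAt.contMDiffWithinAt fun p hp => hp.2
    have h3 := (contMDiff_smul (I := 𝓘(ℝ, EG)) (I' := I) (n := ∞) (G := G)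
      (M := W)).contMDiffAt.comp_contMDiffWithinAt (0, z₀) (h1.prodMk h2)
    exact hh.contMDiffAt.comp_contMDiffWithinAt (0, z₀) h3
  have hud : ∀ᶠ p in 𝓝[S] (0, z₀), DifferentiableWithinAt ℝ u S p := by
    have := (hu.of_le (m := 1) (by simp)).eventually (by simp)
    rw [insert_eq_of_mem (hmem 0)] at this
    exact this.mono fun p hp => hp.differentiableWithinAt (by simp)
  have hDu : DifferentiableWithinAt ℝ (fderivWithin ℝ u S) S (0, z₀) :=
    (hu.fderivWithin_right hS (m := ∞) (by simp) (hmem 0)).differentiableWithinAt (by simp)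
  have hsymm : IsSymmSndFDerivWithinAt ℝ u S (0, z₀) :=
    hu.isSymmSndFDerivWithinAt (by simpa using ENat.LEInfty.out) hS hcl (hmem 0)
  have hud1 : ∀ᶠ t in 𝓝 (0 : ℝ), DifferentiableWithinAt ℝ u S (t, z₀) := by
    have ht : Tendsto (fun t : ℝ => (t, z₀)) (𝓝 0) (𝓝[S] (0, z₀)) :=
      tendsto_nhdsWithin_iff.mpr ⟨(Continuous.prodMk_left z₀).tendsto 0,
        Eventually.of_forall hmem⟩
    exact ht.eventually hud
  have hud2 : ∀ᶠ z in 𝓝[range I] z₀, DifferentiableWithinAt ℝ u S (0, z) := by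
    have ht : Tendsto (fun z : E => ((0 : ℝ), z)) (𝓝[range I] z₀) (𝓝[S] (0, z₀)) :=
      tendsto_nhdsWithin_iff.mpr ⟨((Continuous.prodMk_right (0 : ℝ)).tendsto z₀).mono_left
        nhdsWithin_le_nhds, eventually_nhdsWithin_of_forall fun z hz => ⟨mem_univ _, hz⟩⟩
    exact ht.eventually hud
  -- the derivative in the space direction
  have hspace : ∀ᶠ t in 𝓝 (0 : ℝ),
      covectorD I (fun z : W => h ((chartCurve (toModel ξ) t : G) • z)) x =
        (fderivWithin ℝ u S (t, z₀)).comp (.inr ℝ ℝ E) := by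
    filter_upwards [hud1] with t ht
    rw [covectorD_eq_fderivWithin (h := fun z : W => h ((chartCurve (toModel ξ) t : G) • z))
      ((hh.comp (contMDiff_smul_left EG I W _) x).mdifferentiableAt (by simp))]
    have h1 : HasFDerivWithinAt (fun z => u (t, z))
        ((fderivWithin ℝ u S (t, z₀)).comp (.inr ℝ ℝ E)) (range I) z₀ :=
      HasFDerivWithinAt.comp (g := u) (f := fun z => (t, z)) (t := S) z₀ ht.hasFDerivWithinAt
        (hasFDerivAt_prodMk_right t z₀).hasFDerivWithinAt fun z hz => ⟨mem_univ _, hz⟩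
    exact h1.fderivWithin (I.uniqueDiffOn _ hz₀r)
  -- the derivative in the time direction
  have htime : fundDeriv I ξ h ∘ (extChartAt I x).symm =ᶠ[𝓝[range I] z₀]
      fun z => -fderivWithin ℝ u S (0, z) (1, 0) := by
    filter_upwards [hud2, self_mem_nhdsWithin] with z hz hzr
    have h1 : HasDerivAt (fun t : ℝ => (t, z)) ((1 : ℝ), (0 : E)) 0 :=
      (hasDerivAt_id (0 : ℝ)).prodMk (hasDerivAt_const (0 : ℝ) z)
    have h2 : HasDerivAt (fun t => u (t, z)) (fderivWithin ℝ u S (0, z) (1, 0)) 0 := by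
      rw [← hasDerivWithinAt_univ] at h1 ⊢
      exact HasFDerivWithinAt.comp_hasDerivWithinAt (l := u) (f := fun t : ℝ => (t, z)) (0 : ℝ)
        hz.hasFDerivWithinAt h1 fun t _ => ⟨mem_univ _, hzr⟩
    have h3 := h2.unique (hasDerivAt_smul_chartCurve ξ hh ((extChartAt I x).symm z))
    rw [h3, neg_neg]
    rfl
  have hmix : covectorD I (fundDeriv I ξ h) x =
      -(fderivWithin ℝ (fderivWithin ℝ u S) S (0, z₀) (1, 0)).comp (.inr ℝ ℝ E) := by
    rw [covectorD_eq_fderivWithin (((contMDiff_fundDeriv ξ hh) x).mdifferentiableAt (by simp)),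
      htime.fderivWithin_eq_of_mem hz₀r]
    have h1 : HasFDerivWithinAt (fun z => fderivWithin ℝ u S (0, z))
        ((fderivWithin ℝ (fderivWithin ℝ u S) S (0, z₀)).comp (.inr ℝ ℝ E)) (range I) z₀ :=
      HasFDerivWithinAt.comp (g := fderivWithin ℝ u S) (f := fun z => ((0 : ℝ), z)) (t := S) z₀
        hDu.hasFDerivWithinAt (hasFDerivAt_prodMk_right (0 : ℝ) z₀).hasFDerivWithinAt
        fun z hz => ⟨mem_univ _, hz⟩
    have h2 := (h1.clm_apply (hasFDerivWithinAt_const ((1 : ℝ), (0 : E)) z₀ (range I))).neg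
    refine (HasFDerivWithinAt.fderivWithin h2 (I.uniqueDiffOn _ hz₀r)).trans ?_
    ext v
    simp only [ContinuousLinearMap.comp_zero, zero_add, neg_apply,
      ContinuousLinearMap.flip_apply, ContinuousLinearMap.comp_apply,
      ContinuousLinearMap.inr_apply]
    rw [hsymm.eq]
  rw [hmix, neg_neg]
  have h1 : HasDerivAt (fun t : ℝ => (t, z₀)) ((1 : ℝ), (0 : E)) 0 :=
    (hasDerivAt_id (0 : ℝ)).prodMk (hasDerivAt_const (0 : ℝ) z₀)
  have h2 : HasDerivAt (fun t => fderivWithin ℝ u S (t, z₀))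
      (fderivWithin ℝ (fderivWithin ℝ u S) S (0, z₀) (1, 0)) 0 := by
    rw [← hasDerivWithinAt_univ] at h1 ⊢
    exact HasFDerivWithinAt.comp_hasDerivWithinAt (l := fderivWithin ℝ u S)
      (f := fun t : ℝ => (t, z₀)) (0 : ℝ) hDu.hasFDerivWithinAt h1 fun t _ => hmem t
  have h3 : HasDerivAt (fun t => (fderivWithin ℝ u S (t, z₀)).comp (.inr ℝ ℝ E))
      ((fderivWithin ℝ (fderivWithin ℝ u S) S (0, z₀) (1, 0)).comp (.inr ℝ ℝ E)) 0 := by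
    simpa using h2.clm_comp (hasDerivAt_const (0 : ℝ) (ContinuousLinearMap.inr ℝ ℝ E))
  exact h3.congr_of_eventuallyEq hspace

theorem hasDerivAt_ext_mul {a b : ℝ → Ext E} {a' b' : Ext E} {t : ℝ} (ha : HasDerivAt a a' t)
    (hb : HasDerivAt b b' t) : HasDerivAt (fun s => a s * b s) (a' * b t + a t * b') t :=
  ((extMulL (E := E)).hasFDerivAt.comp_hasDerivAt t ha).clm_apply hb

variable [T2Space W]

/-- The derivative of the pullback of a form along a curve in `G`. -/
theorem hasDerivAt_val_pullAct (ξ : LieAlg EG G) (x : W) (α : Form I W) :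
    HasDerivAt (fun t => Form.val I W (pullAct EG I W (chartCurve (toModel ξ) t : G) α) x)
      (-Form.val I W (lieD G I W ξ α) x) 0 := by
  refine Form.local_induction x (P := fun α =>
    HasDerivAt (fun t => Form.val I W (pullAct EG I W (chartCurve (toModel ξ) t : G) α) x)
      (-Form.val I W (lieD G I W ξ α) x) 0) ?_ ?_ ?_ ?_ ?_ α
  · intro h hh
    rw [lieD_funForm, val_funForm, ← map_neg (algebraMap ℝ (Ext E))]
    have := ((Algebra.linearMap ℝ (Ext E)).toContinuousLinearMap.hasFDerivAt).comp_hasDerivAt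
      (0 : ℝ) (hasDerivAt_smul_chartCurve (G := G) ξ hh x)
    refine this.congr_of_eventuallyEq (Eventually.of_forall fun t => ?_)
    change Form.val I W (pullback I _ _ (funForm h hh)) x = _
    rw [pullback_funForm, val_funForm]
    rfl
  · intro h hh
    rw [lieD_extD, lieD_funForm, val_extD_funForm]
    let l : (E →L[ℝ] ℝ) →L[ℝ] Ext E := LinearMap.toContinuousLinearMap
      ((ExteriorAlgebra.ι ℝ).comp (ContinuousLinearMap.coeLM ℝ : (E →L[ℝ] ℝ) →ₗ[ℝ] (E →ₗ[ℝ] ℝ)))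
    have := l.hasFDerivAt.comp_hasDerivAt (0 : ℝ) (hasDerivAt_covectorD_smul (G := G) ξ hh x)
    rw [map_neg] at this
    refine this.congr_of_eventuallyEq (Eventually.of_forall fun t => ?_)
    change Form.val I W (pullback I _ _ (extD I W (funForm h hh))) x = _
    rw [pullback_extD, pullback_funForm, val_extD_funForm]
    rfl
  · intro α β hα hβ
    refine ((hα.add hβ).congr_deriv ?_).congr_of_eventuallyEq (Eventually.of_forall fun t => ?_)
    · rw [map_add, map_add, Pi.add_apply, neg_add]
    · simp only [map_add, Pi.add_apply]
  · intro α β hα hβ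
    have h := hasDerivAt_ext_mul hα hβ
    rw [chartCurve_zero, pullAct_one, pullAct_one] at h
    refine (h.congr_deriv ?_).congr_of_eventuallyEq (Eventually.of_forall fun t => ?_)
    · rw [lieD_mul, map_add, map_mul, map_mul, Pi.add_apply, Pi.mul_apply, Pi.mul_apply]
      noncomm_ring
    · simp only [pullAct_mul, map_mul, Pi.mul_apply]
  · intro α β h hα
    rw [← val_lieD_congr ξ h]
    refine hα.congr_of_eventuallyEq ?_
    have hc : Tendsto (fun t => (chartCurve (toModel ξ) t : G) • x) (𝓝 0) (𝓝 x) := by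
      have h1 : ContinuousAt (fun t => (chartCurve (toModel ξ) t : G) • x) 0 :=
        ContinuousAt.comp (g := fun g : G => g • x)
          (contMDiff_orbit EG (I := I) x).continuous.continuousAt
          (contMDiffAt_chartCurve_zero (G := G) (toModel ξ)).continuousAt
      simpa [ContinuousAt, chartCurve_zero] using h1
    filter_upwards [hc.eventually h] with t ht
    rw [val_pullAct, val_pullAct, ht]

end LieDerivative

attribute [local instance] lieGroup_minSmoothness

section DegenerateConnection

variable {EG : Type*} [NormedAddCommGroup EG] [NormedSpace ℝ EG] [FiniteDimensional ℝ EG]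
  {G : Type*} [TopologicalSpace G] [ChartedSpace EG G] [Group G] [LieGroup 𝓘(ℝ, EG) ∞ G]
  {E : Type*} [NormedAddCommGroup E] [NormedSpace ℝ E] [FiniteDimensional ℝ E]
  {H : Type*} [TopologicalSpace H] {I : ModelWithCorners ℝ E H}
  {W : Type*} [TopologicalSpace W] [ChartedSpace H W] [IsManifold I ∞ W]
  [MulAction G W] [ContMDiffSMul 𝓘(ℝ, EG) I ∞ G W]
  {k : ℕ} (ξ : Module.Basis (Fin k) ℝ (LieAlg EG G))

/-- The functional `η ↦ φ ⁅ζ, η⁆`, i.e. minus the coadjoint action of `ζ` on `φ`. -/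
def lieDual (ζ : LieAlg EG G) (φ : LieDual EG G) : LieDual EG G where
  toFun η := φ ⁅ζ, η⁆
  map_add' η η' := by rw [lie_add, map_add]
  map_smul' c η := by rw [lie_smul, map_smul, RingHom.id_apply]

theorem lieDual_apply (ζ η : LieAlg EG G) (φ : LieDual EG G) : lieDual ζ φ η = φ ⁅ζ, η⁆ := rfl

theorem dual_eq_sum (φ : LieDual EG G) : φ = ∑ a, φ (ξ a) • ξ.coord a := by
  refine ξ.ext fun b => ?_
  simp

include ξ in
/-- The Lie derivative of a contraction. -/
theorem lieD_iota [T2Space W] (ζ η : LieAlg EG G) (α : Form I W) :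
    lieD G I W ζ (iota G I W η α) =
      iota G I W η (lieD G I W ζ α) + iota G I W ⁅ζ, η⁆ α := by
  refine Form.ext fun x => ?_
  let γ : ℝ → G := chartCurve (toModel ζ)
  have hsum : ∀ θ : LieAlg EG G, iota G I W θ = ∑ a, ξ.coord a θ • iota G I W (ξ a) := by
    intro θ
    conv_lhs => rw [← iotaLin_apply, ← ξ.sum_repr θ, map_sum]
    refine Finset.sum_congr rfl fun a _ => ?_
    rw [map_smul, iotaLin_apply, Module.Basis.coord_apply]
  have h1 : HasDerivAt (fun t => extContract (fundField G I η x)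
      (Form.val I W (pullAct EG I W (γ t) α) x))
      (extContract (fundField G I η x) (-Form.val I W (lieD G I W ζ α) x)) 0 :=
    (LinearMap.toContinuousLinearMap
      (extContract (fundField G I η x))).hasFDerivAt.comp_hasDerivAt (0 : ℝ)
        (hasDerivAt_val_pullAct ζ x α)
  have h2 : HasDerivAt (fun t => ∑ a, ξ.coord a (Ad (γ t) η) •
      Form.val I W (pullAct EG I W (γ t) (iota G I W (ξ a) α)) x)
      (∑ a, (ξ.coord a (Ad (γ 0) η) • (-Form.val I W (lieD G I W ζ (iota G I W (ξ a) α)) x) +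
        ξ.coord a ⁅ζ, η⁆ • Form.val I W (pullAct EG I W (γ 0) (iota G I W (ξ a) α)) x)) 0 :=
    HasDerivAt.fun_sum fun a _ =>
      (hasDerivAt_dual_Ad (ξ.coord a) ζ η).smul (hasDerivAt_val_pullAct ζ x (iota G I W (ξ a) α))
  have h3 : (fun t => extContract (fundField G I η x)
      (Form.val I W (pullAct EG I W (γ t) α) x)) = fun t => ∑ a, ξ.coord a (Ad (γ t) η) •
      Form.val I W (pullAct EG I W (γ t) (iota G I W (ξ a) α)) x := by
    funext t
    rw [← val_iota, iota_pullAct, hsum (Ad (γ t) η)]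
    simp only [LinearMap.sum_apply, LinearMap.smul_apply, map_sum, map_smul, Finset.sum_apply,
      Pi.smul_apply]
  rw [h3] at h1
  have h4 := h1.unique h2
  have hγ : γ 0 = 1 := chartCurve_zero _
  rw [hγ] at h4
  simp only [Ad_one, pullAct_one, Finset.sum_add_distrib, smul_neg, Finset.sum_neg_distrib] at h4
  have h5 : ∑ a, ξ.coord a η • Form.val I W (lieD G I W ζ (iota G I W (ξ a) α)) x =
      Form.val I W (lieD G I W ζ (iota G I W η α)) x := by
    rw [hsum η]
    simp only [LinearMap.sum_apply, LinearMap.smul_apply, map_sum, map_smul, Finset.sum_apply,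
      Pi.smul_apply]
  have h6 : ∑ a, ξ.coord a ⁅ζ, η⁆ • Form.val I W (iota G I W (ξ a) α) x =
      Form.val I W (iota G I W ⁅ζ, η⁆ α) x := by
    rw [hsum ⁅ζ, η⁆]
    simp only [LinearMap.sum_apply, LinearMap.smul_apply, map_sum, map_smul, Finset.sum_apply,
      Pi.smul_apply]
  rw [h5, h6, map_neg, ← val_iota] at h4
  rw [map_add, Pi.add_apply]
  rw [neg_eq_iff_eq_neg] at h4
  rw [h4]
  abel

variable (f : Cutoff G I W) (conn : Connection (EG := EG) G I W)

/-- The value of the degenerate connection at a point. -/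
def degForm (x : W) : E →ₗ[ℝ] LieAlg EG G := f.toFun x • conn.form x

theorem val_degConn (φ : LieDual EG G) (x : W) :
    Form.val I W (degConn f conn φ) x = ExteriorAlgebra.ι ℝ (φ ∘ₗ degForm f conn x) := rfl

theorem cutoff_eq_zero {x : W} (hx : x ∈ singularSet G W) : f.toFun x = 0 := by
  obtain ⟨U, V, -, -, hsU, -, h0, -⟩ := f.exists_nhds
  exact h0 x (hsU hx)

theorem degForm_fundField (η : LieAlg EG G) (x : W) :
    degForm f conn x (fundField G I η x) = f.toFun x • η := by
  by_cases hx : x ∈ singularSet G W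
  · rw [degForm, cutoff_eq_zero f hx, zero_smul, zero_smul, LinearMap.zero_apply]
  · rw [degForm, LinearMap.smul_apply, conn.vertical x hx]

theorem degForm_smul (g : G) (x : W) (v : E) :
    degForm f conn (g • x) (tangentD I (fun z : W => g • z) x v) = Ad g (degForm f conn x v) := by
  by_cases hx : x ∈ singularSet G W
  · rw [degForm, degForm, f.invariant, cutoff_eq_zero f hx, zero_smul, zero_smul,
      LinearMap.zero_apply, LinearMap.zero_apply, map_zero]
  · rw [degForm, degForm, LinearMap.smul_apply, LinearMap.smul_apply, f.invariant,
      conn.equivariant x hx, map_smul]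

theorem cutoffForm_eq_funForm : cutoffForm f = funForm f.toFun f.smooth := rfl

theorem cutoffForm_comm (α : Form I W) : cutoffForm f * α = α * cutoffForm f :=
  funForm_comm _ f.smooth _

theorem iota_cutoffForm (η : LieAlg EG G) : iota G I W η (cutoffForm f) = 0 :=
  contract_funForm _ _ f.smooth

theorem pullAct_cutoffForm (g : G) : pullAct EG I W g (cutoffForm f) = cutoffForm f := by
  rw [cutoffForm_eq_funForm, pullAct, pullback_funForm]
  refine Form.ext fun x => ?_
  rw [val_funForm, val_funForm, Function.comp_apply, f.invariant]

theorem iota_degConn (η : LieAlg EG G) (φ : LieDual EG G) :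
    iota G I W η (degConn f conn φ) = φ η • cutoffForm f := by
  refine Form.ext fun x => ?_
  rw [val_iota, val_degConn, extContract_ι, LinearMap.comp_apply, degForm_fundField, map_smul φ,
    map_smul (Form.val I W), Pi.smul_apply, cutoffForm_eq_funForm, val_funForm, smul_eq_mul, mul_comm, map_mul,
    ← Algebra.smul_def]

theorem pullAct_degConn (g : G) (φ : LieDual EG G) :
    pullAct EG I W g (degConn f conn φ) = degConn f conn (φ ∘ₗ Ad g) := by
  refine Form.ext fun x => ?_
  rw [val_pullAct, val_degConn, val_degConn, extPull_ι]
  congr 1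
  ext v
  exact congrArg φ (degForm_smul f conn g x v)

theorem parity_degConn (φ : LieDual EG G) :
    parity I W (degConn f conn φ) = -degConn f conn φ := by
  refine Form.ext fun x => ?_
  rw [val_parity, map_neg, Pi.neg_apply, val_degConn]
  exact CliffordAlgebra.involute_ι _

/-- A connection component commutes with forms up to sign. -/
theorem degConn_mul_comm (φ : LieDual EG G) (α : Form I W) :
    degConn f conn φ * α = parity I W α * degConn f conn φ := by
  refine Form.ext fun x => ?_
  rw [map_mul, map_mul, Pi.mul_apply, Pi.mul_apply, val_degConn, val_parity]
  exact ι_mul_eq_involute_mul _ _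

include ξ in
theorem lieD_degConn [T2Space W] (ζ : LieAlg EG G) (φ : LieDual EG G) :
    lieD G I W ζ (degConn f conn φ) = -degConn f conn (lieDual ζ φ) := by
  refine Form.ext fun x => ?_
  let γ : ℝ → G := chartCurve (toModel ζ)
  have h1 := hasDerivAt_val_pullAct ζ x (degConn f conn φ)
  have h2 : HasDerivAt (fun t => ∑ a, φ (Ad (γ t) (ξ a)) •
      Form.val I W (degConn f conn (ξ.coord a)) x)
      (∑ a, φ ⁅ζ, ξ a⁆ • Form.val I W (degConn f conn (ξ.coord a)) x) 0 :=
    HasDerivAt.fun_sum fun a _ => (hasDerivAt_dual_Ad φ ζ (ξ a)).smul_const _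
  have hsum : ∀ ψ : LieDual EG G, Form.val I W (degConn f conn ψ) x =
      ∑ a, ψ (ξ a) • Form.val I W (degConn f conn (ξ.coord a)) x := by
    intro ψ
    conv_lhs => rw [dual_eq_sum ξ ψ]
    simp only [map_sum, map_smul, Finset.sum_apply, Pi.smul_apply]
  have h3 : (fun t => Form.val I W (pullAct EG I W (chartCurve (toModel ζ) t : G)
      (degConn f conn φ)) x) = fun t => ∑ a, φ (Ad (γ t) (ξ a)) •
      Form.val I W (degConn f conn (ξ.coord a)) x := by
    funext t
    rw [pullAct_degConn, hsum]
    rfl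
  rw [h3] at h1
  have h4 := h1.unique h2
  rw [map_neg, Pi.neg_apply, hsum, ← neg_eq_iff_eq_neg, h4]
  rfl

/-- The degenerate curvature `dω_f + ½ [ω_f, ω_f]`, through its components. -/
def curvForm : LieDual EG G →ₗ[ℝ] Form I W where
  toFun φ := extD I W (degConn f conn φ) +
      (2⁻¹ : ℝ) • ∑ b, ∑ c, φ ⁅ξ b, ξ c⁆ •
        (degConn f conn (ξ.coord b) * degConn f conn (ξ.coord c))
  map_add' φ ψ := by
    simp only [map_add, LinearMap.add_apply, add_smul, Finset.sum_add_distrib, smul_add]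
    abel
  map_smul' c φ := by
    simp only [map_smul, LinearMap.smul_apply, smul_eq_mul, mul_smul, ← Finset.smul_sum,
      RingHom.id_apply]
    rw [smul_comm (2⁻¹ : ℝ) c, ← smul_add]

theorem curvForm_apply (φ : LieDual EG G) : curvForm ξ f conn φ = extD I W (degConn f conn φ) +
      (2⁻¹ : ℝ) • ∑ b, ∑ c, φ ⁅ξ b, ξ c⁆ •
        (degConn f conn (ξ.coord b) * degConn f conn (ξ.coord c)) := rfl

theorem degCurvature_apply (φ : LieDual EG G) : degCurvature ξ f conn φ =
    (1 : Sym EG G) ⊗ₜ[ℝ] curvForm ξ f conn φ - symι G φ ⊗ₜ[ℝ] (-1 + cutoffForm f) := rfl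

theorem curvForm_comm (φ : LieDual EG G) (γ : Form I W) :
    curvForm ξ f conn φ * γ = γ * curvForm ξ f conn φ := by
  rw [curvForm_apply, add_mul, mul_add, extD_degConn_comm, smul_mul_assoc, mul_smul_comm,
    Finset.sum_mul, Finset.mul_sum]
  congr 2
  refine Finset.sum_congr rfl fun b _ => ?_
  rw [Finset.sum_mul, Finset.mul_sum]
  refine Finset.sum_congr rfl fun c _ => ?_
  rw [smul_mul_assoc, mul_smul_comm]
  congr 1
  refine Form.ext fun x => ?_
  exact commute_ι_mul_ι _ _ _

end DegenerateConnection

section HorizontalProjection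

variable {EG : Type*} [NormedAddCommGroup EG] [NormedSpace ℝ EG] [FiniteDimensional ℝ EG]
  {G : Type*} [TopologicalSpace G] [ChartedSpace EG G] [Group G] [LieGroup 𝓘(ℝ, EG) ∞ G]
  {E : Type*} [NormedAddCommGroup E] [NormedSpace ℝ E] [FiniteDimensional ℝ E]
  {H : Type*} [TopologicalSpace H] {I : ModelWithCorners ℝ E H}
  {W : Type*} [TopologicalSpace W] [ChartedSpace H W] [IsManifold I ∞ W]
  [MulAction G W] [ContMDiffSMul 𝓘(ℝ, EG) I ∞ G W]
  {k : ℕ} (ξ : Module.Basis (Fin k) ℝ (LieAlg EG G))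
  (f : Cutoff G I W) (conn : Connection (EG := EG) G I W)

/-- The map `v ↦ v - ∑ ω_f^a(v) X_a` at a point, the sum being over a list of indices. -/
def horLinList : List (Fin k) → W → E →L[ℝ] E
  | [], _ => ContinuousLinearMap.id ℝ E
  | a :: l, x => horLinList l x - (LinearMap.toContinuousLinearMap
      (ξ.coord a ∘ₗ degForm f conn x)).smulRight (fundField G I (ξ a) x)

/-- The operator on forms which is pointwise the pullback by `horLinList`. -/
def horList : List (Fin k) → Form I W →ₗ[ℝ] Form I W
  | [] => LinearMap.id
  | a :: l => horList l - (LinearMap.mulLeft ℝ (degConn f conn (ξ.coord a))).comp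
      ((horList l).comp (iota G I W (ξ a)))

theorem val_horList (l : List (Fin k)) (α : Form I W) (x : W) :
    Form.val I W (horList ξ f conn l α) x =
      extPull (horLinList ξ f conn l x) (Form.val I W α x) := by
  induction l generalizing α with
  | nil => exact (extPull_id _).symm
  | cons a l ih =>
    rw [horLinList, extPull_sub_smulRight, horList, LinearMap.sub_apply, LinearMap.comp_apply,
      LinearMap.comp_apply, LinearMap.mulLeft_apply, map_sub, Pi.sub_apply, map_mul, Pi.mul_apply,
      ih, ih, val_degConn, val_iota]
    rfl

/-- The operator on `Ω(W)` given by `∏_a (1 - ω_f^a ι_a)`, normally ordered. -/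
def hor : Form I W →ₗ[ℝ] Form I W := horList ξ f conn (List.finRange k).reverse

/-- The map `v ↦ v - ∑_a ω_f^a(v) X_a` at a point. -/
def horLin (x : W) : E →L[ℝ] E := horLinList ξ f conn (List.finRange k).reverse x

theorem val_hor (α : Form I W) (x : W) :
    Form.val I W (hor ξ f conn α) x = extPull (horLin ξ f conn x) (Form.val I W α x) :=
  val_horList ξ f conn _ α x

theorem horLinList_apply (l : List (Fin k)) (x : W) (v : E) :
    horLinList ξ f conn l x v =
      v - (l.map fun a => ξ.coord a (degForm f conn x v) • fundField G I (ξ a) x).sum := by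
  induction l with
  | nil => simp [horLinList]
  | cons a l ih =>
    rw [horLinList, List.map_cons, List.sum_cons, sub_apply, ih,
      ContinuousLinearMap.smulRight_apply, sub_sub, add_comm]
    rfl

variable (I) in
theorem fundField_eq_sum (η : LieAlg EG G) (x : W) :
    fundField G I η x = ∑ a, ξ.coord a η • fundField G I (ξ a) x := by
  conv_lhs => rw [← ξ.sum_repr η]
  simp only [fundField, map_sum, map_smul, smul_neg, Finset.sum_neg_distrib,
    Module.Basis.coord_apply]

theorem horLin_apply (x : W) (v : E) :
    horLin ξ f conn x v = v - fundField G I (degForm f conn x v) x := by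
  rw [horLin, horLinList_apply, List.map_reverse, List.sum_reverse, ← List.ofFn_eq_map,
    List.sum_ofFn, ← fundField_eq_sum]

theorem fundField_smul (c : ℝ) (η : LieAlg EG G) (x : W) :
    fundField G I (c • η) x = c • fundField G I η x := by
  rw [fundField, fundField, map_smul, smul_neg]

theorem horLin_fundField (η : LieAlg EG G) (x : W) :
    horLin ξ f conn x (fundField G I η x) = (1 - f.toFun x) • fundField G I η x := by
  rw [horLin_apply, degForm_fundField, fundField_smul, sub_smul, one_smul]

theorem horLin_smul (g : G) (x : W) :
    (horLin ξ f conn (g • x)).comp (tangentD I (fun z : W => g • z) x) =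
      (tangentD I (fun z : W => g • z) x).comp (horLin ξ f conn x) := by
  ext v
  rw [ContinuousLinearMap.comp_apply, ContinuousLinearMap.comp_apply, horLin_apply, horLin_apply,
    map_sub, degForm_smul, tangentD_smul_fundField]

theorem hor_mul (α β : Form I W) :
    hor ξ f conn (α * β) = hor ξ f conn α * hor ξ f conn β := by
  refine Form.ext fun x => ?_
  rw [map_mul (Form.val I W), Pi.mul_apply, val_hor, val_hor, val_hor, map_mul, Pi.mul_apply,
    map_mul]

theorem hor_funForm (h : W → ℝ) (hh : ContMDiff I 𝓘(ℝ, ℝ) ∞ h) :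
    hor ξ f conn (funForm h hh) = funForm h hh := by
  refine Form.ext fun x => ?_
  rw [val_hor, val_funForm, AlgHom.commutes]

theorem hor_one : hor ξ f conn (1 : Form I W) = 1 := by
  refine Form.ext fun x => ?_
  rw [val_hor, map_one, Pi.one_apply, map_one]

theorem hor_parity (α : Form I W) :
    hor ξ f conn (parity I W α) = parity I W (hor ξ f conn α) := by
  refine Form.ext fun x => ?_
  rw [val_parity, val_hor, val_hor, val_parity, involute_extPull]

theorem iota_hor (η : LieAlg EG G) (α : Form I W) :
    iota G I W η (hor ξ f conn α) = (1 - cutoffForm f) * hor ξ f conn (iota G I W η α) := by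
  refine Form.ext fun x => ?_
  rw [val_iota, val_hor, map_mul, Pi.mul_apply, val_hor, val_iota, extContract_extPull,
    horLin_fundField, map_smul, LinearMap.smul_apply, map_smul, Algebra.smul_def, map_sub, map_one]
  rfl

theorem pullAct_hor (g : G) (α : Form I W) :
    pullAct EG I W g (hor ξ f conn α) = hor ξ f conn (pullAct EG I W g α) := by
  refine Form.ext fun x => ?_
  rw [val_pullAct, val_hor, val_hor, val_pullAct, extPull_comp, extPull_comp, horLin_smul]

theorem hor_extD_funForm (h : W → ℝ) (hh : ContMDiff I 𝓘(ℝ, ℝ) ∞ h) :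
    hor ξ f conn (extD I W (funForm h hh)) = extD I W (funForm h hh) -
      ∑ a, degConn f conn (ξ.coord a) * iota G I W (ξ a) (extD I W (funForm h hh)) := by
  refine Form.ext fun x => ?_
  rw [map_sub, Pi.sub_apply, map_sum, Finset.sum_apply, val_hor, val_extD_funForm, extPull_ι]
  have h1 : (covectorD I h x : Module.Dual ℝ E) ∘ₗ (horLin ξ f conn x : E →ₗ[ℝ] E) =
      (covectorD I h x : Module.Dual ℝ E) -
        ∑ a, fundDeriv I (ξ a) h x • (ξ.coord a ∘ₗ degForm f conn x) := by
    ext v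
    simp only [LinearMap.comp_apply, LinearMap.sub_apply, LinearMap.sum_apply,
      LinearMap.smul_apply, ContinuousLinearMap.coe_coe]
    rw [horLin_apply, map_sub, fundField_eq_sum I ξ, map_sum]
    congr 1
    refine Finset.sum_congr rfl fun a _ => ?_
    rw [map_smul, smul_eq_mul, smul_eq_mul, mul_comm]
    rfl
  rw [h1, map_sub, map_sum]
  congr 1
  refine Finset.sum_congr rfl fun a _ => ?_
  rw [map_mul, Pi.mul_apply, val_iota_extD_funForm, val_degConn, map_smul, ← Algebra.commutes,
    ← Algebra.smul_def]

/-! The map `r_f^G` is an algebra homomorphism. -/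

theorem cwWeil_ι_mul_involute (a : Fin k) (w : Weil EG G) :
    (ExteriorAlgebra.ι ℝ (ξ.coord a) ⊗ₜ[ℝ] (1 : Sym EG G)) *
        TensorProduct.map CliffordAlgebra.involute.toLinearMap LinearMap.id w =
      w * (ExteriorAlgebra.ι ℝ (ξ.coord a) ⊗ₜ[ℝ] (1 : Sym EG G)) := by
  have key : ∀ y : ExteriorAlgebra ℝ (LieDual EG G),
      ExteriorAlgebra.ι ℝ (ξ.coord a) * CliffordAlgebra.involute y =
        y * ExteriorAlgebra.ι ℝ (ξ.coord a) := by
    intro y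
    induction y using CliffordAlgebra.left_induction with
    | algebraMap r => simp [AlgHom.commutes, Algebra.commutes]
    | add x y hx hy => simp [mul_add, add_mul, hx, hy]
    | ι_mul x ψ hx =>
      have h := ExteriorAlgebra.ι_add_mul_swap (R := ℝ) (ξ.coord a) ψ
      change ExteriorAlgebra.ι ℝ (ξ.coord a) *
        CliffordAlgebra.involute (ExteriorAlgebra.ι ℝ ψ * x) =
          (ExteriorAlgebra.ι ℝ ψ * x) * ExteriorAlgebra.ι ℝ (ξ.coord a)
      have h2 : CliffordAlgebra.involute (ExteriorAlgebra.ι ℝ ψ) = -ExteriorAlgebra.ι ℝ ψ :=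
        CliffordAlgebra.involute_ι ψ
      rw [map_mul, h2, mul_assoc, ← hx, ← mul_assoc, ← mul_assoc, mul_neg,
        eq_neg_of_add_eq_zero_left h, neg_neg]
  induction w using TensorProduct.induction_on with
  | zero => simp
  | tmul y s =>
    rw [TensorProduct.map_tmul, Algebra.TensorProduct.tmul_mul_tmul,
      Algebra.TensorProduct.tmul_mul_tmul, mul_comm]
    exact congrArg₂ _ (key y) (by simp)
  | add x y hx hy => rw [map_add, mul_add, add_mul, hx, hy]

theorem cwWeil_tmul (y : ExteriorAlgebra ℝ (LieDual EG G)) (s : Sym EG G) :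
    cwWeil ξ f conn (y ⊗ₜ[ℝ] s) = cwExterior f conn y * (cwSym ξ f conn s : Cartan EG G I W) :=
  Algebra.TensorProduct.lift_tmul _ _ _ _ _

theorem cwWeil_ι (a : Fin k) :
    cwWeil ξ f conn (ExteriorAlgebra.ι ℝ (ξ.coord a) ⊗ₜ[ℝ] (1 : Sym EG G)) =
      1 ⊗ₜ[ℝ] degConn f conn (ξ.coord a) := by
  have h : cwExterior f conn (ExteriorAlgebra.ι ℝ (ξ.coord a)) =
      (1 : Sym EG G) ⊗ₜ[ℝ] degConn f conn (ξ.coord a) := ExteriorAlgebra.lift_ι_apply _ _ _ _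
  rw [cwWeil_tmul, map_one, h]
  exact mul_one _

theorem CWf_list_prod (l : List (Fin k)) (w : Weil EG G) (β : Form I W) :
    CWf ξ f conn ((l.map fun a => 1 - thetaIota G I W ξ a).prod (w ⊗ₜ[ℝ] β)) =
      cwWeil ξ f conn w * 1 ⊗ₜ[ℝ] horList ξ f conn l.reverse β := by
  induction l using List.reverseRecOn generalizing w β with
  | nil => rfl
  | append_singleton l a ih =>
    rw [List.map_append, List.prod_append, List.map_singleton, List.prod_singleton,
      Module.End.mul_apply, LinearMap.sub_apply, Module.End.one_apply, thetaIota,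
      TensorProduct.map_tmul, map_sub, map_sub, ih, ih, LinearMap.comp_apply,
      LinearMap.mulLeft_apply, cwWeil_ι_mul_involute, map_mul, cwWeil_ι, List.reverse_append,
      List.reverse_singleton, List.singleton_append, horList, LinearMap.sub_apply,
      TensorProduct.tmul_sub, mul_sub, mul_assoc, Algebra.TensorProduct.tmul_mul_tmul, one_mul]
    rfl

theorem rMap_tmul (s : Sym EG G) (β : Form I W) :
    rMap ξ f conn (s ⊗ₜ[ℝ] β) =
      (cwSym ξ f conn s : Cartan EG G I W) * 1 ⊗ₜ[ℝ] hor ξ f conn β := by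
  have h1 : cartanToWeil EG G I W (s ⊗ₜ[ℝ] β) = ((1 : ExteriorAlgebra ℝ (LieDual EG G)) ⊗ₜ[ℝ] s) ⊗ₜ[ℝ] β :=
    rfl
  have h2 : cwWeil ξ f conn ((1 : ExteriorAlgebra ℝ (LieDual EG G)) ⊗ₜ[ℝ] s) =
      (cwSym ξ f conn s : Cartan EG G I W) := by
    rw [cwWeil_tmul, map_one, one_mul]
  rw [rMap, LinearMap.comp_apply, LinearMap.comp_apply, h1, Psi, List.ofFn_eq_map, CWf_list_prod,
    h2]
  rfl

theorem rMap_mul (α β : Cartan EG G I W) :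
    rMap ξ f conn (α * β) = rMap ξ f conn α * rMap ξ f conn β := by
  induction α using TensorProduct.induction_on with
  | zero => rw [zero_mul, map_zero, zero_mul]
  | add x y hx hy => rw [add_mul, map_add, hx, hy, map_add, add_mul]
  | tmul s γ =>
    induction β using TensorProduct.induction_on with
    | zero => rw [mul_zero, map_zero, mul_zero]
    | add x y hx hy => rw [mul_add, map_add, hx, hy, map_add, mul_add]
    | tmul s' γ' =>
      have hc := Subalgebra.mem_center_iff.mp (cwSym ξ f conn s').2 (1 ⊗ₜ[ℝ] hor ξ f conn γ)
      rw [Algebra.TensorProduct.tmul_mul_tmul, rMap_tmul, rMap_tmul, rMap_tmul, map_mul, hor_mul]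
      rw [mul_assoc, ← mul_assoc (1 ⊗ₜ[ℝ] hor ξ f conn γ), hc, mul_assoc,
        Algebra.TensorProduct.tmul_mul_tmul, one_mul, ← mul_assoc]
      rfl

theorem rMap_one_tmul (β : Form I W) :
    rMap ξ f conn (1 ⊗ₜ[ℝ] β) = 1 ⊗ₜ[ℝ] hor ξ f conn β := by
  rw [rMap_tmul, map_one]
  exact one_mul _

theorem rMap_symι (φ : LieDual EG G) :
    rMap ξ f conn (symι G φ ⊗ₜ[ℝ] 1) = degCurvature ξ f conn φ := by
  have h : cwSym ξ f conn (symι G φ) = ((degCurvature ξ f conn).codRestrict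
    (Subalgebra.toSubmodule (Subalgebra.center ℝ (Cartan EG G I W)))
    (degCurvature_mem_center ξ f conn)) φ := SymmetricAlgebra.lift_ι_apply _ _
  rw [rMap_tmul, hor_one, h]
  exact mul_one _

/-- Induction for `S(𝔤*) ⊗ Ω(W)`: it is generated by `𝔤*` and `Ω(W)`. -/
theorem Cartan.induction {P : Cartan EG G I W → Prop} (hsym : ∀ φ, P (symι G φ ⊗ₜ[ℝ] 1))
    (hform : ∀ β, P (1 ⊗ₜ[ℝ] β)) (hadd : ∀ α β, P α → P β → P (α + β))
    (hmul : ∀ α β, P α → P β → P (α * β)) (α : Cartan EG G I W) : P α := by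
  have hs : ∀ s : Sym EG G, P (s ⊗ₜ[ℝ] 1) := by
    intro s
    refine SymmetricAlgebra.induction (R := ℝ) (M := LieDual EG G)
      (motive := fun s => P ((show Sym EG G from s) ⊗ₜ[ℝ] 1)) ?_ hsym ?_ ?_ s
    · intro r
      have : (algebraMap ℝ (Sym EG G) r) ⊗ₜ[ℝ] (1 : Form I W) = 1 ⊗ₜ[ℝ] (algebraMap ℝ _ r) := by
        rw [Algebra.algebraMap_eq_smul_one, Algebra.algebraMap_eq_smul_one, TensorProduct.smul_tmul]
      have h2 := hform (algebraMap ℝ _ r)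
      rw [← this] at h2
      exact h2
    · intro a b ha hb
      have := hmul _ _ ha hb
      rw [Algebra.TensorProduct.tmul_mul_tmul, one_mul] at this
      exact this
    · intro a b ha hb
      have := hadd _ _ ha hb
      rw [← TensorProduct.add_tmul] at this
      exact this
  induction α using TensorProduct.induction_on with
  | zero =>
    have := hform 0
    rwa [TensorProduct.tmul_zero] at this
  | add x y hx hy => exact hadd _ _ hx hy
  | tmul s β =>
    have := hmul _ _ (hs s) (hform β)
    rwa [Algebra.TensorProduct.tmul_mul_tmul, mul_one, one_mul] at this

end HorizontalProjection

section HorizontalDifferential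

variable {EG : Type*} [NormedAddCommGroup EG] [NormedSpace ℝ EG] [FiniteDimensional ℝ EG]
  {G : Type*} [TopologicalSpace G] [ChartedSpace EG G] [Group G] [LieGroup 𝓘(ℝ, EG) ∞ G]
  {E : Type*} [NormedAddCommGroup E] [NormedSpace ℝ E] [FiniteDimensional ℝ E]
  {H : Type*} [TopologicalSpace H] {I : ModelWithCorners ℝ E H}
  {W : Type*} [TopologicalSpace W] [ChartedSpace H W] [IsManifold I ∞ W]
  [MulAction G W] [ContMDiffSMul 𝓘(ℝ, EG) I ∞ G W]
  {k : ℕ} (ξ : Module.Basis (Fin k) ℝ (LieAlg EG G))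
  (f : Cutoff G I W) (conn : Connection (EG := EG) G I W)

theorem degConn_mul_degConn (φ ψ : LieDual EG G) :
    degConn f conn φ * degConn f conn ψ = -(degConn f conn ψ * degConn f conn φ) := by
  rw [degConn_mul_comm, parity_degConn, neg_mul]

/-- A sum antisymmetrized by the anticommuting connection components. -/
theorem sum_degConn_mul_swap (u : Fin k → Fin k → Form I W) :
    ∑ b, ∑ c, degConn f conn (ξ.coord b) * degConn f conn (ξ.coord c) * u c b =
      -∑ b, ∑ c, degConn f conn (ξ.coord b) * degConn f conn (ξ.coord c) * u b c := by
  rw [Finset.sum_comm, ← Finset.sum_neg_distrib]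
  refine Finset.sum_congr rfl fun b _ => ?_
  rw [← Finset.sum_neg_distrib]
  refine Finset.sum_congr rfl fun c _ => ?_
  rw [degConn_mul_degConn, neg_mul]

/-- The failure of `hor` to commute with the exterior derivative, corrected by curvature and Lie
derivative terms. -/
def horDefect (α : Form I W) : Form I W :=
  extD I W (hor ξ f conn α) - hor ξ f conn (extD I W α) +
    ∑ a, curvForm ξ f conn (ξ.coord a) * hor ξ f conn (iota G I W (ξ a) α) -
    ∑ a, degConn f conn (ξ.coord a) * hor ξ f conn (lieD G I W (ξ a) α)

theorem horDefect_add (α β : Form I W) :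
    horDefect ξ f conn (α + β) = horDefect ξ f conn α + horDefect ξ f conn β := by
  simp only [horDefect, map_add, mul_add, Finset.sum_add_distrib]
  abel

theorem horDefect_mul (α β : Form I W) :
    horDefect ξ f conn (α * β) = horDefect ξ f conn α * hor ξ f conn β +
      parity I W (hor ξ f conn α) * horDefect ξ f conn β := by
  have h1 : ∀ a, curvForm ξ f conn (ξ.coord a) * hor ξ f conn (iota G I W (ξ a) (α * β)) =
      curvForm ξ f conn (ξ.coord a) * hor ξ f conn (iota G I W (ξ a) α) * hor ξ f conn β +
      parity I W (hor ξ f conn α) *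
        (curvForm ξ f conn (ξ.coord a) * hor ξ f conn (iota G I W (ξ a) β)) := by
    intro a
    rw [iota_mul, map_add, hor_mul, hor_mul, hor_parity, mul_add, ← mul_assoc, ← mul_assoc,
      ← mul_assoc, curvForm_comm ξ f conn _ (parity I W _)]
  have h2 : ∀ a, degConn f conn (ξ.coord a) * hor ξ f conn (lieD G I W (ξ a) (α * β)) =
      degConn f conn (ξ.coord a) * hor ξ f conn (lieD G I W (ξ a) α) * hor ξ f conn β +
      parity I W (hor ξ f conn α) *
        (degConn f conn (ξ.coord a) * hor ξ f conn (lieD G I W (ξ a) β)) := by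
    intro a
    rw [lieD_mul, map_add, hor_mul, hor_mul, mul_add, ← mul_assoc, ← mul_assoc, ← mul_assoc,
      degConn_mul_comm f conn _ (hor ξ f conn α)]
  simp only [horDefect, h1, h2, Finset.sum_add_distrib, ← Finset.sum_mul, ← Finset.mul_sum,
    extD_mul, map_add, hor_mul, hor_parity]
  noncomm_ring

theorem horDefect_funForm (h : W → ℝ) (hh : ContMDiff I 𝓘(ℝ, ℝ) ∞ h) :
    horDefect ξ f conn (funForm h hh) = 0 := by
  have h0 : ∀ a, iota G I W (ξ a) (funForm h hh) = 0 := fun a => contract_funForm _ _ _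
  simp only [horDefect, hor_funForm, h0, map_zero, mul_zero, Finset.sum_const_zero, add_zero,
    lieD_funForm, hor_extD_funForm, iota_extD_funForm]
  abel

theorem iota_lie_eq_sum (η : LieAlg EG G) (α : Form I W) :
    iota G I W η α = ∑ a, ξ.coord a η • iota G I W (ξ a) α := by
  conv_lhs => rw [← iotaLin_apply, ← ξ.sum_repr η, map_sum]
  rw [LinearMap.sum_apply]
  refine Finset.sum_congr rfl fun a _ => ?_
  rw [map_smul, iotaLin_apply, Module.Basis.coord_apply, LinearMap.smul_apply]

theorem horDefect_extD_funForm [T2Space W] (h : W → ℝ) (hh : ContMDiff I 𝓘(ℝ, ℝ) ∞ h) :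
    horDefect ξ f conn (extD I W (funForm h hh)) = 0 := by
  let w : Fin k → Form I W := fun a => degConn f conn (ξ.coord a)
  let u : Fin k → Form I W := fun a => iota G I W (ξ a) (extD I W (funForm h hh))
  let u₂ : Fin k → Fin k → Form I W := fun b c => iota G I W (ξ b) (extD I W (u c))
  have hu : ∀ a, u a = funForm (fundDeriv I (ξ a) h) (contMDiff_fundDeriv (ξ a) hh) :=
    fun a => iota_extD_funForm _ _ _
  have hιu : ∀ b c, iota G I W (ξ b) (u c) = 0 := fun b c => by
    rw [hu]
    exact contract_funForm _ _ _
  have horu : ∀ a, hor ξ f conn (u a) = u a := fun a => by rw [hu, hor_funForm]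
  have hordu : ∀ a, hor ξ f conn (extD I W (u a)) =
      extD I W (u a) - ∑ b, w b * u₂ b a := fun a => by
    simp only [u₂, w]
    rw [hu, hor_extD_funForm]
  have hL : ∀ a, lieD G I W (ξ a) (extD I W (funForm h hh)) = extD I W (u a) := fun a => by
    rw [lieD_apply, extD_extD, map_zero, add_zero]
  have hbr : ∀ b c, ∑ a, ξ.coord a ⁅ξ b, ξ c⁆ • u a = u₂ b c - u₂ c b := by
    intro b c
    rw [← iota_lie_eq_sum ξ]
    have h1 := lieD_iota ξ (ξ b) (ξ c) (extD I W (funForm h hh))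
    rw [hL, lieD_apply] at h1
    change extD I W (iota G I W (ξ b) (u c)) + u₂ b c = u₂ c b + _ at h1
    rw [hιu, map_zero, zero_add] at h1
    rw [h1]
    abel
  have hcurv : ∑ a, curvForm ξ f conn (ξ.coord a) * u a =
      ∑ a, extD I W (w a) * u a + ∑ b, ∑ c, w b * w c * u₂ b c := by
    have h1 : ∀ a, curvForm ξ f conn (ξ.coord a) * u a = extD I W (w a) * u a +
        (2⁻¹ : ℝ) • ∑ b, ∑ c, w b * w c * (ξ.coord a ⁅ξ b, ξ c⁆ • u a) := by
      intro a
      rw [curvForm_apply, add_mul, smul_mul_assoc, Finset.sum_mul]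
      congr 2
      refine Finset.sum_congr rfl fun b _ => ?_
      rw [Finset.sum_mul]
      refine Finset.sum_congr rfl fun c _ => ?_
      rw [smul_mul_assoc, mul_smul_comm]
    have h2 : ∑ a, ∑ b, ∑ c, w b * w c * (ξ.coord a ⁅ξ b, ξ c⁆ • u a) =
        ∑ b, ∑ c, w b * w c * (u₂ b c - u₂ c b) := by
      rw [Finset.sum_comm]
      refine Finset.sum_congr rfl fun b _ => ?_
      rw [Finset.sum_comm]
      refine Finset.sum_congr rfl fun c _ => ?_
      rw [← Finset.mul_sum, hbr]
    simp only [h1, Finset.sum_add_distrib, ← Finset.smul_sum, h2, mul_sub, Finset.sum_sub_distrib]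
    rw [sum_degConn_mul_swap ξ f conn u₂, sub_neg_eq_add, ← two_smul ℝ, smul_smul]
    norm_num
  have h1 : extD I W (hor ξ f conn (extD I W (funForm h hh))) =
      -∑ a, extD I W (w a) * u a + ∑ a, w a * extD I W (u a) := by
    rw [hor_extD_funForm, map_sub, extD_extD, zero_sub, map_sum, ← sub_neg_eq_add, ← neg_add',
      neg_inj, ← Finset.sum_neg_distrib, ← Finset.sum_add_distrib]
    refine Finset.sum_congr rfl fun a _ => ?_
    rw [extD_mul, parity_degConn, neg_mul]
  have h2 : ∑ a, w a * hor ξ f conn (lieD G I W (ξ a) (extD I W (funForm h hh))) =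
      ∑ a, w a * extD I W (u a) + ∑ b, ∑ c, w b * w c * u₂ b c := by
    have h3 : ∀ a, w a * hor ξ f conn (lieD G I W (ξ a) (extD I W (funForm h hh))) =
        w a * extD I W (u a) - ∑ b, w a * w b * u₂ b a := fun a => by
      rw [hL, hordu, mul_sub, Finset.mul_sum]
      simp only [mul_assoc]
    simp only [h3, Finset.sum_sub_distrib]
    rw [sum_degConn_mul_swap ξ f conn u₂, sub_neg_eq_add]
  have h4 : ∑ a, curvForm ξ f conn (ξ.coord a) *
      hor ξ f conn (iota G I W (ξ a) (extD I W (funForm h hh))) =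
        ∑ a, curvForm ξ f conn (ξ.coord a) * u a :=
    Finset.sum_congr rfl fun a _ => congrArg _ (horu a)
  rw [horDefect, h1, h4, hcurv, extD_extD, map_zero]
  change _ - ∑ a, w a * hor ξ f conn (lieD G I W (ξ a) (extD I W (funForm h hh))) = 0
  rw [h2]
  abel

theorem horDefect_eq_zero [T2Space W] (α : Form I W) : horDefect ξ f conn α = 0 := by
  refine Form.ext fun x => ?_
  rw [map_zero, Pi.zero_apply]
  refine Form.local_induction x (P := fun α => Form.val I W (horDefect ξ f conn α) x = 0)
    ?_ ?_ ?_ ?_ ?_ α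
  · intro h hh
    rw [horDefect_funForm, map_zero, Pi.zero_apply]
  · intro h hh
    rw [horDefect_extD_funForm, map_zero, Pi.zero_apply]
  · intro α β hα hβ
    rw [horDefect_add, map_add, Pi.add_apply, hα, hβ, add_zero]
  · intro α β hα hβ
    rw [horDefect_mul, map_add, map_mul, map_mul, Pi.add_apply, Pi.mul_apply, Pi.mul_apply, hα, hβ,
      zero_mul, mul_zero, add_zero]
  · intro α β h hα
    rw [← hα]
    have h1 : Form.val I W (extD I W (hor ξ f conn β)) x =
        Form.val I W (extD I W (hor ξ f conn α)) x := by
      refine val_extD_congr ?_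
      filter_upwards [h] with y hy
      rw [val_hor, val_hor, hy]
    simp only [horDefect, map_sub, map_add, map_sum, map_mul, Pi.sub_apply, Pi.add_apply,
      Finset.sum_apply, Pi.mul_apply, h1, val_hor, val_iota, val_extD_congr h, h.self_of_nhds,
      val_lieD_congr _ h]

/-! The Bianchi identity. -/

theorem parity_curvForm (φ : LieDual EG G) :
    parity I W (curvForm ξ f conn φ) = curvForm ξ f conn φ := by
  simp only [curvForm_apply, map_add, map_smul, map_sum, map_mul, parity_extD, parity_degConn,
    map_neg, neg_neg, neg_mul_neg]

theorem degConn_lieDual (ζ : LieAlg EG G) (φ : LieDual EG G) :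
    degConn f conn (lieDual ζ φ) = ∑ c, φ ⁅ζ, ξ c⁆ • degConn f conn (ξ.coord c) := by
  conv_lhs => rw [dual_eq_sum ξ (lieDual ζ φ)]
  simp only [map_sum, map_smul, lieDual_apply]

theorem iota_curvForm [T2Space W] (a : Fin k) (φ : LieDual EG G) :
    iota G I W (ξ a) (curvForm ξ f conn φ) =
      -((1 - cutoffForm f) * degConn f conn (lieDual (ξ a) φ)) -
        φ (ξ a) • extD I W (cutoffForm f) := by
  have h1 : iota G I W (ξ a) (extD I W (degConn f conn φ)) =
      -degConn f conn (lieDual (ξ a) φ) - φ (ξ a) • extD I W (cutoffForm f) := by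
    have := lieD_degConn ξ f conn (ξ a) φ
    rw [lieD_apply, iota_degConn, map_smul] at this
    rw [← this]
    abel
  have h2 : ∀ b c, iota G I W (ξ a) (degConn f conn (ξ.coord b) * degConn f conn (ξ.coord c)) =
      ξ.coord b (ξ a) • (cutoffForm f * degConn f conn (ξ.coord c)) -
      ξ.coord c (ξ a) • (cutoffForm f * degConn f conn (ξ.coord b)) := by
    intro b c
    rw [iota_mul, iota_degConn, iota_degConn, parity_degConn, smul_mul_assoc, mul_smul_comm,
      neg_mul, ← cutoffForm_comm, smul_neg, sub_eq_add_neg]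
  have h3 : ∑ b, ∑ c, φ ⁅ξ b, ξ c⁆ • (ξ.coord b (ξ a) • (cutoffForm f * degConn f conn (ξ.coord c)))
      = cutoffForm f * degConn f conn (lieDual (ξ a) φ) := by
    rw [degConn_lieDual ξ, Finset.mul_sum, Finset.sum_eq_single a]
    · simp
    · intro b _ hb
      simp [hb.symm]
    · simp
  have h4 : ∑ b, ∑ c, φ ⁅ξ b, ξ c⁆ • (ξ.coord c (ξ a) • (cutoffForm f * degConn f conn (ξ.coord b)))
      = -(cutoffForm f * degConn f conn (lieDual (ξ a) φ)) := by
    rw [← h3, Finset.sum_comm, ← Finset.sum_neg_distrib]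
    refine Finset.sum_congr rfl fun b _ => ?_
    rw [← Finset.sum_neg_distrib]
    refine Finset.sum_congr rfl fun c _ => ?_
    rw [← lie_skew, map_neg, neg_smul]
  rw [curvForm_apply, map_add, h1, map_smul]
  simp only [map_sum, map_smul, h2, smul_sub, Finset.sum_sub_distrib]
  rw [← smul_sub, h3, h4, sub_neg_eq_add, ← two_smul ℝ, smul_smul, sub_mul, one_mul]
  norm_num
  abel

theorem sum_lie_lie_degConn (φ : LieDual EG G) :
    ∑ a, ∑ b, ∑ c, φ ⁅ξ a, ⁅ξ b, ξ c⁆⁆ • (degConn f conn (ξ.coord a) *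
      (degConn f conn (ξ.coord b) * degConn f conn (ξ.coord c))) = 0 := by
  set w : Fin k → Form I W := fun a => degConn f conn (ξ.coord a) with hw
  have hanti : ∀ a b, w a * w b = -(w b * w a) := fun a b => degConn_mul_degConn f conn _ _
  set J := ∑ a, ∑ b, ∑ c, φ ⁅ξ a, ⁅ξ b, ξ c⁆⁆ • (w a * (w b * w c)) with hJ
  have h1 : ∑ a, ∑ b, ∑ c, φ ⁅ξ b, ⁅ξ a, ξ c⁆⁆ • (w a * (w b * w c)) = -J := by
    rw [Finset.sum_comm, hJ, ← Finset.sum_neg_distrib]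
    refine Finset.sum_congr rfl fun a _ => ?_
    rw [← Finset.sum_neg_distrib]
    refine Finset.sum_congr rfl fun b _ => ?_
    rw [← Finset.sum_neg_distrib]
    refine Finset.sum_congr rfl fun c _ => ?_
    rw [← mul_assoc, hanti b a, neg_mul, smul_neg, mul_assoc]
  have h2 : ∑ a, ∑ b, ∑ c, φ ⁅⁅ξ a, ξ b⁆, ξ c⁆ • (w a * (w b * w c)) = -J := by
    have h3 : ∀ a b c, φ ⁅⁅ξ a, ξ b⁆, ξ c⁆ • (w a * (w b * w c)) =
        -(φ ⁅ξ c, ⁅ξ a, ξ b⁆⁆ • (w c * (w a * w b))) := by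
      intro a b c
      rw [← lie_skew, map_neg, neg_smul, hanti b c, mul_neg, ← mul_assoc, hanti a c, neg_mul,
        neg_neg, mul_assoc]
    simp only [h3, Finset.sum_neg_distrib]
    rw [neg_inj, hJ]
    calc ∑ a, ∑ b, ∑ c, φ ⁅ξ c, ⁅ξ a, ξ b⁆⁆ • (w c * (w a * w b))
        = ∑ a, ∑ c, ∑ b, φ ⁅ξ c, ⁅ξ a, ξ b⁆⁆ • (w c * (w a * w b)) :=
          Finset.sum_congr rfl fun a _ => Finset.sum_comm
      _ = _ := Finset.sum_comm
  have h4 : J = -J + -J := by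
    refine hJ.trans (Eq.trans ?_ (congrArg₂ (· + ·) h2 h1))
    simp only [← Finset.sum_add_distrib, ← add_smul, ← map_add, ← leibniz_lie]
  have h5 : (3 : ℝ) • J = 0 := by
    have : (3 : ℝ) • J = J + J + J := by
      rw [show (3 : ℝ) = 1 + 1 + 1 by norm_num, add_smul, add_smul, one_smul]
    rw [this]
    nth_rewrite 1 [h4]
    abel
  exact (smul_eq_zero.mp h5).resolve_left (by norm_num)

theorem extD_curvForm (φ : LieDual EG G) :
    extD I W (curvForm ξ f conn φ) =
      -∑ a, degConn f conn (ξ.coord a) * curvForm ξ f conn (lieDual (ξ a) φ) := by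
  set w : Fin k → Form I W := fun a => degConn f conn (ξ.coord a) with hw
  have h1 : ∀ a, w a * curvForm ξ f conn (lieDual (ξ a) φ) =
      ∑ b, φ ⁅ξ a, ξ b⁆ • (w a * extD I W (w b)) +
      (2⁻¹ : ℝ) • ∑ b, ∑ c, φ ⁅ξ a, ⁅ξ b, ξ c⁆⁆ • (w a * (w b * w c)) := by
    intro a
    rw [curvForm_apply, degConn_lieDual ξ, mul_add, mul_smul_comm]
    simp only [map_sum, map_smul, Finset.mul_sum, mul_smul_comm, lieDual_apply, hw]
  have h2 : ∑ b, ∑ c, φ ⁅ξ b, ξ c⁆ • (extD I W (w b) * w c) =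
      -∑ a, ∑ b, φ ⁅ξ a, ξ b⁆ • (w a * extD I W (w b)) := by
    rw [Finset.sum_comm, ← Finset.sum_neg_distrib]
    refine Finset.sum_congr rfl fun a _ => ?_
    rw [← Finset.sum_neg_distrib]
    refine Finset.sum_congr rfl fun b _ => ?_
    rw [← lie_skew, map_neg, neg_smul, extD_degConn_comm]
  have h3 : ∀ b c, extD I W (w b * w c) = extD I W (w b) * w c - w b * extD I W (w c) := by
    intro b c
    rw [extD_mul, parity_degConn, neg_mul, sub_eq_add_neg]
  change _ = -∑ a, w a * curvForm ξ f conn (lieDual (ξ a) φ)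
  simp only [h1, Finset.sum_add_distrib, ← Finset.smul_sum]
  rw [sum_lie_lie_degConn ξ f conn φ, smul_zero, add_zero, curvForm_apply, map_add, extD_extD,
    zero_add, map_smul]
  simp only [map_sum, map_smul]
  change (2⁻¹ : ℝ) • ∑ b, ∑ c, φ ⁅ξ b, ξ c⁆ • extD I W (w b * w c) = _
  simp only [h3, smul_sub, Finset.sum_sub_distrib]
  rw [← smul_sub, h2, ← neg_add', ← two_smul ℝ, smul_neg, smul_smul]
  norm_num

end HorizontalDifferential

section CartanModel

theorem eq_zero_of_eq_neg {V : Type*} [AddCommGroup V] [Module ℝ V] {v : V} (h : v = -v) :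
    v = 0 := by
  have h2 : (2 : ℝ) • v = 0 := by
    rw [two_smul]
    nth_rewrite 1 [h]
    exact neg_add_cancel v
  exact (smul_eq_zero.mp h2).resolve_left two_ne_zero

variable {EG : Type*} [NormedAddCommGroup EG] [NormedSpace ℝ EG] [FiniteDimensional ℝ EG]
  {G : Type*} [TopologicalSpace G] [ChartedSpace EG G] [Group G] [LieGroup 𝓘(ℝ, EG) ∞ G]

theorem symLift_symι {A : Type*} [CommRing A] [Algebra ℝ A] (l : LieDual EG G →ₗ[ℝ] A)
    (φ : LieDual EG G) : symLift l (symι G φ) = l φ :=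
  SymmetricAlgebra.lift_ι_apply _ _

theorem Sym.induction {P : Sym EG G → Prop} (halg : ∀ r : ℝ, P (algebraMap ℝ _ r))
    (hι : ∀ φ, P (symι G φ)) (hmul : ∀ s t, P s → P t → P (s * t))
    (hadd : ∀ s t, P s → P t → P (s + t)) (s : Sym EG G) : P s :=
  SymmetricAlgebra.induction (R := ℝ) (M := LieDual EG G) (motive := P) halg hι hmul hadd s

/-- The algebra map `s ↦ s + ε (ζ · s)` to the dual numbers over `S(𝔤*)`, for the infinitesimal
coadjoint action of `ζ`. -/
def lieSymDual (ζ : LieAlg EG G) : Sym EG G →ₐ[ℝ] TrivSqZeroExt (Sym EG G) (Sym EG G) :=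
  symLift
    { toFun := fun φ => TrivSqZeroExt.inl (symι G φ) - TrivSqZeroExt.inr (symι G (lieDual ζ φ))
      map_add' := fun φ ψ => by
        have h : lieDual ζ (φ + ψ) = lieDual ζ φ + lieDual ζ ψ := rfl
        ext <;> simp [h, add_comm]
      map_smul' := fun c φ => by
        have h : lieDual ζ (c • φ) = c • lieDual ζ φ := rfl
        ext <;> simp [h] }

theorem fst_lieSymDual (ζ : LieAlg EG G) (s : Sym EG G) : (lieSymDual ζ s).fst = s := by
  induction s using Sym.induction with
  | halg r => rw [AlgHom.commutes]; rfl
  | hι φ => rw [lieSymDual, symLift_symι]; simp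
  | hmul s t hs ht => rw [map_mul, TrivSqZeroExt.fst_mul, hs, ht]
  | hadd s t hs ht => rw [map_add, TrivSqZeroExt.fst_add, hs, ht]

/-- The infinitesimal coadjoint action of `ζ ∈ 𝔤` on `S(𝔤*)`. -/
def lieSym (ζ : LieAlg EG G) : Sym EG G →ₗ[ℝ] Sym EG G where
  toFun s := (lieSymDual ζ s).snd
  map_add' s t := by rw [map_add, TrivSqZeroExt.snd_add]
  map_smul' c s := by rw [map_smul, TrivSqZeroExt.snd_smul, RingHom.id_apply]

theorem lieSym_mul (ζ : LieAlg EG G) (s t : Sym EG G) :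
    lieSym ζ (s * t) = lieSym ζ s * t + s * lieSym ζ t := by
  change (lieSymDual ζ (s * t)).snd = (lieSymDual ζ s).snd * t + s * (lieSymDual ζ t).snd
  rw [map_mul, TrivSqZeroExt.snd_mul, fst_lieSymDual, fst_lieSymDual, add_comm, smul_eq_mul,
    op_smul_eq_mul]

theorem lieSym_symι (ζ : LieAlg EG G) (φ : LieDual EG G) :
    lieSym ζ (symι G φ) = -symι G (lieDual ζ φ) := by
  change (lieSymDual ζ (symι G φ)).snd = _
  rw [lieSymDual, symLift_symι]
  simp

theorem lieSym_algebraMap (ζ : LieAlg EG G) (r : ℝ) :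
    lieSym ζ (algebraMap ℝ (Sym EG G) r) = 0 := by
  change (lieSymDual ζ (algebraMap ℝ _ r)).snd = _
  rw [AlgHom.commutes]
  rfl

theorem lieSym_one (ζ : LieAlg EG G) : lieSym ζ (1 : Sym EG G) = 0 := by
  rw [← map_one (algebraMap ℝ (Sym EG G)), lieSym_algebraMap]

variable {k : ℕ} (ξ : Module.Basis (Fin k) ℝ (LieAlg EG G))

theorem symι_lieDual (ζ : LieAlg EG G) (φ : LieDual EG G) :
    symι G (lieDual ζ φ) = ∑ c, φ ⁅ζ, ξ c⁆ • symι G (ξ.coord c) := by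
  conv_lhs => rw [dual_eq_sum ξ (lieDual ζ φ)]
  simp only [map_sum, map_smul, lieDual_apply]

theorem sum_symι_mul_lieSym (s : Sym EG G) : ∑ a, symι G (ξ.coord a) * lieSym (ξ a) s = 0 := by
  induction s using Sym.induction with
  | halg r => simp only [lieSym_algebraMap, mul_zero, Finset.sum_const_zero]
  | hι φ =>
    have h : ∑ a, symι G (ξ.coord a) * lieSym (ξ a) (symι G φ) =
        -∑ a, ∑ c, φ ⁅ξ a, ξ c⁆ • (symι G (ξ.coord a) * symι G (ξ.coord c)) := by
      simp only [lieSym_symι, symι_lieDual ξ, mul_neg, Finset.mul_sum, mul_smul_comm,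
        Finset.sum_neg_distrib]
    have h2 : ∑ a, ∑ c, φ ⁅ξ a, ξ c⁆ • (symι G (ξ.coord a) * symι G (ξ.coord c)) =
        -∑ a, ∑ c, φ ⁅ξ a, ξ c⁆ • (symι G (ξ.coord a) * symι G (ξ.coord c)) := by
      conv_lhs => rw [Finset.sum_comm]
      rw [← Finset.sum_neg_distrib]
      refine Finset.sum_congr rfl fun a _ => ?_
      rw [← Finset.sum_neg_distrib]
      refine Finset.sum_congr rfl fun c _ => ?_
      rw [← lie_skew, map_neg, neg_smul, mul_comm]
    rw [h, eq_zero_of_eq_neg h2, neg_zero]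
  | hmul s t hs ht =>
    have h : ∀ a, symι G (ξ.coord a) * lieSym (ξ a) (s * t) =
        symι G (ξ.coord a) * lieSym (ξ a) s * t + s * (symι G (ξ.coord a) * lieSym (ξ a) t) := by
      intro a
      rw [lieSym_mul]
      ring
    simp only [h, Finset.sum_add_distrib, ← Finset.sum_mul, ← Finset.mul_sum, hs, ht, zero_mul,
      mul_zero, add_zero]
  | hadd s t hs ht => simp only [map_add, mul_add, Finset.sum_add_distrib, hs, ht, add_zero]

variable {E : Type*} [NormedAddCommGroup E] [NormedSpace ℝ E] [FiniteDimensional ℝ E]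
  {H : Type*} [TopologicalSpace H] {I : ModelWithCorners ℝ E H}
  {W : Type*} [TopologicalSpace W] [ChartedSpace H W] [IsManifold I ∞ W]
  [MulAction G W] [ContMDiffSMul 𝓘(ℝ, EG) I ∞ G W]

theorem extD_one : extD I W (1 : Form I W) = 0 := by
  have h := extD_mul (I := I) (M := W) 1 1
  rw [map_one (parity I W), one_mul, one_mul, mul_one, left_eq_add] at h
  exact h

theorem iota_one (η : LieAlg EG G) : iota G I W η (1 : Form I W) = 0 := by
  have h := iota_mul (I := I) (W := W) η 1 1
  rw [map_one (parity I W), one_mul, one_mul, mul_one, left_eq_add] at h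
  exact h

theorem lieD_one (η : LieAlg EG G) : lieD G I W η (1 : Form I W) = 0 := by
  rw [lieD_apply, iota_one, extD_one, map_zero, map_zero, add_zero]

variable (EG G I W) in
/-- The parity automorphism of `S(𝔤*) ⊗ Ω(W)`. -/
def cartanParity : Cartan EG G I W →ₐ[ℝ] Cartan EG G I W :=
  Algebra.TensorProduct.map (AlgHom.id ℝ (Sym EG G)) (parity I W)

theorem cartanParity_tmul (s : Sym EG G) (β : Form I W) :
    cartanParity EG G I W (s ⊗ₜ[ℝ] β) = s ⊗ₜ[ℝ] parity I W β := rfl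

theorem cartanD_tmul (s : Sym EG G) (β : Form I W) :
    cartanD G I W ξ (s ⊗ₜ[ℝ] β) = s ⊗ₜ[ℝ] extD I W β -
      ∑ a, (symι G (ξ.coord a) * s) ⊗ₜ[ℝ] iota G I W (ξ a) β := by
  rw [cartanD, LinearMap.sub_apply, LinearMap.sum_apply]
  rfl

theorem cartanD_mul (α β : Cartan EG G I W) :
    cartanD G I W ξ (α * β) =
      cartanD G I W ξ α * β + cartanParity EG G I W α * cartanD G I W ξ β := by
  induction α using TensorProduct.induction_on with
  | zero => simp only [zero_mul, map_zero, add_zero]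
  | add x y hx hy =>
    rw [add_mul, map_add, hx, hy, map_add, map_add, add_mul, add_mul]
    abel
  | tmul s γ =>
    induction β using TensorProduct.induction_on with
    | zero => simp only [mul_zero, map_zero, add_zero]
    | add x y hx hy =>
      rw [mul_add, map_add, hx, hy, map_add, mul_add, mul_add]
      abel
    | tmul t δ =>
      rw [Algebra.TensorProduct.tmul_mul_tmul, cartanD_tmul, cartanD_tmul, cartanD_tmul,
        cartanParity_tmul, extD_mul, TensorProduct.tmul_add, sub_mul, mul_sub, Finset.sum_mul,
        Finset.mul_sum, Algebra.TensorProduct.tmul_mul_tmul, Algebra.TensorProduct.tmul_mul_tmul]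
      have h : ∀ a, (symι G (ξ.coord a) * (s * t)) ⊗ₜ[ℝ] iota G I W (ξ a) (γ * δ) =
          ((symι G (ξ.coord a) * s) ⊗ₜ[ℝ] iota G I W (ξ a) γ) * (t ⊗ₜ[ℝ] δ) +
          (s ⊗ₜ[ℝ] parity I W γ) * ((symι G (ξ.coord a) * t) ⊗ₜ[ℝ] iota G I W (ξ a) δ) := by
        intro a
        rw [Algebra.TensorProduct.tmul_mul_tmul, Algebra.TensorProduct.tmul_mul_tmul, iota_mul,
          TensorProduct.tmul_add, mul_assoc, mul_left_comm s]
      simp only [h, Finset.sum_add_distrib]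
      abel

variable (I W) in
/-- The infinitesimal diagonal action of `ζ ∈ 𝔤` on `S(𝔤*) ⊗ Ω(W)`. -/
def cartanLie (ζ : LieAlg EG G) : Cartan EG G I W →ₗ[ℝ] Cartan EG G I W :=
  TensorProduct.map (lieSym ζ) LinearMap.id + TensorProduct.map LinearMap.id (lieD G I W ζ)

theorem cartanLie_tmul (ζ : LieAlg EG G) (s : Sym EG G) (β : Form I W) :
    cartanLie I W ζ (s ⊗ₜ[ℝ] β) = lieSym ζ s ⊗ₜ[ℝ] β + s ⊗ₜ[ℝ] lieD G I W ζ β := rfl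

theorem cartanLie_mul (ζ : LieAlg EG G) (α β : Cartan EG G I W) :
    cartanLie I W ζ (α * β) = cartanLie I W ζ α * β + α * cartanLie I W ζ β := by
  induction α using TensorProduct.induction_on with
  | zero => simp only [zero_mul, map_zero, add_zero]
  | add x y hx hy =>
    rw [add_mul, map_add, hx, hy, map_add, add_mul, add_mul]
    abel
  | tmul s γ =>
    induction β using TensorProduct.induction_on with
    | zero => simp only [mul_zero, map_zero, add_zero]
    | add x y hx hy =>
      rw [mul_add, map_add, hx, hy, map_add, mul_add, mul_add]
      abel
    | tmul t δ =>
      simp only [Algebra.TensorProduct.tmul_mul_tmul, cartanLie_tmul, lieD_mul, lieSym_mul,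
        TensorProduct.tmul_add, TensorProduct.add_tmul, add_mul, mul_add]
      abel

theorem cartanD_cartanD (α : Cartan EG G I W) :
    cartanD G I W ξ (cartanD G I W ξ α) =
      -∑ a, (symι G (ξ.coord a) ⊗ₜ[ℝ] 1) * cartanLie I W (ξ a) α := by
  induction α using TensorProduct.induction_on with
  | zero => simp only [map_zero, mul_zero, Finset.sum_const_zero, neg_zero]
  | add x y hx hy =>
    rw [map_add, map_add, hx, hy, ← neg_add, ← Finset.sum_add_distrib]
    simp only [map_add, mul_add]
  | tmul s β =>
    have h1 : ∑ a, ∑ b, (symι G (ξ.coord b) * (symι G (ξ.coord a) * s)) ⊗ₜ[ℝ]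
        iota G I W (ξ b) (iota G I W (ξ a) β) = 0 := by
      refine eq_zero_of_eq_neg ?_
      conv_lhs => rw [Finset.sum_comm]
      rw [← Finset.sum_neg_distrib]
      refine Finset.sum_congr rfl fun a _ => ?_
      rw [← Finset.sum_neg_distrib]
      refine Finset.sum_congr rfl fun b _ => ?_
      rw [iota_iota_comm, TensorProduct.tmul_neg, mul_left_comm]
    have h2 : ∑ a, (symι G (ξ.coord a) * lieSym (ξ a) s) ⊗ₜ[ℝ] β = 0 := by
      rw [← TensorProduct.sum_tmul, sum_symι_mul_lieSym, TensorProduct.zero_tmul]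
    simp only [cartanD_tmul, map_sub, map_sum, cartanLie_tmul, mul_add,
      Algebra.TensorProduct.tmul_mul_tmul, one_mul, Finset.sum_add_distrib,
      Finset.sum_sub_distrib, lieD_apply, TensorProduct.tmul_add, extD_extD,
      TensorProduct.tmul_zero]
    rw [h1, h2]
    abel

variable (f : Cutoff G I W) (conn : Connection (EG := EG) G I W)

theorem parity_cutoffForm : parity I W (cutoffForm f) = cutoffForm f := parity_funForm _ f.smooth

theorem cartanParity_rMap (α : Cartan EG G I W) :
    rMap ξ f conn (cartanParity EG G I W α) = cartanParity EG G I W (rMap ξ f conn α) := by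
  induction α using Cartan.induction with
  | hsym φ =>
    rw [cartanParity_tmul, map_one, rMap_symι, degCurvature_apply, map_sub, cartanParity_tmul,
      cartanParity_tmul, parity_curvForm, map_add, map_neg, map_one, parity_cutoffForm]
  | hform β => rw [cartanParity_tmul, rMap_one_tmul, rMap_one_tmul, hor_parity, cartanParity_tmul]
  | hadd α β hα hβ => rw [map_add, map_add, hα, hβ, map_add, map_add]
  | hmul α β hα hβ => rw [map_mul, rMap_mul, hα, hβ, rMap_mul, map_mul]

theorem one_tmul_degConn_mul (φ : LieDual EG G) (α : Cartan EG G I W) :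
    (1 ⊗ₜ[ℝ] degConn f conn φ) * α = cartanParity EG G I W α * (1 ⊗ₜ[ℝ] degConn f conn φ) := by
  induction α using TensorProduct.induction_on with
  | zero => simp only [map_zero, mul_zero, zero_mul]
  | add x y hx hy => rw [mul_add, hx, hy, map_add, add_mul]
  | tmul s β =>
    rw [cartanParity_tmul, Algebra.TensorProduct.tmul_mul_tmul,
      Algebra.TensorProduct.tmul_mul_tmul, one_mul, mul_one, degConn_mul_comm]

theorem rMap_symι_tmul (φ : LieDual EG G) (β : Form I W) :
    rMap ξ f conn (symι G φ ⊗ₜ[ℝ] β) =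
      1 ⊗ₜ[ℝ] (curvForm ξ f conn φ * hor ξ f conn β) +
        symι G φ ⊗ₜ[ℝ] ((1 - cutoffForm f) * hor ξ f conn β) := by
  have h : symι G φ ⊗ₜ[ℝ] β = (symι G φ ⊗ₜ[ℝ] (1 : Form I W)) * (1 ⊗ₜ[ℝ] β) := by
    rw [Algebra.TensorProduct.tmul_mul_tmul, one_mul, mul_one]
  rw [h, rMap_mul, rMap_symι, rMap_one_tmul, degCurvature_apply, sub_mul,
    Algebra.TensorProduct.tmul_mul_tmul, Algebra.TensorProduct.tmul_mul_tmul, one_mul, mul_one,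
    sub_eq_add_neg, ← TensorProduct.tmul_neg, ← neg_mul, neg_add_rev, neg_neg,
    neg_add_eq_sub]

/-- The failure of `r_f^G` to commute with `D` is controlled by the infinitesimal action. -/
theorem cartanD_rMap [T2Space W] (α : Cartan EG G I W) :
    cartanD G I W ξ (rMap ξ f conn α) = rMap ξ f conn (cartanD G I W ξ α) +
      ∑ a, (1 ⊗ₜ[ℝ] degConn f conn (ξ.coord a)) * rMap ξ f conn (cartanLie I W (ξ a) α) := by
  induction α using Cartan.induction with
  | hsym φ =>
    have h0 : cartanD G I W ξ (symι G φ ⊗ₜ[ℝ] (1 : Form I W)) = 0 := by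
      rw [cartanD_tmul, extD_one]
      simp only [iota_one, TensorProduct.tmul_zero, Finset.sum_const_zero, sub_zero]
    have h1 : ∀ a, (1 ⊗ₜ[ℝ] degConn f conn (ξ.coord a)) *
        rMap ξ f conn (cartanLie I W (ξ a) (symι G φ ⊗ₜ[ℝ] (1 : Form I W))) =
        -((1 : Sym EG G) ⊗ₜ[ℝ] (degConn f conn (ξ.coord a) * curvForm ξ f conn (lieDual (ξ a) φ))) -
        symι G (lieDual (ξ a) φ) ⊗ₜ[ℝ] ((1 - cutoffForm f) * degConn f conn (ξ.coord a)) := by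
      intro a
      rw [cartanLie_tmul, lieD_one, TensorProduct.tmul_zero, add_zero, lieSym_symι,
        TensorProduct.neg_tmul, map_neg, rMap_symι_tmul, hor_one, mul_one, mul_one, mul_neg,
        mul_add, Algebra.TensorProduct.tmul_mul_tmul, Algebra.TensorProduct.tmul_mul_tmul, one_mul,
        one_mul, neg_add', mul_sub, sub_mul, cutoffForm_comm, one_mul, mul_one]
    have h2 : ∑ a, symι G (ξ.coord a) ⊗ₜ[ℝ] iota G I W (ξ a) (curvForm ξ f conn φ) =
        ∑ a, symι G (lieDual (ξ a) φ) ⊗ₜ[ℝ] ((1 - cutoffForm f) * degConn f conn (ξ.coord a)) -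
          symι G φ ⊗ₜ[ℝ] extD I W (cutoffForm f) := by
      have h3 : ∑ a, symι G (ξ.coord a) ⊗ₜ[ℝ] (φ (ξ a) • extD I W (cutoffForm f)) =
          symι G φ ⊗ₜ[ℝ] extD I W (cutoffForm f) := by
        conv_rhs => rw [dual_eq_sum ξ φ, map_sum, TensorProduct.sum_tmul]
        refine Finset.sum_congr rfl fun a _ => ?_
        rw [map_smul, TensorProduct.smul_tmul]
      have h4 : ∑ a, symι G (ξ.coord a) ⊗ₜ[ℝ]
            ((1 - cutoffForm f) * degConn f conn (lieDual (ξ a) φ)) =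
          -∑ a, symι G (lieDual (ξ a) φ) ⊗ₜ[ℝ]
            ((1 - cutoffForm f) * degConn f conn (ξ.coord a)) := by
        simp only [degConn_lieDual ξ, symι_lieDual ξ, Finset.mul_sum, mul_smul_comm,
          TensorProduct.tmul_sum, TensorProduct.sum_tmul]
        rw [Finset.sum_comm, ← Finset.sum_neg_distrib]
        refine Finset.sum_congr rfl fun a _ => ?_
        rw [← Finset.sum_neg_distrib]
        refine Finset.sum_congr rfl fun b _ => ?_
        rw [← lie_skew, map_neg, neg_smul, TensorProduct.tmul_neg, TensorProduct.smul_tmul]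
      simp only [iota_curvForm, TensorProduct.tmul_sub, TensorProduct.tmul_neg,
        Finset.sum_sub_distrib, Finset.sum_neg_distrib]
      rw [h3, h4, neg_neg]
    rw [h0, map_zero, zero_add, Finset.sum_congr rfl fun a _ => h1 a, Finset.sum_sub_distrib,
      Finset.sum_neg_distrib, ← TensorProduct.tmul_sum, ← TensorProduct.tmul_neg, ← extD_curvForm,
      rMap_symι, degCurvature_apply, map_sub, cartanD_tmul, cartanD_tmul]
    simp only [mul_one, h2, map_add, map_neg, iota_one, iota_cutoffForm, extD_one, neg_zero,
      zero_add, TensorProduct.tmul_zero, Finset.sum_const_zero]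
    abel
  | hform β =>
    have h := horDefect_eq_zero ξ f conn β
    have h1 : ∀ a, (1 ⊗ₜ[ℝ] degConn f conn (ξ.coord a)) *
        rMap ξ f conn (cartanLie I W (ξ a) ((1 : Sym EG G) ⊗ₜ[ℝ] β)) =
        1 ⊗ₜ[ℝ] (degConn f conn (ξ.coord a) * hor ξ f conn (lieD G I W (ξ a) β)) := by
      intro a
      rw [cartanLie_tmul, lieSym_one, TensorProduct.zero_tmul, zero_add, rMap_one_tmul,
        Algebra.TensorProduct.tmul_mul_tmul, one_mul]
    rw [Finset.sum_congr rfl fun a _ => h1 a, rMap_one_tmul, cartanD_tmul, cartanD_tmul, map_sub,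
      map_sum, rMap_one_tmul]
    simp only [mul_one, rMap_symι_tmul, iota_hor, Finset.sum_add_distrib]
    rw [← TensorProduct.tmul_sum, ← TensorProduct.tmul_sum]
    have h2 : extD I W (hor ξ f conn β) = hor ξ f conn (extD I W β) -
        ∑ a, curvForm ξ f conn (ξ.coord a) * hor ξ f conn (iota G I W (ξ a) β) +
        ∑ a, degConn f conn (ξ.coord a) * hor ξ f conn (lieD G I W (ξ a) β) := by
      rw [horDefect] at h
      rw [← sub_eq_zero, ← h]
      abel
    rw [h2, TensorProduct.tmul_add, TensorProduct.tmul_sub]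
    abel
  | hadd α β hα hβ =>
    simp only [map_add, mul_add, Finset.sum_add_distrib, hα, hβ]
    abel
  | hmul α β hα hβ =>
    have h1 : ∀ a, (1 ⊗ₜ[ℝ] degConn f conn (ξ.coord a)) *
        rMap ξ f conn (cartanLie I W (ξ a) (α * β)) =
        (1 ⊗ₜ[ℝ] degConn f conn (ξ.coord a)) * rMap ξ f conn (cartanLie I W (ξ a) α) *
          rMap ξ f conn β + cartanParity EG G I W (rMap ξ f conn α) *
          ((1 ⊗ₜ[ℝ] degConn f conn (ξ.coord a)) * rMap ξ f conn (cartanLie I W (ξ a) β)) := by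
      intro a
      rw [cartanLie_mul, map_add, rMap_mul, rMap_mul, mul_add, ← mul_assoc, ← mul_assoc,
        ← mul_assoc, one_tmul_degConn_mul f conn _ (rMap ξ f conn α)]
    rw [Finset.sum_congr rfl fun a _ => h1 a, Finset.sum_add_distrib, ← Finset.sum_mul,
      ← Finset.mul_sum, rMap_mul, cartanD_mul, cartanD_mul, hα, hβ, map_add, rMap_mul, rMap_mul,
      cartanParity_rMap, add_mul, mul_add]
    abel

end CartanModel

section InfinitesimalInvariance

variable {EG : Type*} [NormedAddCommGroup EG] [NormedSpace ℝ EG] [FiniteDimensional ℝ EG]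
  {G : Type*} [TopologicalSpace G] [ChartedSpace EG G] [Group G] [LieGroup 𝓘(ℝ, EG) ∞ G]
  {E : Type*} [NormedAddCommGroup E] [NormedSpace ℝ E] [FiniteDimensional ℝ E]
  {H : Type*} [TopologicalSpace H] {I : ModelWithCorners ℝ E H}
  {W : Type*} [TopologicalSpace W] [ChartedSpace H W] [IsManifold I ∞ W]
  [MulAction G W] [ContMDiffSMul 𝓘(ℝ, EG) I ∞ G W]
  {k : ℕ} (ξ : Module.Basis (Fin k) ℝ (LieAlg EG G))

/-- Evaluation of a polynomial on `𝔤` at `p`. -/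
def symEv (p : LieAlg EG G) : Sym EG G →ₐ[ℝ] ℝ :=
  symLift (Module.Dual.eval ℝ (LieAlg EG G) p)

theorem symEv_symι (p : LieAlg EG G) (φ : LieDual EG G) : symEv p (symι G φ) = φ p :=
  symLift_symι _ _

include ξ in
/-- A polynomial on `𝔤` that vanishes at every point is zero. -/
theorem eq_zero_of_symEv (s : Sym EG G) (h : ∀ p, symEv p s = 0) : s = 0 := by
  let e : Sym EG G ≃ₐ[ℝ] MvPolynomial (Fin k) ℝ := SymmetricAlgebra.equivMvPolynomial ξ.dualBasis
  have he : ∀ p (s : Sym EG G), MvPolynomial.eval (fun a => ξ.coord a p) (e s) = symEv p s := by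
    intro p s
    induction s using Sym.induction with
    | halg r =>
      rw [AlgEquiv.commutes, AlgHom.commutes]
      exact MvPolynomial.eval_C r
    | hι φ =>
      have h1 : ∀ a, e (symι G (ξ.coord a)) = MvPolynomial.X a := fun a => by
        have h2 : ξ.dualBasis a = ξ.coord a := by rw [Module.Basis.coe_dualBasis]
        rw [← h2]
        exact SymmetricAlgebra.equivMvPolynomial_ι_apply ξ.dualBasis a
      rw [dual_eq_sum ξ φ]
      simp only [map_sum, map_smul, h1, symEv_symι, MvPolynomial.smul_eval, MvPolynomial.eval_X,
        smul_eq_mul]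
    | hmul s t hs ht => rw [map_mul, map_mul, map_mul, hs, ht]
    | hadd s t hs ht => rw [map_add, map_add, map_add, hs, ht]
  refine (map_eq_zero_iff e e.injective).mp (MvPolynomial.funext fun v => ?_)
  have hv : v = fun a => ξ.coord a (∑ b, v b • ξ b) := by
    funext a
    rw [map_sum, Finset.sum_eq_single a]
    · simp
    · intro b _ hb
      simp [hb]
    · simp
  rw [hv, he, h, map_zero]

variable (I W) in
/-- Evaluation of an element of `S(𝔤*) ⊗ Ω(W)` at a point of `𝔤` and a point of `W`. -/
def cartanEv (p : LieAlg EG G) (x : W) : Cartan EG G I W →ₗ[ℝ] Ext E :=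
  TensorProduct.lift ((LinearMap.lsmul ℝ (Ext E)).compl₁₂ (symEv p).toLinearMap
    (LinearMap.proj x ∘ₗ (Form.val I W).toLinearMap))

theorem cartanEv_tmul (p : LieAlg EG G) (x : W) (s : Sym EG G) (β : Form I W) :
    cartanEv I W p x (s ⊗ₜ[ℝ] β) = symEv p s • Form.val I W β x := rfl

include ξ in
theorem eq_zero_of_cartanEv (α : Cartan EG G I W) (h : ∀ p x, cartanEv I W p x α = 0) :
    α = 0 := by
  let b := Module.Basis.ofVectorSpace ℝ (Sym EG G)
  obtain ⟨c, rfl⟩ := TensorProduct.eq_repr_basis_left b α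
  have hc : c = 0 := by
    refine Finsupp.ext fun i => Form.ext fun x => ?_
    rw [Finsupp.zero_apply, map_zero, Pi.zero_apply]
    refine (Module.forall_dual_apply_eq_zero_iff ℝ _).mp fun l => ?_
    let m : Form I W →ₗ[ℝ] ℝ := l ∘ₗ LinearMap.proj x ∘ₗ (Form.val I W).toLinearMap
    have hq : b.repr.symm (c.mapRange m (map_zero m)) = 0 := by
      refine eq_zero_of_symEv ξ _ fun p => ?_
      have h2 := congrArg l (h p x)
      rw [map_finsuppSum, map_finsuppSum, map_zero] at h2
      rw [Module.Basis.repr_symm_apply, Finsupp.linearCombination_apply,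
        Finsupp.sum_mapRange_index (fun i => zero_smul ℝ (b i)), map_finsuppSum, ← h2]
      refine Finsupp.sum_congr fun j _ => ?_
      rw [cartanEv_tmul, map_smul, map_smul, smul_eq_mul, smul_eq_mul, mul_comm]
      rfl
    have h3 := DFunLike.congr_fun ((map_eq_zero_iff _ b.repr.symm.injective).mp hq) i
    exact h3
  rw [hc, Finsupp.sum_zero_index]

theorem symAct_symι (g : G) (φ : LieDual EG G) : symAct g (symι G φ) = symι G (φ ∘ₗ Ad g⁻¹) :=
  symLift_symι _ _

theorem symAct_one (s : Sym EG G) : symAct (1 : G) s = s := by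
  induction s using Sym.induction with
  | halg r => exact AlgHom.commutes _ r
  | hι φ =>
    rw [symAct_symι, inv_one]
    congr 1
    exact LinearMap.ext fun η => congrArg φ (Ad_one η)
  | hmul s t hs ht => rw [map_mul, hs, ht]
  | hadd s t hs ht => rw [map_add, hs, ht]

theorem hasDerivAt_symAct (ζ p : LieAlg EG G) (s : Sym EG G) :
    HasDerivAt (fun t => symEv p (symAct (chartCurve (toModel ζ) t : G)⁻¹ s))
      (-symEv p (lieSym ζ s)) 0 := by
  induction s using Sym.induction with
  | halg r =>
    simp only [AlgHom.commutes, lieSym_algebraMap, map_zero, neg_zero]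
    exact hasDerivAt_const _ _
  | hι φ =>
    simp only [symAct_symι, inv_inv, symEv_symι, lieSym_symι, map_neg, neg_neg]
    exact hasDerivAt_dual_Ad φ ζ p
  | hmul s t hs ht =>
    have h := hs.mul ht
    simp only [chartCurve_zero, inv_one, symAct_one] at h
    simp only [map_mul, lieSym_mul, map_add, neg_add]
    refine h.congr_deriv ?_
    ring
  | hadd s t hs ht =>
    simp only [map_add, neg_add]
    exact hs.add ht

theorem cartanAct_tmul (g : G) (s : Sym EG G) (β : Form I W) :
    cartanAct I W g (s ⊗ₜ[ℝ] β) = symAct g s ⊗ₜ[ℝ] pullAct EG I W g⁻¹ β := rfl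

theorem hasDerivAt_cartanAct [T2Space W] (ζ p : LieAlg EG G) (x : W) (α : Cartan EG G I W) :
    HasDerivAt (fun t => cartanEv I W p x (cartanAct I W (chartCurve (toModel ζ) t : G)⁻¹ α))
      (-cartanEv I W p x (cartanLie I W ζ α)) 0 := by
  induction α using TensorProduct.induction_on with
  | zero =>
    simp only [map_zero, neg_zero]
    exact hasDerivAt_const _ _
  | add x y hx hy =>
    simp only [map_add, neg_add]
    exact hx.add hy
  | tmul s β =>
    have h := (hasDerivAt_symAct ζ p s).smul (hasDerivAt_val_pullAct ζ x β)
    simp only [chartCurve_zero, inv_one, symAct_one, pullAct_one] at h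
    simp only [cartanAct_tmul, cartanEv_tmul, inv_inv, cartanLie_tmul, map_add]
    refine h.congr_deriv ?_
    rw [neg_add, smul_neg, neg_smul, add_comm]

include ξ in
/-- Invariant elements are infinitesimally invariant. -/
theorem cartanLie_eq_zero [T2Space W] {α : Cartan EG G I W} (hα : α ∈ equivForms EG G I W)
    (ζ : LieAlg EG G) : cartanLie I W ζ α = 0 := by
  refine eq_zero_of_cartanEv ξ _ fun p x => ?_
  have h := hasDerivAt_cartanAct ζ p x α
  have h2 : (fun t => cartanEv I W p x (cartanAct I W (chartCurve (toModel ζ) t : G)⁻¹ α)) =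
      fun _ => cartanEv I W p x α := by
    funext t
    rw [hα]
  rw [h2] at h
  exact neg_eq_zero.mp (h.unique (hasDerivAt_const _ _))

end InfinitesimalInvariance

section Equivariance

variable {EG : Type*} [NormedAddCommGroup EG] [NormedSpace ℝ EG] [FiniteDimensional ℝ EG]
  {G : Type*} [TopologicalSpace G] [ChartedSpace EG G] [Group G] [LieGroup 𝓘(ℝ, EG) ∞ G]
  {E : Type*} [NormedAddCommGroup E] [NormedSpace ℝ E] [FiniteDimensional ℝ E]
  {H : Type*} [TopologicalSpace H] {I : ModelWithCorners ℝ E H}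
  {W : Type*} [TopologicalSpace W] [ChartedSpace H W] [IsManifold I ∞ W]
  [MulAction G W] [ContMDiffSMul 𝓘(ℝ, EG) I ∞ G W]
  {k : ℕ} (ξ : Module.Basis (Fin k) ℝ (LieAlg EG G))
  (f : Cutoff G I W) (conn : Connection (EG := EG) G I W)

theorem sum_coord_comp {V : Type*} [AddCommGroup V] [Module ℝ V]
    (B : LieDual EG G →ₗ[ℝ] LieAlg EG G →ₗ[ℝ] V) (A : LieAlg EG G →ₗ[ℝ] LieAlg EG G) :
    ∑ a, B (ξ.coord a ∘ₗ A) (ξ a) = ∑ a, B (ξ.coord a) (A (ξ a)) := by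
  have h1 : ∀ a, B (ξ.coord a ∘ₗ A) (ξ a) = ∑ c, ξ.coord a (A (ξ c)) • B (ξ.coord c) (ξ a) := by
    intro a
    conv_lhs => rw [dual_eq_sum ξ (ξ.coord a ∘ₗ A)]
    simp only [map_sum, map_smul, LinearMap.sum_apply, LinearMap.smul_apply, LinearMap.comp_apply]
  have h2 : ∀ c, B (ξ.coord c) (A (ξ c)) = ∑ a, ξ.coord a (A (ξ c)) • B (ξ.coord c) (ξ a) := by
    intro c
    conv_lhs => rw [← ξ.sum_repr (A (ξ c))]
    simp only [map_sum, map_smul, Module.Basis.coord_apply]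
  simp only [h1, h2]
  exact Finset.sum_comm

theorem sum_smul_coord_comp {V : Type*} [AddCommGroup V] [Module ℝ V] (l : LieDual EG G)
    (L : LieDual EG G →ₗ[ℝ] V) (A : LieAlg EG G →ₗ[ℝ] LieAlg EG G) :
    ∑ a, l (ξ a) • L (ξ.coord a ∘ₗ A) = ∑ a, l (A (ξ a)) • L (ξ.coord a) :=
  sum_coord_comp ξ ((LinearMap.lsmul ℝ V).flip.compl₁₂ L l) A

theorem pullAct_algebraMap (g : G) (r : ℝ) :
    pullAct EG I W g (algebraMap ℝ (Form I W) r) = algebraMap ℝ _ r := pullback_algebraMap _ _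

theorem pullAct_map_one (g : G) : pullAct EG I W g (1 : Form I W) = 1 := by
  rw [← map_one (algebraMap ℝ (Form I W)), pullAct_algebraMap]

theorem cartanAct_mul (g : G) (α β : Cartan EG G I W) :
    cartanAct I W g (α * β) = cartanAct I W g α * cartanAct I W g β := by
  induction α using TensorProduct.induction_on with
  | zero => simp only [zero_mul, map_zero]
  | add x y hx hy => rw [add_mul, map_add, hx, hy, map_add, add_mul]
  | tmul s γ =>
    induction β using TensorProduct.induction_on with
    | zero => simp only [mul_zero, map_zero]
    | add x y hx hy => rw [mul_add, map_add, hx, hy, map_add, mul_add]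
    | tmul t δ =>
      rw [Algebra.TensorProduct.tmul_mul_tmul, cartanAct_tmul, cartanAct_tmul, cartanAct_tmul,
        Algebra.TensorProduct.tmul_mul_tmul, map_mul, pullAct_mul]

theorem cartanAct_cartanD (g : G) (α : Cartan EG G I W) :
    cartanAct I W g (cartanD G I W ξ α) = cartanD G I W ξ (cartanAct I W g α) := by
  induction α using TensorProduct.induction_on with
  | zero => simp only [map_zero]
  | add x y hx hy => simp only [map_add, hx, hy]
  | tmul s β =>
    have h := sum_coord_comp ξ ((TensorProduct.mk ℝ (Sym EG G) (Form I W)).compl₁₂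
      (LinearMap.mulRight ℝ (symAct g s) ∘ₗ symι G)
      (pullAct EG I W g⁻¹ ∘ₗ (iotaLin G I W).flip β)) (Ad g⁻¹)
    have h2 : ∑ a, (symι G (ξ.coord a ∘ₗ Ad g⁻¹) * symAct g s) ⊗ₜ[ℝ]
        pullAct EG I W g⁻¹ (iota G I W (ξ a) β) = ∑ a, (symι G (ξ.coord a) * symAct g s) ⊗ₜ[ℝ]
        pullAct EG I W g⁻¹ (iota G I W (Ad g⁻¹ (ξ a)) β) := h
    rw [cartanD_tmul, map_sub, map_sum, cartanAct_tmul, cartanAct_tmul, cartanD_tmul, pullAct_extD]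
    simp only [cartanAct_tmul, map_mul, symAct_symι, iota_pullAct]
    rw [h2]

theorem pullAct_curvForm (g : G) (φ : LieDual EG G) :
    pullAct EG I W g (curvForm ξ f conn φ) = curvForm ξ f conn (φ ∘ₗ Ad g) := by
  have h1 : ∀ b, ∑ c, φ ⁅ξ b, ξ c⁆ •
      (degConn f conn (ξ.coord b ∘ₗ Ad g) * degConn f conn (ξ.coord c ∘ₗ Ad g)) =
      ∑ c, φ ⁅ξ b, Ad g (ξ c)⁆ •
        (degConn f conn (ξ.coord b ∘ₗ Ad g) * degConn f conn (ξ.coord c)) := fun b =>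
    sum_smul_coord_comp ξ (lieDual (ξ b) φ)
      (LinearMap.mulLeft ℝ (degConn f conn (ξ.coord b ∘ₗ Ad g)) ∘ₗ degConn f conn) (Ad g)
  have h2 : ∀ c, ∑ b, φ ⁅ξ b, Ad g (ξ c)⁆ •
        (degConn f conn (ξ.coord b ∘ₗ Ad g) * degConn f conn (ξ.coord c)) =
      ∑ b, φ ⁅Ad g (ξ b), Ad g (ξ c)⁆ •
        (degConn f conn (ξ.coord b) * degConn f conn (ξ.coord c)) := fun c => by
    have h3 := sum_smul_coord_comp ξ (-lieDual (Ad g (ξ c)) φ)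
      (LinearMap.mulRight ℝ (degConn f conn (ξ.coord c)) ∘ₗ degConn f conn) (Ad g)
    have h4 : ∀ η, (-lieDual (Ad g (ξ c)) φ) η = φ ⁅η, Ad g (ξ c)⁆ := fun η => by
      rw [LinearMap.neg_apply, lieDual_apply, ← lie_skew, map_neg, neg_neg]
    simp only [h4] at h3
    exact h3
  rw [curvForm_apply, curvForm_apply, map_add, pullAct_extD, pullAct_degConn, map_smul]
  congr 2
  simp only [map_sum, map_smul, pullAct_mul, pullAct_degConn, h1]
  rw [Finset.sum_comm]
  simp only [h2]
  rw [Finset.sum_comm]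
  simp only [LinearMap.comp_apply, Ad_lie]

theorem cartanAct_rMap (g : G) (α : Cartan EG G I W) :
    cartanAct I W g (rMap ξ f conn α) = rMap ξ f conn (cartanAct I W g α) := by
  induction α using Cartan.induction with
  | hsym φ =>
    rw [cartanAct_tmul, symAct_symι, pullAct_map_one, rMap_symι, rMap_symι, degCurvature_apply,
      degCurvature_apply, map_sub, cartanAct_tmul, cartanAct_tmul, map_one, symAct_symι,
      pullAct_curvForm, map_add, map_neg, pullAct_map_one, pullAct_cutoffForm]
  | hform β =>
    rw [rMap_one_tmul, cartanAct_tmul, cartanAct_tmul, map_one, rMap_one_tmul, pullAct_hor]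
  | hadd α β hα hβ => rw [map_add, map_add, hα, hβ, map_add, map_add]
  | hmul α β hα hβ => rw [rMap_mul, cartanAct_mul, hα, hβ, cartanAct_mul, rMap_mul]

end Equivariance

section Degree

variable {EG : Type*} [NormedAddCommGroup EG] [NormedSpace ℝ EG] [FiniteDimensional ℝ EG]
  {G : Type*} [TopologicalSpace G] [ChartedSpace EG G] [Group G] [LieGroup 𝓘(ℝ, EG) ∞ G]
  {E : Type*} [NormedAddCommGroup E] [NormedSpace ℝ E] [FiniteDimensional ℝ E]
  {H : Type*} [TopologicalSpace H] {I : ModelWithCorners ℝ E H}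
  {W : Type*} [TopologicalSpace W] [ChartedSpace H W] [IsManifold I ∞ W]
  [MulAction G W] [ContMDiffSMul 𝓘(ℝ, EG) I ∞ G W]
  {k : ℕ} (ξ : Module.Basis (Fin k) ℝ (LieAlg EG G))
  (f : Cutoff G I W) (conn : Connection (EG := EG) G I W)

theorem formDegree_mul {p q : ℕ} {α β : Form I W} (hα : α ∈ formDegree I W p)
    (hβ : β ∈ formDegree I W q) : α * β ∈ formDegree I W (p + q) := fun x => by
  rw [map_mul, Pi.mul_apply, ExteriorAlgebra.exteriorPower, pow_add]
  exact Submodule.mul_mem_mul (hα x) (hβ x)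

theorem algebraMap_mem_exteriorPower_zero (r : ℝ) :
    algebraMap ℝ (Ext E) r ∈ ⋀[ℝ]^0 (Module.Dual ℝ E) := by
  rw [ExteriorAlgebra.exteriorPower, pow_zero]
  exact Submodule.mem_one.mpr ⟨r, rfl⟩

theorem one_mem_formDegree : (1 : Form I W) ∈ formDegree I W 0 := fun x => by
  rw [map_one, Pi.one_apply, ← map_one (algebraMap ℝ (Ext E))]
  exact algebraMap_mem_exteriorPower_zero 1

theorem cutoffForm_mem_formDegree : cutoffForm f ∈ formDegree I W 0 := fun x =>
  algebraMap_mem_exteriorPower_zero (f.toFun x)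

theorem degConn_mem_formDegree (φ : LieDual EG G) : degConn f conn φ ∈ formDegree I W 1 := by
  intro x
  rw [val_degConn, ExteriorAlgebra.exteriorPower, pow_one]
  exact LinearMap.mem_range_self _ _

theorem extD_degConn_mem_formDegree (φ : LieDual EG G) :
    extD I W (degConn f conn φ) ∈ formDegree I W 2 := by
  intro x
  have hι : ∀ y : E, ∃ ψ : Module.Dual ℝ E,
      chartRep I (Form.val I W (degConn f conn φ)) x y = ExteriorAlgebra.ι ℝ ψ := fun y =>
    ⟨_, extPull_ι _ _⟩
  have hd : ∀ v : E, ∃ ψ : Module.Dual ℝ E,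
      fderivWithin ℝ (chartRep I (Form.val I W (degConn f conn φ)) x) (range I)
        (extChartAt I x x) v = ExteriorAlgebra.ι ℝ ψ := fun v =>
    fderivWithin_mem_range_ι (I.uniqueDiffOn _ (mem_range_self _))
      (((degConn f conn φ).smooth x).differentiableWithinAt (by simp)) hι v
  change extPull (chartD I x x) (∑ i, _) ∈ _
  rw [map_sum]
  refine Submodule.sum_mem _ fun i _ => ?_
  obtain ⟨ψ, hψ⟩ := hd (Module.finBasis ℝ E i)
  rw [hψ, map_mul, extPull_ι, extPull_ι, ExteriorAlgebra.exteriorPower, pow_two]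
  exact Submodule.mul_mem_mul (LinearMap.mem_range_self _ _) (LinearMap.mem_range_self _ _)

theorem curvForm_mem_formDegree (φ : LieDual EG G) : curvForm ξ f conn φ ∈ formDegree I W 2 := by
  rw [curvForm_apply]
  refine add_mem (extD_degConn_mem_formDegree f conn φ) (Submodule.smul_mem _ _ ?_)
  exact Submodule.sum_mem _ fun b _ => Submodule.sum_mem _ fun c _ => Submodule.smul_mem _ _
    (formDegree_mul (degConn_mem_formDegree f conn _) (degConn_mem_formDegree f conn _))

theorem hor_mem_formDegree {q : ℕ} {β : Form I W} (hβ : β ∈ formDegree I W q) :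
    hor ξ f conn β ∈ formDegree I W q := fun x => by
  rw [val_hor]
  exact extPull_mem_exteriorPower _ (hβ x)

theorem tmul_mem_cartanDegree {p q n : ℕ} (hn : 2 * p + q = n) {s : Sym EG G} {β : Form I W}
    (hs : s ∈ LinearMap.range (symι (EG := EG) G) ^ p) (hβ : β ∈ formDegree I W q) :
    s ⊗ₜ[ℝ] β ∈ cartanDegree EG G I W n :=
  Submodule.mem_iSup_of_mem p (Submodule.mem_iSup_of_mem q (Submodule.mem_iSup_of_mem hn
    (Submodule.apply_mem_map₂ _ hs hβ)))

theorem cartanDegree_le {n : ℕ} {N : Submodule ℝ (Cartan EG G I W)}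
    (h : ∀ p q, 2 * p + q = n → ∀ s ∈ LinearMap.range (symι (EG := EG) G) ^ p,
      ∀ β ∈ formDegree I W q, s ⊗ₜ[ℝ] β ∈ N) : cartanDegree EG G I W n ≤ N :=
  iSup_le fun p => iSup_le fun q => iSup_le fun hn => Submodule.map₂_le.mpr (h p q hn)

theorem cartanDegree_mul {m n : ℕ} {α β : Cartan EG G I W} (hα : α ∈ cartanDegree EG G I W m)
    (hβ : β ∈ cartanDegree EG G I W n) : α * β ∈ cartanDegree EG G I W (m + n) := by
  have h1 : cartanDegree EG G I W m ≤
      (cartanDegree EG G I W (m + n)).comap (LinearMap.mulRight ℝ β) := by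
    refine cartanDegree_le fun p q hm s hs γ hγ => ?_
    have h2 : cartanDegree EG G I W n ≤
        (cartanDegree EG G I W (m + n)).comap (LinearMap.mulLeft ℝ (s ⊗ₜ[ℝ] γ)) := by
      refine cartanDegree_le fun p' q' hn t ht δ hδ => ?_
      rw [Submodule.mem_comap, LinearMap.mulLeft_apply, Algebra.TensorProduct.tmul_mul_tmul]
      refine tmul_mem_cartanDegree (p := p + p') (q := q + q') (by omega) ?_
        (formDegree_mul hγ hδ)
      rw [pow_add]
      exact Submodule.mul_mem_mul hs ht
    exact h2 hβ
  exact h1 hα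

theorem one_tmul_mem_cartanDegree {q : ℕ} {β : Form I W} (hβ : β ∈ formDegree I W q) :
    (1 : Sym EG G) ⊗ₜ[ℝ] β ∈ cartanDegree EG G I W q :=
  tmul_mem_cartanDegree (p := 0) (by omega) (by rw [pow_zero]; exact Submodule.one_le.mp le_rfl) hβ

theorem degCurvature_mem_cartanDegree (φ : LieDual EG G) :
    degCurvature ξ f conn φ ∈ cartanDegree EG G I W 2 := by
  rw [degCurvature_apply]
  refine sub_mem (one_tmul_mem_cartanDegree (curvForm_mem_formDegree ξ f conn φ))
    (tmul_mem_cartanDegree (p := 1) (q := 0) rfl ?_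
      (add_mem (neg_mem one_mem_formDegree) (cutoffForm_mem_formDegree f)))
  rw [pow_one]
  exact LinearMap.mem_range_self _ _

theorem rMap_sym_mem_cartanDegree (p : ℕ) {s : Sym EG G}
    (hs : s ∈ LinearMap.range (symι (EG := EG) G) ^ p) :
    rMap ξ f conn (s ⊗ₜ[ℝ] (1 : Form I W)) ∈ cartanDegree EG G I W (2 * p) := by
  induction p generalizing s with
  | zero =>
    rw [pow_zero] at hs
    obtain ⟨r, rfl⟩ := Submodule.mem_one.mp hs
    rw [Algebra.algebraMap_eq_smul_one, ← TensorProduct.smul_tmul', map_smul, rMap_one_tmul,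
      hor_one]
    exact Submodule.smul_mem _ _ (one_tmul_mem_cartanDegree one_mem_formDegree)
  | succ p ih =>
    rw [pow_succ'] at hs
    induction hs using Submodule.mul_induction_on' with
    | mem_mul_mem t ht u hu =>
      obtain ⟨φ, rfl⟩ := ht
      have h : (symι G φ * u) ⊗ₜ[ℝ] (1 : Form I W) = (symι G φ ⊗ₜ[ℝ] 1) * (u ⊗ₜ[ℝ] 1) := by
        rw [Algebra.TensorProduct.tmul_mul_tmul, one_mul]
      rw [h, rMap_mul, rMap_symι, show 2 * (p + 1) = 2 + 2 * p by ring]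
      exact cartanDegree_mul (degCurvature_mem_cartanDegree ξ f conn φ) (ih hu)
    | add t _ u _ ht hu =>
      rw [TensorProduct.add_tmul, map_add]
      exact add_mem ht hu

theorem rMap_mem_cartanDegree {n : ℕ} {α : Cartan EG G I W} (hα : α ∈ cartanDegree EG G I W n) :
    rMap ξ f conn α ∈ cartanDegree EG G I W n := by
  have h : cartanDegree EG G I W n ≤ (cartanDegree EG G I W n).comap (rMap ξ f conn) := by
    refine cartanDegree_le fun p q hn s hs β hβ => ?_
    have h1 : s ⊗ₜ[ℝ] β = (s ⊗ₜ[ℝ] (1 : Form I W)) * (1 ⊗ₜ[ℝ] β) := by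
      rw [Algebra.TensorProduct.tmul_mul_tmul, one_mul, mul_one]
    rw [Submodule.mem_comap, h1, rMap_mul, rMap_one_tmul, ← hn]
    exact cartanDegree_mul (rMap_sym_mem_cartanDegree ξ f conn p hs)
      (one_tmul_mem_cartanDegree (hor_mem_formDegree ξ f conn hβ))
  exact h hα

end Degree

end DegenerateChernWeil

end

theorem theorem2p3
    {EG : Type*} [NormedAddCommGroup EG] [NormedSpace ℝ EG] [FiniteDimensional ℝ EG]
    {G : Type*} [TopologicalSpace G] [ChartedSpace EG G] [Group G] [LieGroup 𝓘(ℝ, EG) ∞ G]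
    [T2Space G] [CompactSpace G] [ConnectedSpace G]
    {E : Type*} [NormedAddCommGroup E] [NormedSpace ℝ E] [FiniteDimensional ℝ E]
    {H : Type*} [TopologicalSpace H] (I : ModelWithCorners ℝ E H)
    {W : Type*} [TopologicalSpace W] [ChartedSpace H W] [IsManifold I ∞ W]
    [T2Space W] [CompactSpace W]
    [MulAction G W] [ContMDiffSMul 𝓘(ℝ, EG) I ∞ G W]
    (hW : IsDegeneratePrincipalBundle G I W)
    {k : ℕ} (ξ : Module.Basis (Fin k) ℝ (LieAlg EG G))
    (f : Cutoff G I W) (conn : Connection (EG := EG) G I W) :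
    -- `(Ω_G(W), D)` is a complex
    (∀ α ∈ equivForms EG G I W, cartanD G I W ξ α ∈ equivForms EG G I W ∧
      cartanD G I W ξ (cartanD G I W ξ α) = 0) ∧
    -- `r_f^G` maps `Ω_G(W)` to itself and preserves the total degree
    (∀ α ∈ equivForms EG G I W, rMap ξ f conn α ∈ equivForms EG G I W) ∧
    (∀ n, ∀ α ∈ equivForms EG G I W ⊓ cartanDegree EG G I W n,
      rMap ξ f conn α ∈ cartanDegree EG G I W n) ∧
    -- `D r_f^G = r_f^G D` on `Ω_G(W)`
    (∀ α ∈ equivForms EG G I W,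
      cartanD G I W ξ (rMap ξ f conn α) = rMap ξ f conn (cartanD G I W ξ α)) ∧
    -- `r_f^G` induces a homomorphism of `H_G^*(W)`, `[z] ↦ [r_f^G z]`
    ∃! R : EquivCohomology G I W ξ →ₗ[ℝ] EquivCohomology G I W ξ,
      ∀ z : cocycles G I W ξ, ∃ hz : rMap ξ f conn z ∈ cocycles G I W ξ,
        R (Submodule.Quotient.mk z) = Submodule.Quotient.mk ⟨rMap ξ f conn z, hz⟩ := by
  have hD : ∀ α ∈ equivForms EG G I W, cartanD G I W ξ α ∈ equivForms EG G I W :=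
    fun α hα g => by rw [cartanAct_cartanD, hα g]
  have hr : ∀ α ∈ equivForms EG G I W, rMap ξ f conn α ∈ equivForms EG G I W :=
    fun α hα g => by rw [cartanAct_rMap, hα g]
  have hcomm : ∀ α ∈ equivForms EG G I W,
      cartanD G I W ξ (rMap ξ f conn α) = rMap ξ f conn (cartanD G I W ξ α) := fun α hα => by
    rw [cartanD_rMap, add_eq_left]
    refine Finset.sum_eq_zero fun a _ => ?_
    rw [cartanLie_eq_zero ξ hα, map_zero, mul_zero]
  have hz : ∀ z ∈ cocycles G I W ξ, rMap ξ f conn z ∈ cocycles G I W ξ := fun z hz =>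
    ⟨hr z hz.1, by rw [SetLike.mem_coe, LinearMap.mem_ker, hcomm z hz.1, LinearMap.mem_ker.mp hz.2, map_zero]⟩
  refine ⟨fun α hα => ⟨hD α hα, ?_⟩, hr, fun n α hα => rMap_mem_cartanDegree ξ f conn hα.2, hcomm,
    Submodule.mapQ _ _ ((rMap ξ f conn).restrict hz) ?_, fun z => ⟨hz z z.2, rfl⟩, ?_⟩
  · rw [cartanD_cartanD, neg_eq_zero]
    refine Finset.sum_eq_zero fun a _ => ?_
    rw [cartanLie_eq_zero ξ hα, mul_zero]
  · rintro z ⟨α, hα, hαz⟩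
    refine ⟨rMap ξ f conn α, hr α hα, ?_⟩
    rw [hcomm α hα, hαz]
    rfl
  · intro R hR
    refine LinearMap.ext fun c => ?_
    obtain ⟨z, rfl⟩ := Submodule.Quotient.mk_surjective _ c
    exact (hR z).choose_spec
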